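/- **Setting.** Everything is over $\mathbb C$. Let $\mathfrak g$ be a simple finite-dimensional Lie superalgebra with a non-degenerate even supersymmetric invariant bilinear form $(\cdot|\cdot)$, and let $x,f\in\mathfrak g$ be even elements such that $\operatorname{ad}x$ is diagonalizable with eigenvalues in $\frac12\mathbb Z$, $\mathfrak g=\bigoplus_{j\in\frac12\mathbb Z}\mathfrak g_j$; $[x,f]=-f$; and $\operatorname{ad}f:\mathfrak g_{1/2}\to\mathfrak g_{-1/2}$ is bijective. Put $\mathfrak g_+=\bigoplus_{j>0}\mathfrak g_j$. Let $\{a_i\},\{a^i\}$ be bases of $\mathfrak g$ consisting of parity-homogeneous elements with $(a_i|a^j)=\delta_{ij}$, let $h^\vee$ be one half of the eigenvalue of $\sum_i(-1)^{p(a_i)}a_ia^i$ in the adjoint representation, and let $k\in\mathbb C$ with $k+h^\vee\ne0$. Let $\{u_i\}_{i\in\tilde S}$ be a basis of $\mathfrak g$ with each $u_i$ homogeneous of parity $p(u_i)$ and $[x,u_i]=m_iu_i$; let $S=\{i: m_i>0\}$, $S'=\{i: m_i=\frac12\}$. *Vertex algebra.* Let $A_{\rm ch}=\Pi(\mathfrak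 g_+\oplus\mathfrak g_+^*)$ ($\Pi$ = reversal of parity) with the skew-supersymmetric form for which $\mathfrak g_+$ and $\mathfrak g_+^*$ are isotropic and $\langle a,b^*\rangle=b^*(a)$ for $a\in\mathfrak g_+$, $b^*\in\mathfrak g_+^*$, and let $A_{\rm ne}=\mathfrak g_{1/2}$ with the form $\langle a,b\rangle=(f|[a,b])$. Let $\mathcal C=V_k(\mathfrak g)\otimes F(A_{\rm ch})\otimes F(A_{\rm ne})$ be the tensor product of the universal affine vertex algebra of level $k$, generated by the currents $a(z)=\sum_n(at^n)z^{-n-1}$, $a\in\mathfrak g$, with $[at^m,bt^n]=[a,b]t^{m+n}+m\,\delta_{m,-n}(a|b)k$, and of the vertex algebras of free superfermions generated by the fields $\Phi(z)=\sum_n(\Phi t^n)z^{-n-1}$, $\Phi\in A_{\rm ch}$ or $\Phi\in A_{\rm ne}$, with $[\Phi t^m,\Psi t^n]=\langle\Phi,\Psi\rangle\delta_{m,-n-1}$ (brackets are supercommutators). Its elements are identified with fields acting on the vacuum module, the quotient of the enveloping algebra by the left ideal generated by all $at^n$, $\Phi t^n$ with $n\ge0$; $\mathcal C(\mathfrak g,x,f,k)$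 is the smallest space of fields that contains the identity field, the currents and the fields $\Phi(z)$ and is closed under $\partial=\partial_z$ and all $n$-th products. The ghosts are the fields $\varphi_i,\varphi_i^*$ ($i\in S$) of the basis $u_i$ of $\mathfrak g_+$ and of its dual basis of $\mathfrak g_+^*$, and $\Phi_i$ ($i\in S'$) of the basis $u_i$ of $\mathfrak g_{1/2}$; $\Phi^i$ are the fields of the basis $u^i$ of $\mathfrak g_{1/2}$ with $\langle u_i,u^j\rangle=\delta_{ij}$. *Products and weights.* For fields $a(z)=\sum_na_{(n)}z^{-n-1}$ and $b(z)$, put $a(z)_{(n)}b(z)={\rm Res}_w(w-z)^n[a(w),b(z)]$ and $a_{(-n-1)}b={:}\partial^na\,b{:}/n!$ for $n\ge0$, where ${:}ab{:}=\bigl(\sum_{n<0}a_{(n)}z^{-n-1}\bigr)b(z)+(-1)^{p(a)p(b)}b(z)\sum_{n\ge0}a_{(n)}z^{-n-1}$, and $[a_\lambda b]=\sum_{n\ge0}\frac{\lambda^n}{n!}a_{(n)}b$. A pair of fields is local if $(z-w)^N[a(z),b(w)]=0$ for some $N$. An energy-momentum field of central charge $c$ is an even field $L$, local with itself, with $[L_\lambda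 L]=(\partial+2\lambda)L+\frac{\lambda^3}{12}c$. A field $a$, local with $L$, has conformal weight $\Delta$ if $[L_\lambda a]=(\partial+\Delta\lambda)a+o(\lambda)$, and is primary of conformal weight $\Delta$ if $[L_\lambda a]=(\partial+\Delta\lambda)a$. *The field $L$.* Let $L=L^{\mathfrak g}+\partial x+L^{\rm ch}+L^{\rm ne}$, where $$L^{\mathfrak g}=\frac1{2(k+h^\vee)}\sum_i(-1)^{p(a_i)}{:}a_ia^i{:},\qquad L^{\rm ne}=\frac12\sum_{i\in S'}{:}(\partial\Phi^i)\Phi_i{:},$$ $$L^{\rm ch}=-\sum_{i\in S}m_i{:}\varphi_i^*\partial\varphi_i{:}+\sum_{i\in S}(1-m_i){:}(\partial\varphi_i^*)\varphi_i{:}.$$ **Theorem.** (a) $L$ belongs to $\mathcal C(\mathfrak g,x,f,k)$ and is an energy-momentum field with central charge $$\frac{k\,\operatorname{sdim}\mathfrak g}{k+h^\vee}-12k(x|x)-\sum_{i\in S}(-1)^{p(u_i)}(12m_i^2-12m_i+2)-\frac12\operatorname{sdim}\mathfrak g_{1/2},$$ where $\operatorname{sdim}V=\dim V_{\bar0}-\dim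 V_{\bar1}$. (b) With respect to $L$, the fields $\varphi_i$ and $\varphi_i^*$ ($i\in S$) are primary of conformal weights $1-m_i$ and $m_i$ respectively, and the fields $\Phi_i$ ($i\in S'$) are primary of conformal weight $\frac12$. For $u\in\mathfrak g_j$, $j\in\frac12\mathbb Z$, the current $u(z)$ has conformal weight $1-j$, and it is primary if it is not the case that $j=0$ and $(x|u)\neq0$. -/

import Mathlib

open scoped Nat

noncomputable section

namespace QuantumReduction

/-! ## Superspaces -/

/-- A vector superspace over `ℂ`, given by its parity operator `Γ`: the even part is the
`(+1)`-eigenspace of `Γ`, the odd part is the `(-1)`-eigenspace, and `V = V₀ ⊕ V₁` because `Γ² = 1`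
(see `isCompl_homog`). -/
class SuperSpace (V : Type*) [AddCommGroup V] [Module ℂ V] where
  parity : V →ₗ[ℂ] V
  parity_parity : ∀ v, parity (parity v) = v

/-- The sign `(-1)^α` for `α ∈ ℤ/2`. -/
def sgn (α : ZMod 2) : ℂ := if α = 0 then 1 else -1

section SuperSpace

variable {V : Type*} [AddCommGroup V] [Module ℂ V] [SuperSpace V]

open SuperSpace

/-- The homogeneous part `V_α`, `α ∈ ℤ/2`, of a superspace. -/
def homog (V : Type*) [AddCommGroup V] [Module ℂ V] [SuperSpace V] (α : ZMod 2) :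
    Submodule ℂ V where
  carrier := {v | parity v = sgn α • v}
  add_mem' := by
    intro a b ha hb
    simp only [Set.mem_ofPred_eq] at ha hb ⊢
    rw [map_add, ha, hb, smul_add]
  zero_mem' := by simp
  smul_mem' := by
    intro c a ha
    simp only [Set.mem_ofPred_eq] at ha ⊢
    rw [map_smul, ha, smul_comm]

theorem mem_homog {α : ZMod 2} {v : V} : v ∈ homog V α ↔ parity v = sgn α • v := Iff.rfl

theorem sgn_mul_self (α : ZMod 2) : sgn α * sgn α = 1 := by
  unfold sgn; split_ifs <;> norm_num

theorem sgn_add (α β : ZMod 2) : sgn (α + β) = sgn α * sgn β := by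
  have h : ∀ γ : ZMod 2, γ = 0 ∨ γ = 1 := by decide
  have h10 : ¬(1 : ZMod 2) = 0 := by decide
  have h11 : (1 : ZMod 2) + 1 = 0 := by decide
  rcases h α with rfl | rfl <;> rcases h β with rfl | rfl <;> simp [sgn, h11]

/-- The projection of a vector to its component of parity `α`. -/
def comp (α : ZMod 2) (v : V) : V := (1 / 2 : ℂ) • (v + sgn α • parity v)

theorem comp_mem (α : ZMod 2) (v : V) : comp α v ∈ homog V α := by
  rw [mem_homog, comp]
  rw [map_smul, map_add, map_smul, parity_parity, smul_comm (sgn α), smul_add (sgn α), smul_smul,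
    sgn_mul_self, one_smul, add_comm]

theorem comp_add_comp (v : V) : comp 0 v + comp 1 v = v := by
  have h0 : sgn 0 = 1 := if_pos rfl
  have h1 : sgn 1 = -1 := if_neg (by decide)
  rw [comp, comp, h0, h1]
  module

theorem isCompl_homog : IsCompl (homog V 0) (homog V 1) := by
  constructor
  · rw [Submodule.disjoint_def]
    intro v h0 h1
    rw [mem_homog] at h0 h1
    have h : v = -v := by
      have := h0.symm.trans h1
      simpa [sgn] using this
    have h2 : (2 : ℂ) • v = 0 := by
      rw [two_smul]; nth_rewrite 1 [h]; simp
    simpa using h2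
  · rw [codisjoint_iff, eq_top_iff]
    intro v _
    rw [← comp_add_comp v]
    exact Submodule.add_mem_sup (comp_mem 0 v) (comp_mem 1 v)

/-- The superdimension `dim W₀ - dim W₁` of a graded subspace `W` of a superspace. -/
def sdim (W : Submodule ℂ V) : ℂ :=
  (Module.finrank ℂ ↥(W ⊓ homog V 0) : ℂ) - (Module.finrank ℂ ↥(W ⊓ homog V 1) : ℂ)

end SuperSpace

/-! ## Fields on a superspace and their products

An `End M`-valued field `a(z) = ∑ₙ a₍ₙ₎ z^{-n-1}` is a `VertexOperator ℂ M`; its mode `a₍ₙ₎` is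
`a.ncoeff n`. -/

section Fields

open SuperSpace

variable {M : Type*} [AddCommGroup M] [Module ℂ M]

/-- The field with prescribed modes `a₍ₙ₎`. -/
def ofModes (a : ℤ → Module.End ℂ M) (h : ∀ v, ∃ N : ℤ, ∀ n, N ≤ n → a n v = 0) :
    VertexOperator ℂ M :=
  VertexOperator.of_coeff (fun y => a (-y - 1)) (by
    intro v
    obtain ⟨N, hN⟩ := h v
    refine ⟨-N, ?_⟩
    intro y hy
    by_contra hlt
    exact hy (hN _ (by omega)))

theorem ncoeff_ofModes (a : ℤ → Module.End ℂ M) (h) (n : ℤ) :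
    (ofModes a h).ncoeff n = a n := by
  rw [ofModes, VertexOperator.ncoeff_of_coeff]
  congr 1
  omega

theorem exists_ncoeff_eq_zero (a : VertexOperator ℂ M) (v : M) :
    ∃ N : ℤ, ∀ n, N ≤ n → a.ncoeff n v = 0 :=
  ⟨-((HahnModule.of ℂ).symm (a v)).order, fun n hn =>
    VertexOperator.ncoeff_eq_zero_of_lt_order a n v (by omega)⟩

/-- The identity field `1`. -/
def idField : VertexOperator ℂ M :=
  ofModes (fun n => if n = -1 then 1 else 0) (by
    intro v
    refine ⟨0, fun n hn => ?_⟩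
    rw [if_neg (by omega)]
    rfl)

/-- The derivative `∂a = ∂_z a(z)`. -/
def fieldDeriv (a : VertexOperator ℂ M) : VertexOperator ℂ M :=
  ofModes (fun n => (-n : ℂ) • a.ncoeff (n - 1)) (by
    intro v
    obtain ⟨N, hN⟩ := exists_ncoeff_eq_zero a v
    refine ⟨N + 1, fun n hn => ?_⟩
    rw [LinearMap.smul_apply, hN _ (by omega), smul_zero])

variable [SuperSpace M]

/-- The component of parity `α` of an endomorphism of a superspace. -/
def part (α : ZMod 2) (T : Module.End ℂ M) : Module.End ℂ M :=
  (1 / 2 : ℂ) • (T + sgn α • (parity * T * parity))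

/-- The opposite product with the sign rule, `(-1)^{p(S)p(T)} T S` for homogeneous `S` and `T`,
extended bilinearly. -/
def swapMul (S T : Module.End ℂ M) : Module.End ℂ M :=
  ∑ α : ZMod 2, ∑ β : ZMod 2, sgn (α * β) • (part β T * part α S)

/-- The supercommutator `[S, T] = S T - (-1)^{p(S)p(T)} T S`. -/
def superComm (S T : Module.End ℂ M) : Module.End ℂ M := S * T - swapMul S T

theorem exists_part_eq_zero (a : VertexOperator ℂ M) (β : ZMod 2) (v : M) :
    ∃ N : ℤ, ∀ n, N ≤ n → part β (a.ncoeff n) v = 0 := by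
  obtain ⟨N, hN⟩ := exists_ncoeff_eq_zero a v
  obtain ⟨N', hN'⟩ := exists_ncoeff_eq_zero a (parity v)
  refine ⟨max N N', fun n hn => ?_⟩
  simp only [part, LinearMap.smul_apply, LinearMap.add_apply, Module.End.mul_apply,
    hN n (le_trans (le_max_left _ _) hn), hN' n (le_trans (le_max_right _ _) hn), map_zero,
    smul_zero, add_zero]

theorem exists_swapMul_eq_zero_right (S : Module.End ℂ M) (b : VertexOperator ℂ M) (v : M) :
    ∃ N : ℤ, ∀ n, N ≤ n → swapMul S (b.ncoeff n) v = 0 := by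
  choose N hN using fun q : ZMod 2 × ZMod 2 => exists_part_eq_zero b q.2 (part q.1 S v)
  refine ⟨∑ q, |N q|, fun n hn => ?_⟩
  have h : ∀ q, N q ≤ n := fun q =>
    (le_abs_self _).trans ((Finset.single_le_sum (f := fun q => |N q|)
      (fun _ _ => abs_nonneg _) (Finset.mem_univ q)).trans hn)
  simp only [swapMul, LinearMap.sum_apply, LinearMap.smul_apply, Module.End.mul_apply]
  exact Finset.sum_eq_zero fun α _ => Finset.sum_eq_zero fun β _ => by
    rw [hN (α, β) n (h _), smul_zero]

theorem exists_swapMul_eq_zero_left (a : VertexOperator ℂ M) (v : M) :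
    ∃ N : ℤ, ∀ n, N ≤ n → ∀ T : Module.End ℂ M, swapMul (a.ncoeff n) T v = 0 := by
  choose N hN using fun α : ZMod 2 => exists_part_eq_zero a α v
  refine ⟨∑ q, |N q|, fun n hn T => ?_⟩
  have h : ∀ q, N q ≤ n := fun q =>
    (le_abs_self _).trans ((Finset.single_le_sum (f := fun q => |N q|)
      (fun _ _ => abs_nonneg _) (Finset.mem_univ q)).trans hn)
  simp only [swapMul, LinearMap.sum_apply, LinearMap.smul_apply, Module.End.mul_apply]
  exact Finset.sum_eq_zero fun α _ => Finset.sum_eq_zero fun β _ => by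
    rw [hN α n (h _), map_zero, smul_zero]

theorem exists_superComm_eq_zero (S : Module.End ℂ M) (b : VertexOperator ℂ M) (v : M) :
    ∃ N : ℤ, ∀ n, N ≤ n → superComm S (b.ncoeff n) v = 0 := by
  obtain ⟨N, hN⟩ := exists_ncoeff_eq_zero b v
  obtain ⟨N', hN'⟩ := exists_swapMul_eq_zero_right S b v
  refine ⟨max N N', fun n hn => ?_⟩
  rw [superComm, LinearMap.sub_apply, Module.End.mul_apply,
    hN n (le_trans (le_max_left _ _) hn), hN' n (le_trans (le_max_right _ _) hn), map_zero,
    sub_zero]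

/-- The `n`-th product `a₍ₙ₎b = Res_x (x - z)ⁿ [a(x), b(z)]` for `n ≥ 0`. -/
def nonnegProd (a b : VertexOperator ℂ M) (n : ℕ) : VertexOperator ℂ M :=
  ofModes (fun m => ∑ j ∈ Finset.range (n + 1),
      ((-1) ^ j * (n.choose j : ℂ)) • superComm (a.ncoeff (n - j)) (b.ncoeff (m + j))) (by
    intro v
    choose N hN using fun j : ℕ => exists_superComm_eq_zero (a.ncoeff (n - j)) b v
    refine ⟨∑ j ∈ Finset.range (n + 1), |N j|, fun m hm => ?_⟩
    rw [LinearMap.sum_apply]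
    refine Finset.sum_eq_zero fun j hj => ?_
    rw [LinearMap.smul_apply, hN j, smul_zero]
    have h := Finset.single_le_sum (f := fun j => |N j|) (fun _ _ => abs_nonneg _) hj
    have h' := le_abs_self (N j)
    omega)

theorem finite_support_of_eventually {W : Type*} [Zero W] (f : ℕ → W) (N : ℤ)
    (h : ∀ i : ℕ, N ≤ i → f i = 0) : (Function.support f).Finite := by
  refine (Set.finite_lt_nat N.toNat).subset fun i hi => ?_
  by_contra hlt
  exact hi (h i (by simp only [Set.mem_ofPred_eq] at hlt; omega))

theorem finite_support_left (a b : VertexOperator ℂ M) (m : ℤ) (v : M) :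
    (Function.support fun i : ℕ => a.ncoeff (-1 - i) (b.ncoeff (m + i) v)).Finite := by
  obtain ⟨N, hN⟩ := exists_ncoeff_eq_zero b v
  refine finite_support_of_eventually _ (N - m) fun i hi => ?_
  rw [hN _ (by omega), map_zero]

theorem finite_support_right (a b : VertexOperator ℂ M) (m : ℤ) (v : M) :
    (Function.support fun i : ℕ => swapMul (a.ncoeff i) (b.ncoeff (m - 1 - i)) v).Finite := by
  obtain ⟨N, hN⟩ := exists_swapMul_eq_zero_left a v
  exact finite_support_of_eventually _ N fun i hi => hN _ hi _

/-- The modes of the normally ordered product: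
`:ab:₍ₘ₎ = ∑_{p < 0} a₍ₚ₎ b₍ₘ₋ₚ₋₁₎ + (-1)^{p(a)p(b)} ∑_{p ≥ 0} b₍ₘ₋ₚ₋₁₎ a₍ₚ₎`; on each vector both
sums are finite. -/
def normalProdMode (a b : VertexOperator ℂ M) (m : ℤ) : Module.End ℂ M where
  toFun v := (∑ᶠ i : ℕ, a.ncoeff (-1 - i) (b.ncoeff (m + i) v)) +
    ∑ᶠ i : ℕ, swapMul (a.ncoeff i) (b.ncoeff (m - 1 - i)) v
  map_add' v w := by
    simp only [map_add]
    rw [finsum_add_distrib (finite_support_left a b m v) (finite_support_left a b m w),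
      finsum_add_distrib (finite_support_right a b m v) (finite_support_right a b m w)]
    abel
  map_smul' c v := by
    simp only [map_smul, RingHom.id_apply]
    rw [← smul_finsum' c (finite_support_left a b m v),
      ← smul_finsum' c (finite_support_right a b m v), smul_add]

/-- The normally ordered product
`:a(z)b(z): = (∑_{n<0} a₍ₙ₎ z^{-n-1}) b(z) + (-1)^{p(a)p(b)} b(z) (∑_{n≥0} a₍ₙ₎ z^{-n-1})`. -/
def normalProd (a b : VertexOperator ℂ M) : VertexOperator ℂ M :=
  ofModes (normalProdMode a b) (by
    intro v
    obtain ⟨B, hB⟩ := exists_ncoeff_eq_zero b v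
    obtain ⟨A, hA⟩ := exists_swapMul_eq_zero_left a v
    choose N hN using fun i : ℕ => exists_swapMul_eq_zero_right (a.ncoeff i) b v
    refine ⟨|B| + ∑ i ∈ Finset.range A.toNat, (|N i| + 1 + i), fun m hm => ?_⟩
    have hs : 0 ≤ ∑ i ∈ Finset.range A.toNat, (|N i| + 1 + (i : ℤ)) :=
      Finset.sum_nonneg fun _ _ => by positivity
    have hB' := le_abs_self B
    change (∑ᶠ i : ℕ, a.ncoeff (-1 - i) (b.ncoeff (m + i) v)) +
      ∑ᶠ i : ℕ, swapMul (a.ncoeff i) (b.ncoeff (m - 1 - i)) v = 0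
    have h1 : ∀ i : ℕ, a.ncoeff (-1 - i) (b.ncoeff (m + i) v) = 0 := fun i => by
      rw [hB _ (by omega), map_zero]
    have h2 : ∀ i : ℕ, swapMul (a.ncoeff i) (b.ncoeff (m - 1 - i)) v = 0 := fun i => by
      by_cases hi : A ≤ i
      · exact hA _ hi _
      · refine hN i _ ?_
        have h := Finset.single_le_sum (f := fun i : ℕ => |N i| + 1 + (i : ℤ))
          (fun _ _ => by positivity) (Finset.mem_range.2 (show i < A.toNat by omega))
        have h' := le_abs_self (N i)
        have h'' := abs_nonneg B
        omega
    simp [h1, h2])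

/-- The `n`-th product of fields for every `n ∈ ℤ`: `a₍₋ₙ₋₁₎b = :∂ⁿa b: / n!` for `n ≥ 0`. -/
def nthProd (a b : VertexOperator ℂ M) : ℤ → VertexOperator ℂ M
  | Int.ofNat n => nonnegProd a b n
  | Int.negSucc n => ((n ! : ℂ)⁻¹) • normalProd (fieldDeriv^[n] a) b

/-- The `λ`-bracket `[a_λ b] = ∑_{n ≥ 0} λⁿ/n! a₍ₙ₎b`, as the sequence of its coefficients at the
powers of `λ`. -/
def lambdaBracket (a b : VertexOperator ℂ M) (n : ℕ) : VertexOperator ℂ M :=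
  ((n ! : ℂ)⁻¹) • nthProd a b n

/-- The polynomial `λʲ a` with coefficient a field `a`, as the sequence of its coefficients. -/
def atPower (j : ℕ) (a : VertexOperator ℂ M) (n : ℕ) : VertexOperator ℂ M :=
  if n = j then a else 0

/-- Locality: `(z - w)^N [a(z), b(w)] = 0` for some `N`, coefficient by coefficient. -/
def IsLocal (a b : VertexOperator ℂ M) : Prop :=
  ∃ N : ℕ, ∀ m n : ℤ, ∑ j ∈ Finset.range (N + 1),
    ((-1) ^ j * (N.choose j : ℂ)) • superComm (a.ncoeff (m + N - j)) (b.ncoeff (n + j)) = 0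

/-- All modes of the field preserve parity. -/
def IsEvenField (a : VertexOperator ℂ M) : Prop :=
  ∀ n, parity * a.ncoeff n = a.ncoeff n * parity

/-- `L` is an energy-momentum field with central charge `c`: an even field, local with itself, with
`[L_λ L] = (∂ + 2λ) L + (λ³/12) c`. -/
structure IsEnergyMomentumField (L : VertexOperator ℂ M) (c : ℂ) : Prop where
  even : IsEvenField L
  isLocal : IsLocal L L
  bracket : lambdaBracket L L =
    atPower 0 (fieldDeriv L) + atPower 1 ((2 : ℂ) • L) + atPower 3 ((c / 12) • idField)

/-- `a` has conformal weight `Δ` with respect to `L`: `(L, a)` is a local pair and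
`[L_λ a] = (∂ + Δ λ) a + o(λ)`. -/
structure HasConformalWeight (L a : VertexOperator ℂ M) (Δ : ℂ) : Prop where
  isLocal : IsLocal L a
  bracket_zero : lambdaBracket L a 0 = fieldDeriv a
  bracket_one : lambdaBracket L a 1 = Δ • a

/-- `a` is primary of conformal weight `Δ` with respect to `L`: `(L, a)` is a local pair and
`[L_λ a] = (∂ + Δ λ) a`. -/
structure IsPrimary (L a : VertexOperator ℂ M) (Δ : ℂ) : Prop where
  isLocal : IsLocal L a
  bracket : lambdaBracket L a = atPower 0 (fieldDeriv a) + atPower 1 (Δ • a)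

/-- The vertex algebra generated by a set of fields: the smallest space of fields which contains
the identity field and the given fields and is closed under `∂` and all `n`-th products. -/
def vertexAlgebraOf (𝒱 : Set (VertexOperator ℂ M)) : Submodule ℂ (VertexOperator ℂ M) :=
  sInf {S | idField ∈ S ∧ 𝒱 ⊆ S ∧ (∀ a ∈ S, fieldDeriv a ∈ S) ∧
    ∀ a ∈ S, ∀ b ∈ S, ∀ n : ℤ, nthProd a b n ∈ S}

end Fields

/-! ## Affinizations and their vacuum modules -/

section Affinization

open SuperSpace

/-- Data for a (Kac–Moody or Clifford) affinization of a superspace `W`: an even bracket on `W` and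
two even bilinear forms, encoding the `λ`-bracket `[a_λ b] = br a b + form₀ a b + λ form₁ a b`. -/
structure AffineData (W : Type*) [AddCommGroup W] [Module ℂ W] [SuperSpace W] where
  br : W →ₗ[ℂ] W →ₗ[ℂ] W
  form₀ : W →ₗ[ℂ] W →ₗ[ℂ] ℂ
  form₁ : W →ₗ[ℂ] W →ₗ[ℂ] ℂ
  parity_br : ∀ a b, parity (br a b) = br (parity a) (parity b)
  form₀_parity : ∀ a b, form₀ (parity a) (parity b) = form₀ a b
  form₁_parity : ∀ a b, form₁ (parity a) (parity b) = form₁ a b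

namespace AffineData

variable {W : Type*} [AddCommGroup W] [Module ℂ W] [SuperSpace W] (D : AffineData W)

/-- The central term of `[a tᵐ, b tⁿ]`. -/
def central (a b : W) (m n : ℤ) : ℂ :=
  (if m + n = -1 then D.form₀ a b else 0) + (if m + n = 0 then (m : ℂ) * D.form₁ a b else 0)

/-- The defining relations of the enveloping algebra, on generators `a tⁿ` (`a ∈ W`, `n ∈ ℤ`). -/
inductive Rel : FreeAlgebra ℂ (W × ℤ) → FreeAlgebra ℂ (W × ℤ) → Prop
  | add (a b : W) (n : ℤ) : Rel (FreeAlgebra.ι ℂ (a + b, n))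
      (FreeAlgebra.ι ℂ (a, n) + FreeAlgebra.ι ℂ (b, n))
  | smul (c : ℂ) (a : W) (n : ℤ) : Rel (FreeAlgebra.ι ℂ (c • a, n)) (c • FreeAlgebra.ι ℂ (a, n))
  | comm (α β : ZMod 2) (a b : W) (ha : a ∈ homog W α) (hb : b ∈ homog W β) (m n : ℤ) :
      Rel (FreeAlgebra.ι ℂ (a, m) * FreeAlgebra.ι ℂ (b, n))
        (sgn (α * β) • (FreeAlgebra.ι ℂ (b, n) * FreeAlgebra.ι ℂ (a, m)) +
          FreeAlgebra.ι ℂ (D.br a b, m + n) + algebraMap ℂ _ (D.central a b m n))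

/-- The universal enveloping algebra of the affinization of `W`, in which the central element acts
by the scalar built into the forms: generated by the `a tⁿ`, linear in `a`, with
`[a tᵐ, b tⁿ] = [a, b] t^{m+n} + form₀(a,b) δ_{m+n,-1} + m form₁(a,b) δ_{m+n,0}`
(supercommutator). -/
abbrev Env : Type _ := RingQuot D.Rel

/-- The element `a tⁿ` of the enveloping algebra. -/
def gen (a : W) (n : ℤ) : D.Env := RingQuot.mkAlgHom ℂ D.Rel (FreeAlgebra.ι ℂ (a, n))

theorem gen_add (a b : W) (n : ℤ) : D.gen (a + b) n = D.gen a n + D.gen b n := by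
  unfold gen
  rw [← map_add]
  exact RingQuot.mkAlgHom_rel ℂ (Rel.add a b n)

theorem gen_smul (c : ℂ) (a : W) (n : ℤ) : D.gen (c • a) n = c • D.gen a n := by
  unfold gen
  rw [← map_smul]
  exact RingQuot.mkAlgHom_rel ℂ (Rel.smul c a n)

theorem gen_mul_gen {α β : ZMod 2} {a b : W} (ha : a ∈ homog W α) (hb : b ∈ homog W β)
    (m n : ℤ) : D.gen a m * D.gen b n = sgn (α * β) • (D.gen b n * D.gen a m) +
      D.gen (D.br a b) (m + n) + algebraMap ℂ _ (D.central a b m n) := by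
  have h := RingQuot.mkAlgHom_rel ℂ (Rel.comm (D := D) α β a b ha hb m n)
  simp only [map_mul, map_add, map_smul, AlgHom.commutes] at h
  exact h

/-- The left ideal generated by all `a tⁿ` with `n ≥ 0`. -/
def vacuumIdeal : Submodule D.Env D.Env :=
  Submodule.span D.Env {u | ∃ (a : W) (n : ℤ), 0 ≤ n ∧ u = D.gen a n}

/-- The vacuum module: the enveloping algebra modulo the left ideal generated by all `a tⁿ`,
`n ≥ 0`. -/
abbrev Vacuum : Type _ := D.Env ⧸ D.vacuumIdeal.restrictScalars ℂ

/-- The parity automorphism of the enveloping algebra, `a tⁿ ↦ Γ(a) tⁿ`. -/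
def parityEnv : D.Env →ₐ[ℂ] D.Env :=
  RingQuot.liftAlgHom ℂ ⟨FreeAlgebra.lift ℂ fun q : W × ℤ => D.gen (parity q.1) q.2, by
    intro u v h
    induction h with
    | add a b n => simp only [map_add, FreeAlgebra.lift_ι_apply, gen_add]
    | smul c a n => simp only [map_smul, FreeAlgebra.lift_ι_apply, gen_smul]
    | comm α β a b ha hb m n =>
      have ha' : parity a ∈ homog W α := by
        rw [mem_homog.1 ha]; exact Submodule.smul_mem _ _ ha
      have hb' : parity b ∈ homog W β := by
        rw [mem_homog.1 hb]; exact Submodule.smul_mem _ _ hb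
      simp only [map_mul, map_add, map_smul, FreeAlgebra.lift_ι_apply, AlgHom.commutes]
      rw [D.gen_mul_gen ha' hb', D.parity_br]
      simp only [central, D.form₀_parity, D.form₁_parity]⟩

theorem parityEnv_gen (a : W) (n : ℤ) : D.parityEnv (D.gen a n) = D.gen (parity a) n := by
  simp [parityEnv, gen]

theorem parityEnv_parityEnv (u : D.Env) : D.parityEnv (D.parityEnv u) = u := by
  have h : D.parityEnv.comp D.parityEnv = AlgHom.id ℂ D.Env := by
    refine RingQuot.ringQuot_ext' ℂ _ _ (FreeAlgebra.hom_ext ?_)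
    funext q
    have := D.parityEnv_gen
    simp only [gen] at this
    simp [this, parity_parity]
  exact DFunLike.congr_fun h u

theorem parityEnv_mem {u : D.Env} (hu : u ∈ D.vacuumIdeal) : D.parityEnv u ∈ D.vacuumIdeal := by
  induction hu using Submodule.span_induction with
  | mem u h =>
    obtain ⟨a, n, hn, rfl⟩ := h
    rw [parityEnv_gen]
    exact Submodule.subset_span ⟨_, n, hn, rfl⟩
  | zero => simp
  | add u v _ _ hu hv => rw [map_add]; exact add_mem hu hv
  | smul c u _ hu => rw [smul_eq_mul, map_mul]; exact Submodule.smul_mem _ _ hu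

theorem vacuumIdeal_le_comap_parityEnv : D.vacuumIdeal.restrictScalars ℂ ≤
    (D.vacuumIdeal.restrictScalars ℂ).comap D.parityEnv.toLinearMap :=
  fun _ hu => D.parityEnv_mem hu

theorem vacuumIdeal_le_comap_mulLeft (u : D.Env) : D.vacuumIdeal.restrictScalars ℂ ≤
    (D.vacuumIdeal.restrictScalars ℂ).comap (LinearMap.mulLeft ℂ u) :=
  fun _ hv => D.vacuumIdeal.smul_mem u hv

instance : SuperSpace D.Vacuum where
  parity := Submodule.mapQ _ _ D.parityEnv.toLinearMap D.vacuumIdeal_le_comap_parityEnv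
  parity_parity := by
    intro v
    obtain ⟨u, rfl⟩ := Submodule.Quotient.mk_surjective _ v
    simp [Submodule.mapQ_apply, parityEnv_parityEnv]

/-- Left multiplication by an element of the enveloping algebra on the vacuum module. -/
def act (u : D.Env) : Module.End ℂ D.Vacuum :=
  Submodule.mapQ _ _ (LinearMap.mulLeft ℂ u) (D.vacuumIdeal_le_comap_mulLeft u)

theorem exists_gen_mul_mem (u : D.Env) :
    ∀ v : D.Env, (∀ a : W, ∃ N : ℤ, ∀ n, N ≤ n → D.gen a n * v ∈ D.vacuumIdeal) →
      ∀ a : W, ∃ N : ℤ, ∀ n, N ≤ n → D.gen a n * (u * v) ∈ D.vacuumIdeal := by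
  obtain ⟨u, rfl⟩ := RingQuot.mkAlgHom_surjective ℂ D.Rel u
  induction u with
  | grade0 r =>
    intro v hv a
    obtain ⟨N, hN⟩ := hv a
    refine ⟨N, fun n hn => ?_⟩
    rw [AlgHom.commutes, ← Algebra.smul_def, mul_smul_comm]
    exact (D.vacuumIdeal.restrictScalars ℂ).smul_mem r (hN n hn)
  | add u₁ u₂ h₁ h₂ =>
    intro v hv a
    obtain ⟨N₁, hN₁⟩ := h₁ v hv a
    obtain ⟨N₂, hN₂⟩ := h₂ v hv a
    refine ⟨max N₁ N₂, fun n hn => ?_⟩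
    rw [map_add, add_mul, mul_add]
    exact add_mem (hN₁ n (le_trans (le_max_left _ _) hn))
      (hN₂ n (le_trans (le_max_right _ _) hn))
  | mul u₁ u₂ h₁ h₂ =>
    intro v hv a
    rw [map_mul]
    simp only [mul_assoc]
    exact h₁ _ (h₂ v hv) a
  | grade1 q =>
    obtain ⟨b, m⟩ := q
    intro v hv
    have key : ∀ (α β : ZMod 2) (a c : W), a ∈ homog W α → c ∈ homog W β →
        ∃ N : ℤ, ∀ n, N ≤ n → D.gen a n * (D.gen c m * v) ∈ D.vacuumIdeal := by
      intro α β a c ha hc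
      obtain ⟨N₁, hN₁⟩ := hv a
      obtain ⟨N₂, hN₂⟩ := hv (D.br a c)
      refine ⟨max (max N₁ (N₂ - m)) (1 - m), fun n hn => ?_⟩
      have e1 : N₁ ≤ n := by omega
      have e2 : N₂ ≤ n + m := by omega
      have e3 : D.central a c n m = 0 := by
        unfold central
        rw [if_neg (by omega), if_neg (by omega), add_zero]
      rw [← mul_assoc, D.gen_mul_gen ha hc, e3, map_zero, add_zero, add_mul, smul_mul_assoc,
        mul_assoc]
      exact add_mem ((D.vacuumIdeal.restrictScalars ℂ).smul_mem _
        (D.vacuumIdeal.smul_mem _ (hN₁ n e1))) (hN₂ _ e2)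
    intro a
    change ∃ N : ℤ, ∀ n, N ≤ n → D.gen a n * (D.gen b m * v) ∈ D.vacuumIdeal
    obtain ⟨N₁, h₁⟩ := key 0 0 _ _ (comp_mem 0 a) (comp_mem 0 b)
    obtain ⟨N₂, h₂⟩ := key 0 1 _ _ (comp_mem 0 a) (comp_mem 1 b)
    obtain ⟨N₃, h₃⟩ := key 1 0 _ _ (comp_mem 1 a) (comp_mem 0 b)
    obtain ⟨N₄, h₄⟩ := key 1 1 _ _ (comp_mem 1 a) (comp_mem 1 b)
    refine ⟨max (max N₁ N₂) (max N₃ N₄), fun n hn => ?_⟩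
    rw [← comp_add_comp a, ← comp_add_comp b, gen_add, gen_add]
    simp only [add_mul, mul_add]
    exact add_mem (add_mem (h₁ n (by omega)) (h₃ n (by omega)))
      (add_mem (h₂ n (by omega)) (h₄ n (by omega)))

theorem act_gen_eventually_zero (a : W) (v : D.Vacuum) :
    ∃ N : ℤ, ∀ n, N ≤ n → D.act (D.gen a n) v = 0 := by
  obtain ⟨u, rfl⟩ := Submodule.Quotient.mk_surjective _ v
  obtain ⟨N, hN⟩ := D.exists_gen_mul_mem u 1 (fun a => ⟨0, fun n hn => by
    rw [mul_one]; exact Submodule.subset_span ⟨a, n, hn, rfl⟩⟩) a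
  refine ⟨N, fun n hn => ?_⟩
  have h := hN n hn
  rw [mul_one] at h
  rw [act, Submodule.mapQ_apply, Submodule.Quotient.mk_eq_zero]
  exact h

/-- The field `a(z) = ∑ₙ (a tⁿ) z^{-n-1}` on the vacuum module. -/
def field (a : W) : VertexOperator ℂ D.Vacuum :=
  ofModes (fun n => D.act (D.gen a n)) (D.act_gen_eventually_zero a)

end AffineData

end Affinization

/-! ## Lie superalgebras -/

/-- A Lie superalgebra over `ℂ`. -/
class LieSuperalgebra (𝔤 : Type*) [AddCommGroup 𝔤] [Module ℂ 𝔤] extends SuperSpace 𝔤 where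
  br : 𝔤 →ₗ[ℂ] 𝔤 →ₗ[ℂ] 𝔤
  br_mem : ∀ {α β : ZMod 2} {a b : 𝔤}, a ∈ homog 𝔤 α → b ∈ homog 𝔤 β →
    br a b ∈ homog 𝔤 (α + β)
  br_skew : ∀ {α β : ZMod 2} {a b : 𝔤}, a ∈ homog 𝔤 α → b ∈ homog 𝔤 β →
    br a b = -(sgn (α * β) • br b a)
  br_jacobi : ∀ {α β : ZMod 2} {a b : 𝔤}, a ∈ homog 𝔤 α → b ∈ homog 𝔤 β → ∀ c : 𝔤,
    br a (br b c) = br (br a b) c + sgn (α * β) • br b (br a c)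

section LieSuper

open SuperSpace LieSuperalgebra

variable {𝔤 : Type*} [AddCommGroup 𝔤] [Module ℂ 𝔤] [LieSuperalgebra 𝔤]

theorem parity_br (a b : 𝔤) : parity (br a b) = br (parity a) (parity b) := by
  have key : ∀ (α β : ZMod 2) (a b : 𝔤), a ∈ homog 𝔤 α → b ∈ homog 𝔤 β →
      parity (br a b) = br (parity a) (parity b) := by
    intro α β a b ha hb
    rw [mem_homog.1 (br_mem ha hb), mem_homog.1 ha, mem_homog.1 hb, sgn_add]
    simp [smul_smul, mul_comm]
  rw [← comp_add_comp a, ← comp_add_comp b]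
  simp only [map_add, LinearMap.add_apply]
  rw [key _ _ _ _ (comp_mem 0 a) (comp_mem 0 b), key _ _ _ _ (comp_mem 0 a) (comp_mem 1 b),
    key _ _ _ _ (comp_mem 1 a) (comp_mem 0 b), key _ _ _ _ (comp_mem 1 a) (comp_mem 1 b)]

/-- A Lie superalgebra is simple if its bracket is not zero and its only graded ideals are `0` and
the whole algebra. -/
def IsSimple (𝔤 : Type*) [AddCommGroup 𝔤] [Module ℂ 𝔤] [LieSuperalgebra 𝔤] : Prop :=
  (∃ a b : 𝔤, br a b ≠ 0) ∧
    ∀ I : Submodule ℂ 𝔤, (∀ a ∈ I, parity a ∈ I) → (∀ a, ∀ b ∈ I, br a b ∈ I) → I = ⊥ ∨ I = ⊤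

/-- The operator by which the Casimir element `∑ (-1)^{p(aᵢ)} aᵢ aⁱ` acts in the adjoint
representation, for families `aᵢ` (of parities `p i`) and `aⁱ`. -/
def casimirAd {J : Type*} [Fintype J] (a a' : J → 𝔤) (p : J → ZMod 2) : Module.End ℂ 𝔤 :=
  ∑ i, sgn (p i) • (br (a i) ∘ₗ br (a' i))

/-- The eigenspace `𝔤_j` of `ad x` for the half-integer `j = n / 2`. -/
def eigen (x : 𝔤) (n : ℤ) : Submodule ℂ 𝔤 := Module.End.eigenspace (br x) ((n : ℂ) / 2)

end LieSuper

/-- A Lie superalgebra `𝔤` with a non-degenerate even supersymmetric invariant bilinear form, even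
elements `x`, `f` subject to the conditions of the quantum reduction, and a level `k`. -/
structure Datum (𝔤 : Type*) [AddCommGroup 𝔤] [Module ℂ 𝔤] [LieSuperalgebra 𝔤] where
  /-- the form `(a|b)` -/
  form : 𝔤 →ₗ[ℂ] 𝔤 →ₗ[ℂ] ℂ
  form_even : ∀ {α β : ZMod 2} {a b : 𝔤}, a ∈ homog 𝔤 α → b ∈ homog 𝔤 β → α ≠ β → form a b = 0
  form_symm : ∀ {α β : ZMod 2} {a b : 𝔤}, a ∈ homog 𝔤 α → b ∈ homog 𝔤 β →
    form a b = sgn (α * β) • form b a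
  form_invariant : ∀ a b c : 𝔤, form (LieSuperalgebra.br a b) c = form a (LieSuperalgebra.br b c)
  form_nondegenerate : ∀ a : 𝔤, (∀ b, form a b = 0) → a = 0
  x : 𝔤
  f : 𝔤
  x_even : x ∈ homog 𝔤 0
  f_even : f ∈ homog 𝔤 0
  /-- `ad x` is diagonalizable with eigenvalues in `½ℤ` -/
  x_diag : ⨆ n : ℤ, eigen x n = ⊤
  /-- `[x, f] = -f` -/
  br_x_f : LieSuperalgebra.br x f = -f
  /-- `ad f : 𝔤_{1/2} → 𝔤_{-1/2}` is an isomorphism -/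
  ad_f_bijOn : Set.BijOn (LieSuperalgebra.br f) (eigen x 1) (eigen x (-1))
  k : ℂ

namespace Datum

open SuperSpace LieSuperalgebra

variable {𝔤 : Type*} [AddCommGroup 𝔤] [Module ℂ 𝔤] [LieSuperalgebra 𝔤] (Q : Datum 𝔤)

/-- `𝔤₊ = ⨁_{j > 0} 𝔤_j`. -/
def gPlus : Submodule ℂ 𝔤 := ⨆ (n : ℤ) (_ : 0 < n), eigen Q.x n

/-- `𝔤_{1/2}`. -/
def gHalf : Submodule ℂ 𝔤 := eigen Q.x 1

theorem form_parity (a b : 𝔤) : Q.form (parity a) (parity b) = Q.form a b := by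
  have key : ∀ (α β : ZMod 2) (a b : 𝔤), a ∈ homog 𝔤 α → b ∈ homog 𝔤 β →
      Q.form (parity a) (parity b) = Q.form a b := by
    intro α β a b ha hb
    rw [mem_homog.1 ha, mem_homog.1 hb]
    by_cases h : α = β
    · subst h
      simp [← mul_assoc, sgn_mul_self]
    · simp [Q.form_even ha hb h]
  rw [← comp_add_comp a, ← comp_add_comp b]
  simp only [map_add, LinearMap.add_apply]
  rw [key _ _ _ _ (comp_mem 0 a) (comp_mem 0 b), key _ _ _ _ (comp_mem 0 a) (comp_mem 1 b),
    key _ _ _ _ (comp_mem 1 a) (comp_mem 0 b), key _ _ _ _ (comp_mem 1 a) (comp_mem 1 b)]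

theorem parity_even {a : 𝔤} (ha : a ∈ homog 𝔤 0) : parity a = a := by
  simpa [sgn] using mem_homog.1 ha

theorem parity_mem_eigen {n : ℤ} {a : 𝔤} (ha : a ∈ eigen Q.x n) : parity a ∈ eigen Q.x n := by
  rw [eigen, Module.End.mem_eigenspace_iff] at ha ⊢
  have h := parity_br Q.x a
  rw [parity_even Q.x_even] at h
  rw [← h, ha, map_smul]

theorem parity_mem_gPlus {a : 𝔤} (ha : a ∈ Q.gPlus) : parity a ∈ Q.gPlus := by
  have h : Q.gPlus ≤ Q.gPlus.comap parity := by
    unfold gPlus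
    refine iSup₂_le fun n hn a ha => ?_
    exact (le_iSup₂ (f := fun (n : ℤ) (_ : 0 < n) => eigen Q.x n) n hn) (Q.parity_mem_eigen ha)
  exact h ha

/-- The parity operator of `𝔤` restricted to `𝔤₊`. -/
def parityPlus : Q.gPlus →ₗ[ℂ] Q.gPlus := parity.restrict fun _ => Q.parity_mem_gPlus

/-- The parity operator of `𝔤` restricted to `𝔤_{1/2}`. -/
def parityHalf : Q.gHalf →ₗ[ℂ] Q.gHalf := parity.restrict fun _ => Q.parity_mem_eigen

/-- The superspace `𝔤 ⊕ A_ch ⊕ A_ne` on which the currents and the ghosts are based, where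
`A_ch = Π(𝔤₊ ⊕ 𝔤₊*)` (with `Π` the reversal of parity) and `A_ne = 𝔤_{1/2}`. -/
abbrev GenSpace : Type _ := 𝔤 × (Q.gPlus × Module.Dual ℂ Q.gPlus) × Q.gHalf

/-- The parity is that of `𝔤` on `𝔤` and on `A_ne`, and is reversed on `A_ch`. -/
instance : SuperSpace Q.GenSpace where
  parity := parity.prodMap (((-Q.parityPlus).prodMap (-Q.parityPlus.dualMap)).prodMap Q.parityHalf)
  parity_parity := by
    rintro ⟨a, ⟨b, ξ⟩, c⟩
    have hp : ∀ b, Q.parityPlus (Q.parityPlus b) = b := fun b =>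
      Subtype.ext (parity_parity (b : 𝔤))
    have hh : ∀ b, Q.parityHalf (Q.parityHalf b) = b := fun b =>
      Subtype.ext (parity_parity (b : 𝔤))
    have hd : Q.parityPlus.dualMap (Q.parityPlus.dualMap ξ) = ξ := by
      ext b; simp [hp]
    simp [parity_parity, hp, hh, hd]

/-- The projection of `𝔤 ⊕ A_ch ⊕ A_ne` to `𝔤`. -/
def toG : Q.GenSpace →ₗ[ℂ] 𝔤 := LinearMap.fst ℂ _ _

/-- The projection to `𝔤₊` (in `A_ch`). -/
def toPlus : Q.GenSpace →ₗ[ℂ] Q.gPlus :=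
  LinearMap.fst ℂ _ _ ∘ₗ LinearMap.fst ℂ _ _ ∘ₗ LinearMap.snd ℂ _ _

/-- The projection to `𝔤₊*` (in `A_ch`). -/
def toDual : Q.GenSpace →ₗ[ℂ] Module.Dual ℂ Q.gPlus :=
  LinearMap.snd ℂ _ _ ∘ₗ LinearMap.fst ℂ _ _ ∘ₗ LinearMap.snd ℂ _ _

/-- The projection to `A_ne = 𝔤_{1/2}`, viewed in `𝔤`. -/
def toHalf : Q.GenSpace →ₗ[ℂ] 𝔤 :=
  Q.gHalf.subtype ∘ₗ LinearMap.snd ℂ _ _ ∘ₗ LinearMap.snd ℂ _ _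

/-- The affinization data on `𝔤 ⊕ A_ch ⊕ A_ne`:
* the Kac–Moody affinization of `𝔤` at level `k`: bracket `[a, b]` and `λ`-term `k (a|b)`;
* the Clifford affinization of `A_ch` for the skew-supersymmetric form with
  `⟨b, ξ⟩ = ξ(b)` for `b ∈ A`, `ξ ∈ A*`, hence `⟨ξ, b⟩ = -(-1)^{p(b)+1} ξ(b) = ξ(Γ b)` where `p(b)`
  and `Γ` are the parity in `𝔤`, and with `A`, `A*` isotropic;
* the Clifford affinization of `A_ne` for the form `⟨a, b⟩ = (f|[a, b])`;
the three summands supercommute with each other. -/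
def affineData : AffineData Q.GenSpace where
  br := LinearMap.mk₂ ℂ (fun v w => (br (Q.toG v) (Q.toG w), (0, 0), 0))
    (by intros; simp) (by intros; simp) (by intros; simp) (by intros; simp)
  form₀ := LinearMap.mk₂ ℂ (fun v w => Q.toDual w (Q.toPlus v) +
      Q.toDual v (Q.parityPlus (Q.toPlus w)) + Q.form Q.f (br (Q.toHalf v) (Q.toHalf w)))
    (by intros; simp; ring) (by intros; simp; ring) (by intros; simp; ring)
    (by intros; simp; ring)
  form₁ := LinearMap.mk₂ ℂ (fun v w => Q.k * Q.form (Q.toG v) (Q.toG w))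
    (by intros; simp; ring) (by intros; simp; ring) (by intros; simp; ring)
    (by intros; simp; ring)
  parity_br := by
    intro v w
    have h := parity_br v.1 w.1
    simpa [toG, parity] using h
  form₀_parity := by
    rintro ⟨a, ⟨b, ξ⟩, c⟩ ⟨a', ⟨b', ξ'⟩, c'⟩
    have hp : ∀ b, Q.parityPlus (Q.parityPlus b) = b := fun b =>
      Subtype.ext (parity_parity (b : 𝔤))
    have hf : Q.form Q.f (br (parity (c : 𝔤)) (parity (c' : 𝔤))) = Q.form Q.f (br (c : 𝔤) c') := by
      rw [← parity_br]
      nth_rewrite 1 [← parity_even Q.f_even]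
      exact Q.form_parity _ _
    have hc : ∀ c : Q.gHalf, ((Q.parityHalf c : Q.gHalf) : 𝔤) = parity (c : 𝔤) := fun _ => rfl
    simp only [LinearMap.mk₂_apply]
    change (-(Q.parityPlus.dualMap ξ')) (-(Q.parityPlus b)) +
      (-(Q.parityPlus.dualMap ξ)) (Q.parityPlus (-(Q.parityPlus b'))) +
      Q.form Q.f (br ((Q.parityHalf c : Q.gHalf) : 𝔤) ((Q.parityHalf c' : Q.gHalf) : 𝔤)) =
      ξ' b + ξ (Q.parityPlus b') + Q.form Q.f (br (c : 𝔤) c')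
    rw [hc, hc, hf]
    simp [hp]
  form₁_parity := by
    intro v w
    have h := Q.form_parity v.1 w.1
    simp only [LinearMap.mk₂_apply]
    change Q.k * Q.form (parity v.1) (parity w.1) = Q.k * Q.form v.1 w.1
    rw [h]

/-- The state space `V_k(𝔤) ⊗ F(A_ch) ⊗ F(A_ne)`. The super tensor product of the enveloping
algebras of the three affinizations is the enveloping algebra of their direct sum, and the tensor
product of the three vacuum modules is its vacuum module. -/
abbrev State : Type _ := Q.affineData.Vacuum

/-- The current `u(z)`, `u ∈ 𝔤`. -/
def current (u : 𝔤) : VertexOperator ℂ Q.State := Q.affineData.field (u, (0, 0), 0)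

/-- The charged ghost `φ_b(z)`, `b ∈ A = Π𝔤₊`. -/
def ghost (b : Q.gPlus) : VertexOperator ℂ Q.State := Q.affineData.field (0, (b, 0), 0)

/-- The charged ghost `φ*_ξ(z)`, `ξ ∈ A* = Π𝔤₊*`. -/
def ghostDual (ξ : Module.Dual ℂ Q.gPlus) : VertexOperator ℂ Q.State :=
  Q.affineData.field (0, (0, ξ), 0)

/-- The neutral ghost `Φ_c(z)`, `c ∈ A_ne = 𝔤_{1/2}`. -/
def neutral (c : Q.gHalf) : VertexOperator ℂ Q.State := Q.affineData.field (0, (0, 0), c)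

/-- The vertex algebra `𝒞(𝔤, x, f, k)`, as a space of fields: it is generated by the currents and
the ghosts. -/
def vertexAlgebra : Submodule ℂ (VertexOperator ℂ Q.State) :=
  vertexAlgebraOf (Set.range Q.current ∪ Set.range Q.ghost ∪ Set.range Q.ghostDual ∪
    Set.range Q.neutral)

/-- A pair of dual bases of `𝔤` for `(.|.)`: a basis `aᵢ` of `𝔤` with `aᵢ` of parity `p i`, and
elements `aⁱ` with `(aᵢ|aʲ) = δᵢⱼ`. -/
structure DualPair (J : Type*) [Fintype J] [DecidableEq J] where
  a : Module.Basis J ℂ 𝔤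
  a' : J → 𝔤
  p : J → ZMod 2
  mem_homog : ∀ i, a i ∈ homog 𝔤 (p i)
  form_eq : ∀ i j, Q.form (a i) (a' j) = if i = j then 1 else 0

/-- `h` is the dual Coxeter number: one half of the eigenvalue of the Casimir operator in the
adjoint representation. -/
def IsDualCoxeterNumber {J : Type*} [Fintype J] [DecidableEq J] (P : Q.DualPair J) (h : ℂ) :
    Prop :=
  Module.End.HasEigenvalue (casimirAd P.a P.a' P.p) (2 * h)

/-- A basis `uᵢ` of `𝔤` compatible with parity and with the `½ℤ`-gradation: `uᵢ` has parity `p i`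
and `[x, uᵢ] = mᵢ uᵢ` with `mᵢ = n i / 2`; together with the basis `uⁱ` (`n i = 1`) of `𝔤_{1/2}`
dual to the `uᵢ` for the form `⟨a, b⟩ = (f|[a, b])`. -/
structure AdaptedBasis (I : Type*) [Fintype I] [DecidableEq I] where
  u : Module.Basis I ℂ 𝔤
  p : I → ZMod 2
  n : I → ℤ
  mem_homog : ∀ i, u i ∈ homog 𝔤 (p i)
  mem_eigen : ∀ i, u i ∈ eigen Q.x (n i)
  u' : {i // n i = 1} → Q.gHalf
  form_eq : ∀ i j : {i // n i = 1},
    Q.form Q.f (br (u i) (u' j : 𝔤)) = if i = j then 1 else 0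

/-- The Sugawara field `L^𝔤 = (1 / (2(k + h^∨))) ∑ᵢ (-1)^{p(aᵢ)} :aᵢ aⁱ:`. -/
def sugawara {J : Type*} [Fintype J] [DecidableEq J] (P : Q.DualPair J) (h : ℂ) :
    VertexOperator ℂ Q.State :=
  (1 / (2 * (Q.k + h))) •
    ∑ i, sgn (P.p i) • normalProd (Q.current (P.a i)) (Q.current (P.a' i))

namespace AdaptedBasis

variable {Q} {I : Type*} [Fintype I] [DecidableEq I] (U : Q.AdaptedBasis I)

/-- The index set `S` of the basis elements in `𝔤₊`. -/
abbrev S : Type _ := {i // 0 < U.n i}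

/-- The index set `S'` of the basis elements in `𝔤_{1/2}`. -/
abbrev S' : Type _ := {i // U.n i = 1}

/-- The eigenvalue `mᵢ` of `ad x` on `uᵢ`. -/
def m (i : I) : ℂ := (U.n i : ℂ) / 2

/-- The ghost `φᵢ(z)`, `i ∈ S`. -/
def phi (i : U.S) : VertexOperator ℂ Q.State :=
  Q.ghost ⟨U.u i, (le_iSup₂ (f := fun (n : ℤ) (_ : 0 < n) => eigen Q.x n) (U.n i) i.2)
    (U.mem_eigen i)⟩

/-- The ghost `φ*ᵢ(z)`, `i ∈ S`, for the basis of `𝔤₊*` dual to `(uᵢ)`, `i ∈ S`. -/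
def phiDual (i : U.S) : VertexOperator ℂ Q.State :=
  Q.ghostDual ((U.u.coord i).domRestrict Q.gPlus)

/-- The ghost `Φᵢ(z)`, `i ∈ S'`. -/
def Phi (i : U.S') : VertexOperator ℂ Q.State :=
  Q.neutral ⟨U.u i, by
    have h := U.mem_eigen i
    rw [i.2] at h
    exact h⟩

/-- The ghost `Φⁱ(z)`, `i ∈ S'`, for the dual basis of `𝔤_{1/2}`. -/
def PhiDual (i : U.S') : VertexOperator ℂ Q.State := Q.neutral (U.u' i)

/-- `L^ch = -∑_{i ∈ S} mᵢ :φ*ᵢ ∂φᵢ: + ∑_{i ∈ S} (1 - mᵢ) :(∂φ*ᵢ) φᵢ:`. -/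
def Lch : VertexOperator ℂ Q.State :=
  -(∑ i : U.S, U.m i • normalProd (U.phiDual i) (fieldDeriv (U.phi i))) +
    ∑ i : U.S, (1 - U.m i) • normalProd (fieldDeriv (U.phiDual i)) (U.phi i)

/-- `L^ne = ½ ∑_{i ∈ S'} :(∂Φⁱ) Φᵢ:`. -/
def Lne : VertexOperator ℂ Q.State :=
  (1 / 2 : ℂ) • ∑ i : U.S', normalProd (fieldDeriv (U.PhiDual i)) (U.Phi i)

/-- The field `L = L^𝔤 + ∂x + L^ch + L^ne`. -/
def energyMomentum {J : Type*} [Fintype J] [DecidableEq J] (P : Q.DualPair J) (h : ℂ) :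
    VertexOperator ℂ Q.State :=
  Q.sugawara P h + fieldDeriv (Q.current Q.x) + U.Lch + U.Lne

/-- The central charge `c(𝔤, x, f, k)`. -/
def centralCharge (h : ℂ) : ℂ :=
  Q.k * sdim (⊤ : Submodule ℂ 𝔤) / (Q.k + h) - 12 * Q.k * Q.form Q.x Q.x -
    (∑ i : U.S, sgn (U.p i) * (12 * U.m i ^ 2 - 12 * U.m i + 2)) - 1 / 2 * sdim Q.gHalf

end AdaptedBasis

end Datum

end QuantumReduction

end

/-!
For every pair of fields `a`, `b` that matters here, the modes satisfy a commutator formula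
`[a₍ₘ₎, b₍ₙ₎] = ∑ⱼ (m choose j) (Aⱼ)₍ₘ₊ₙ₋ⱼ₎` with `j ≤ 3`. The predicate
`HasBracket a b A₀ A₁ A₂ A₃` records it. Since binomial coefficients are killed by enough forward
differences, such a formula implies that `a` and `b` are local (`HasBracket.isLocal`) and that
`[a_λ b] = ∑ⱼ λʲ/j! Aⱼ` (`HasBracket.lambdaBracket_eq`). The theorem thus becomes a computation with
commutator formulas, whose rules are sesquilinearity (`HasBracket.deriv_left`,
`HasBracket.deriv_right`), skew-symmetry (`HasBracket.skew`) and the noncommutative Wick formula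
(`HasBracket.wick`). The last one holds because a mode of `:ab:` is, on each vector, the eventual
value of finite sums (`partialNormal`), on which a supercommutator acts as a superderivation; the
result is a partial normally ordered product with a shifted splitting into creation and annihilation
operators, and undoing the shift produces the integral term
(`HasBracket.pointwiseLim_partialNormal`).

The four summands of `L` are treated as follows.

* `L^𝔤`: the tensor `∑ aⁱ ⊗ aᵢ` is invariant (`Datum.DualPair.sum_invariant`), and the Casimir
  operator acts on `𝔤` as the scalar `2h^∨`, since its eigenspaces are graded ideals of `𝔤`
  (`Datum.DualPair.casimirAd_eq`). By the Wick formula `[u_λ ∑ :aⁱaᵢ:] = 2(k + h^∨) λ u`, so that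
  currents are primary of conformal weight one for `L^𝔤`, and `[L^𝔤_λ L^𝔤]` follows by applying the
  Wick formula once more.
* `L^ch` and `L^ne`: for free fields the Wick formula first gives the brackets with the generators,
  and then the brackets of the energy-momentum fields with themselves. The coefficient of `λ²`
  cancels between the two sums in `L^ch`; for `L^ne` it vanishes by skew-symmetry
  (`HasBracket.virasoro_quadratic_eq_zero`).
* `∂x`: its bracket with itself is `-λ³ k (x|x)`, and the terms `±λ² x` of its brackets with `L^𝔤`
  cancel.

Currents, charged ghosts and neutral ghosts commute with each other, so these pieces add up
(`HasBracket.add_four`). On `u ∈ 𝔤_j` the summand `∂x` shifts the weight from `1` to `1 - j` and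
contributes `-λ² k (x|u)`; by invariance of the form `(x|u) = 0` unless `j = 0`.
-/

noncomputable section

namespace QuantumReduction

/-! ### The supercommutator of endomorphisms -/

section EndAlgebra

open SuperSpace

variable {M : Type*} [AddCommGroup M] [Module ℂ M] [SuperSpace M]

/-- An endomorphism of a superspace is homogeneous of parity `α` if it commutes with the parity
operator up to the sign `(-1)^α`. -/
def IsHomogEnd (α : ZMod 2) (T : Module.End ℂ M) : Prop :=
  parity * T = sgn α • (T * parity)

theorem sgn_zero : sgn 0 = 1 := if_pos rfl

theorem sgn_one : sgn 1 = -1 := if_neg (by decide)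

theorem zmod_two_cases (α : ZMod 2) : α = 0 ∨ α = 1 := by revert α; decide

theorem zmod_two_add_self (α : ZMod 2) : α + α = 0 := by revert α; decide

theorem zmod_two_mul_self (α : ZMod 2) : α * α = α := by revert α; decide

theorem parity_mul_parity : (parity * parity : Module.End ℂ M) = 1 :=
  LinearMap.ext parity_parity

theorem parity_mul_parity_mul (T : Module.End ℂ M) : parity * (parity * T) = T := by
  rw [← mul_assoc, parity_mul_parity, one_mul]

theorem IsHomogEnd.parity_mul_mul {α : ZMod 2} {T : Module.End ℂ M} (h : IsHomogEnd α T)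
    (X : Module.End ℂ M) : parity * (T * X) = sgn α • (T * (parity * X)) := by
  rw [← mul_assoc, h, smul_mul_assoc, mul_assoc]

theorem part_add (α : ZMod 2) (S T : Module.End ℂ M) :
    part α (S + T) = part α S + part α T := by
  simp only [part, mul_add, add_mul, smul_add]; abel

theorem part_smul (α : ZMod 2) (c : ℂ) (T : Module.End ℂ M) : part α (c • T) = c • part α T := by
  simp only [part, mul_smul_comm, smul_mul_assoc, smul_add, smul_smul]
  congr 2 <;> ring

theorem swapMul_add_left (S S' T : Module.End ℂ M) :
    swapMul (S + S') T = swapMul S T + swapMul S' T := by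
  simp only [swapMul, part_add, mul_add, smul_add, Finset.sum_add_distrib]

theorem swapMul_add_right (S T T' : Module.End ℂ M) :
    swapMul S (T + T') = swapMul S T + swapMul S T' := by
  simp only [swapMul, part_add, add_mul, smul_add, Finset.sum_add_distrib]

theorem swapMul_smul_left (c : ℂ) (S T : Module.End ℂ M) :
    swapMul (c • S) T = c • swapMul S T := by
  simp only [swapMul, part_smul, mul_smul_comm, Finset.smul_sum, smul_comm c]

theorem swapMul_smul_right (c : ℂ) (S T : Module.End ℂ M) :
    swapMul S (c • T) = c • swapMul S T := by
  simp only [swapMul, part_smul, smul_mul_assoc, Finset.smul_sum, smul_comm c]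

/-- The opposite product as a bilinear map. -/
def swapMulₗ : Module.End ℂ M →ₗ[ℂ] Module.End ℂ M →ₗ[ℂ] Module.End ℂ M :=
  LinearMap.mk₂ ℂ swapMul swapMul_add_left swapMul_smul_left swapMul_add_right swapMul_smul_right

theorem swapMulₗ_apply (S T : Module.End ℂ M) : swapMulₗ S T = swapMul S T := rfl

theorem swapMul_zero_left (T : Module.End ℂ M) : swapMul 0 T = 0 := by
  simp [← swapMulₗ_apply]

theorem swapMul_zero_right (S : Module.End ℂ M) : swapMul S 0 = 0 := by
  simp [← swapMulₗ_apply]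

theorem superComm_add_left (S S' T : Module.End ℂ M) :
    superComm (S + S') T = superComm S T + superComm S' T := by
  simp only [superComm, swapMul_add_left, add_mul]; abel

theorem superComm_add_right (S T T' : Module.End ℂ M) :
    superComm S (T + T') = superComm S T + superComm S T' := by
  simp only [superComm, swapMul_add_right, mul_add]; abel

theorem superComm_smul_left (c : ℂ) (S T : Module.End ℂ M) :
    superComm (c • S) T = c • superComm S T := by
  simp only [superComm, swapMul_smul_left, smul_mul_assoc, smul_sub]

theorem superComm_smul_right (c : ℂ) (S T : Module.End ℂ M) :
    superComm S (c • T) = c • superComm S T := by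
  simp only [superComm, swapMul_smul_right, mul_smul_comm, smul_sub]

/-- The supercommutator as a bilinear map. -/
def superCommₗ : Module.End ℂ M →ₗ[ℂ] Module.End ℂ M →ₗ[ℂ] Module.End ℂ M :=
  LinearMap.mk₂ ℂ superComm superComm_add_left superComm_smul_left superComm_add_right
    superComm_smul_right

theorem superCommₗ_apply (S T : Module.End ℂ M) : superCommₗ S T = superComm S T := rfl

theorem superComm_zero_left (T : Module.End ℂ M) : superComm 0 T = 0 := by
  simp [← superCommₗ_apply]

theorem superComm_zero_right (S : Module.End ℂ M) : superComm S 0 = 0 := by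
  simp [← superCommₗ_apply]

theorem superComm_sum_right {ι : Type*} (s : Finset ι) (S : Module.End ℂ M)
    (T : ι → Module.End ℂ M) : superComm S (∑ i ∈ s, T i) = ∑ i ∈ s, superComm S (T i) := by
  simp only [← superCommₗ_apply, map_sum]

theorem IsHomogEnd.part_self {α : ZMod 2} {S : Module.End ℂ M} (h : IsHomogEnd α S) :
    part α S = S := by
  rw [part, h, smul_mul_assoc, mul_assoc, parity_mul_parity, mul_one, smul_smul, sgn_mul_self,
    one_smul, ← two_smul ℂ S, smul_smul]
  norm_num

theorem IsHomogEnd.part_add_one {α : ZMod 2} {S : Module.End ℂ M} (h : IsHomogEnd α S) :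
    part (α + 1) S = 0 := by
  rw [part, h, smul_mul_assoc, mul_assoc, parity_mul_parity, mul_one, smul_smul, sgn_add, sgn_one,
    mul_right_comm, sgn_mul_self]
  simp

theorem sum_zmod_two {V : Type*} [AddCommMonoid V] (g : ZMod 2 → V) : ∑ α, g α = g 0 + g 1 :=
  Fin.sum_univ_two g

theorem IsHomogEnd.swapMul_eq_even {S : Module.End ℂ M} (h : IsHomogEnd 0 S)
    (T : Module.End ℂ M) : swapMul S T = T * S := by
  have h1 : part 1 S = 0 := by simpa using h.part_add_one
  simp only [swapMul, sum_zmod_two, h.part_self, h1]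
  simp only [part, zero_mul, mul_zero, smul_zero, add_zero, sgn_zero, sgn_one, one_smul,
    ← add_mul]
  congr 1
  module

/-- Moving an odd endomorphism across `T` conjugates `T` by the parity operator. -/
theorem IsHomogEnd.swapMul_eq_odd {S : Module.End ℂ M} (h : IsHomogEnd 1 S)
    (T : Module.End ℂ M) : swapMul S T = parity * T * parity * S := by
  have h1 : part 0 S = 0 := by simpa [zmod_two_add_self] using h.part_add_one
  simp only [swapMul, sum_zmod_two, h.part_self, h1]
  simp only [part, mul_zero, smul_zero, zero_add, sgn_zero, sgn_one, one_smul, mul_one,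
    ← smul_mul_assoc, ← add_mul]
  congr 1
  simp only [smul_mul_assoc]
  module

theorem IsHomogEnd.swapMul_eq {α β : ZMod 2} {S T : Module.End ℂ M} (hS : IsHomogEnd α S)
    (hT : IsHomogEnd β T) : swapMul S T = sgn (α * β) • (T * S) := by
  rcases zmod_two_cases α with rfl | rfl
  · rw [hS.swapMul_eq_even, zero_mul, sgn_zero, one_smul]
  · rw [hS.swapMul_eq_odd, hT, one_mul, smul_mul_assoc, smul_mul_assoc, mul_assoc T,
      parity_mul_parity, mul_one]

theorem IsHomogEnd.mul {α β : ZMod 2} {S T : Module.End ℂ M} (hS : IsHomogEnd α S)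
    (hT : IsHomogEnd β T) : IsHomogEnd (α + β) (S * T) := by
  unfold IsHomogEnd
  rw [hS.parity_mul_mul, hT, mul_smul_comm, smul_smul, sgn_add, mul_assoc]

theorem IsHomogEnd.add {α : ZMod 2} {S T : Module.End ℂ M} (hS : IsHomogEnd α S)
    (hT : IsHomogEnd α T) : IsHomogEnd α (S + T) := by
  unfold IsHomogEnd at *
  rw [mul_add, hS, hT, add_mul, smul_add]

theorem IsHomogEnd.zero (α : ZMod 2) : IsHomogEnd α (0 : Module.End ℂ M) := by
  simp [IsHomogEnd]

theorem IsHomogEnd.smul {α : ZMod 2} {S : Module.End ℂ M} (c : ℂ) (hS : IsHomogEnd α S) :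
    IsHomogEnd α (c • S) := by
  unfold IsHomogEnd at *
  rw [mul_smul_comm, hS, smul_mul_assoc, smul_comm]

theorem IsHomogEnd.sum {ι : Type*} {α : ZMod 2} (s : Finset ι) {S : ι → Module.End ℂ M}
    (hS : ∀ i ∈ s, IsHomogEnd α (S i)) : IsHomogEnd α (∑ i ∈ s, S i) := by
  unfold IsHomogEnd at *
  rw [Finset.mul_sum, Finset.sum_mul, Finset.smul_sum]
  exact Finset.sum_congr rfl hS

theorem IsHomogEnd.swapMul {α β : ZMod 2} {S T : Module.End ℂ M} (hS : IsHomogEnd α S)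
    (hT : IsHomogEnd β T) : IsHomogEnd (α + β) (swapMul S T) := by
  rw [hS.swapMul_eq hT, add_comm]
  exact (hT.mul hS).smul _

/-- Bracketing with an even endomorphism is the ordinary commutator. -/
theorem IsHomogEnd.superComm_even {S : Module.End ℂ M} (h : IsHomogEnd 0 S)
    (T : Module.End ℂ M) : superComm S T = S * T - T * S := by
  rw [superComm, h.swapMul_eq_even]

theorem superComm_even_right (S : Module.End ℂ M) {T : Module.End ℂ M} (h : IsHomogEnd 0 T) :
    superComm S T = S * T - T * S := by
  have h1 : part 1 T = 0 := by simpa using h.part_add_one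
  rw [superComm, QuantumReduction.swapMul]
  simp only [sum_zmod_two, h.part_self, h1]
  simp only [part, zero_mul, mul_zero, smul_zero, add_zero, sgn_zero, sgn_one, one_smul,
    ← mul_add]
  congr 2
  module

/-- The supercommutator with a homogeneous endomorphism is a superderivation of the product. -/
theorem IsHomogEnd.superComm_mul {γ α : ZMod 2} {C S : Module.End ℂ M} (hC : IsHomogEnd γ C)
    (hS : IsHomogEnd α S) (T : Module.End ℂ M) :
    superComm C (S * T) = superComm C S * T + sgn (γ * α) • (S * superComm C T) := by
  have h : superComm C S = C * S - sgn (γ * α) • (S * C) := by rw [superComm, hC.swapMul_eq hS]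
  rw [h]
  rcases zmod_two_cases γ with rfl | rfl
  · rw [hC.superComm_even, hC.superComm_even, zero_mul, sgn_zero]
    simp only [one_smul]
    noncomm_ring
  · rw [superComm, superComm, hC.swapMul_eq_odd, hC.swapMul_eq_odd, one_mul]
    simp only [mul_assoc, hS.parity_mul_mul, sub_mul, mul_sub, smul_sub, smul_mul_assoc]
    abel

/-- The supercommutator with a homogeneous endomorphism is a superderivation of the opposite
product. -/
theorem IsHomogEnd.superComm_swapMul {γ α : ZMod 2} {C S : Module.End ℂ M} (hC : IsHomogEnd γ C)
    (hS : IsHomogEnd α S) (T : Module.End ℂ M) :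
    superComm C (QuantumReduction.swapMul S T) = QuantumReduction.swapMul (superComm C S) T +
      sgn (γ * α) • QuantumReduction.swapMul S (superComm C T) := by
  have h : superComm C S = C * S + (-sgn (γ * α)) • (S * C) := by
    rw [superComm, hC.swapMul_eq hS, neg_smul, sub_eq_add_neg]
  have hCS : IsHomogEnd (γ + α) (superComm C S) := by
    rw [h]
    exact (hC.mul hS).add (add_comm α γ ▸ (hS.mul hC).smul _)
  rcases zmod_two_cases γ with rfl | rfl <;> rcases zmod_two_cases α with rfl | rfl
  · rw [add_zero] at hCS
    rw [hCS.swapMul_eq_even, h, hS.swapMul_eq_even, hS.swapMul_eq_even,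
      hC.superComm_even, hC.superComm_even]
    simp only [mul_zero, sgn_zero, one_smul, neg_smul]
    noncomm_ring
  · rw [zero_add] at hCS
    rw [hCS.swapMul_eq_odd, h, hS.swapMul_eq_odd, hS.swapMul_eq_odd, hC.superComm_even,
      hC.superComm_even]
    simp only [zero_mul, sgn_zero, one_smul, neg_smul, mul_assoc, sub_mul, mul_sub, mul_add,
      mul_neg, hC.parity_mul_mul]
    abel
  · rw [add_zero] at hCS
    rw [hCS.swapMul_eq_odd, h, hS.swapMul_eq_even, hS.swapMul_eq_even, superComm,
      superComm, hC.swapMul_eq_odd, hC.swapMul_eq_odd]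
    simp only [mul_zero, sgn_zero, one_smul, neg_smul, mul_assoc, sub_mul, mul_add, mul_neg,
      hC.parity_mul_mul, hS.parity_mul_mul]
    abel
  · rw [zmod_two_add_self] at hCS
    rw [hCS.swapMul_eq_even, h, hS.swapMul_eq_odd, hS.swapMul_eq_odd, superComm,
      superComm, hC.swapMul_eq_odd, hC.swapMul_eq_odd]
    simp only [mul_one, sgn_one, one_smul, neg_smul, neg_neg, mul_assoc, sub_mul, mul_sub, mul_add,
      neg_mul, mul_neg, hC.parity_mul_mul, hS.parity_mul_mul, parity_mul_parity_mul]
    abel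

end EndAlgebra

/-! ### Modes of fields and partial sums of normally ordered products -/

section Modes

open SuperSpace Filter

variable {M : Type*} [AddCommGroup M] [Module ℂ M]

theorem field_ext {a b : VertexOperator ℂ M} (h : ∀ n, a.ncoeff n = b.ncoeff n) : a = b := by
  refine VertexOperator.ext a b fun v => ?_
  apply (HahnModule.of ℂ).symm.injective
  ext n
  have := LinearMap.congr_fun (h (-n - 1)) v
  simpa [VertexOperator.ncoeff_apply, HVertexOperator.coeff] using this

theorem ncoeff_add (a b : VertexOperator ℂ M) (n : ℤ) :
    (a + b).ncoeff n = a.ncoeff n + b.ncoeff n := by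
  rw [map_add]; rfl

theorem ncoeff_sub (a b : VertexOperator ℂ M) (n : ℤ) :
    (a - b).ncoeff n = a.ncoeff n - b.ncoeff n := by
  rw [map_sub]; rfl

theorem ncoeff_neg (a : VertexOperator ℂ M) (n : ℤ) : (-a).ncoeff n = -a.ncoeff n := by
  rw [map_neg]; rfl

theorem ncoeff_smul (c : ℂ) (a : VertexOperator ℂ M) (n : ℤ) :
    (c • a).ncoeff n = c • a.ncoeff n := by
  rw [map_smul]; rfl

theorem ncoeff_zero (n : ℤ) : (0 : VertexOperator ℂ M).ncoeff n = 0 := by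
  rw [map_zero]; rfl

theorem ncoeff_fieldDeriv (a : VertexOperator ℂ M) (n : ℤ) :
    (fieldDeriv a).ncoeff n = (-n : ℂ) • a.ncoeff (n - 1) := by
  rw [fieldDeriv, ncoeff_ofModes]

theorem ncoeff_idField (n : ℤ) :
    (idField : VertexOperator ℂ M).ncoeff n = if n = -1 then 1 else 0 := by
  rw [idField, ncoeff_ofModes]

/-- The derivative of fields as a linear map. -/
def fieldDerivₗ : VertexOperator ℂ M →ₗ[ℂ] VertexOperator ℂ M where
  toFun := fieldDeriv
  map_add' a b := field_ext fun n => by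
    simp only [ncoeff_fieldDeriv, ncoeff_add, smul_add]
  map_smul' c a := field_ext fun n => by
    simp only [ncoeff_fieldDeriv, ncoeff_smul, RingHom.id_apply, smul_comm c]

theorem fieldDerivₗ_apply (a : VertexOperator ℂ M) : fieldDerivₗ a = fieldDeriv a := rfl

theorem fieldDeriv_zero : fieldDeriv (0 : VertexOperator ℂ M) = 0 := by
  rw [← fieldDerivₗ_apply, map_zero]

theorem fieldDeriv_smul (c : ℂ) (a : VertexOperator ℂ M) :
    fieldDeriv (c • a) = c • fieldDeriv a := by
  rw [← fieldDerivₗ_apply, map_smul, fieldDerivₗ_apply]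

theorem fieldDeriv_add (a b : VertexOperator ℂ M) :
    fieldDeriv (a + b) = fieldDeriv a + fieldDeriv b := by
  rw [← fieldDerivₗ_apply, map_add, fieldDerivₗ_apply, fieldDerivₗ_apply]

theorem fieldDeriv_neg (a : VertexOperator ℂ M) : fieldDeriv (-a) = -fieldDeriv a := by
  rw [← fieldDerivₗ_apply, map_neg, fieldDerivₗ_apply]

theorem fieldDeriv_sum {ι : Type*} (s : Finset ι) (a : ι → VertexOperator ℂ M) :
    fieldDeriv (∑ i ∈ s, a i) = ∑ i ∈ s, fieldDeriv (a i) := by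
  simp only [← fieldDerivₗ_apply, map_sum]

theorem fieldDeriv_idField : fieldDeriv (idField : VertexOperator ℂ M) = 0 := by
  refine field_ext fun n => ?_
  rw [ncoeff_fieldDeriv, ncoeff_idField, ncoeff_zero]
  split_ifs with h
  · have : n = 0 := by omega
    simp [this]
  · rw [smul_zero]

/-- The sequence `T` of endomorphisms converges pointwise to `S`, for the discrete topology: on
each vector it is eventually equal to `S`. -/
def PointwiseLim (T : ℕ → Module.End ℂ M) (S : Module.End ℂ M) : Prop :=
  ∀ v, ∀ᶠ R in atTop, T R v = S v

namespace PointwiseLim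

variable {T T' : ℕ → Module.End ℂ M} {S S' : Module.End ℂ M}

theorem unique (h : PointwiseLim T S) (h' : PointwiseLim T S') : S = S' := by
  ext v
  obtain ⟨R, hR, hR'⟩ := ((h v).and (h' v)).exists
  exact hR.symm.trans hR'

theorem congr (h : PointwiseLim T S) (hT : ∀ R, T' R = T R) (hS : S' = S) :
    PointwiseLim T' S' := by
  intro v
  filter_upwards [h v] with R hR
  rw [hT, hR, hS]

theorem add (h : PointwiseLim T S) (h' : PointwiseLim T' S') :
    PointwiseLim (fun R => T R + T' R) (S + S') := by
  intro v
  filter_upwards [h v, h' v] with R hR hR'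
  simp [hR, hR']

theorem smul (c : ℂ) (h : PointwiseLim T S) : PointwiseLim (fun R => c • T R) (c • S) := by
  intro v
  filter_upwards [h v] with R hR
  simp [hR]

theorem sub (h : PointwiseLim T S) (h' : PointwiseLim T' S') :
    PointwiseLim (fun R => T R - T' R) (S - S') := by
  intro v
  filter_upwards [h v, h' v] with R hR hR'
  simp [hR, hR']

theorem mul_left (X : Module.End ℂ M) (h : PointwiseLim T S) :
    PointwiseLim (fun R => X * T R) (X * S) := by
  intro v
  filter_upwards [h v] with R hR
  simp [hR]

theorem mul_right (h : PointwiseLim T S) (X : Module.End ℂ M) :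
    PointwiseLim (fun R => T R * X) (S * X) := by
  intro v
  filter_upwards [h (X v)] with R hR
  simp [hR]

variable [SuperSpace M]

theorem superComm {γ : ZMod 2} {C : Module.End ℂ M} (hC : IsHomogEnd γ C)
    (h : PointwiseLim T S) :
    PointwiseLim (fun R => superComm C (T R)) (QuantumReduction.superComm C S) := by
  rcases zmod_two_cases γ with rfl | rfl
  · simp only [hC.superComm_even]
    exact (h.mul_left C).sub (h.mul_right C)
  · simp only [QuantumReduction.superComm, hC.swapMul_eq_odd, mul_assoc]
    exact (h.mul_left C).sub ((h.mul_right (parity * C)).mul_left parity)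

theorem isHomogEnd {α : ZMod 2} (h : PointwiseLim T S) (hT : ∀ R, IsHomogEnd α (T R)) :
    IsHomogEnd α S :=
  (h.mul_left parity).unique (((h.mul_right parity).smul (sgn α)).congr hT rfl)

end PointwiseLim

theorem eventually_finsum_eq_sum_range {V : Type*} [AddCommMonoid V] {f : ℕ → V}
    (h : (Function.support f).Finite) : ∀ᶠ R in atTop, ∑ᶠ i, f i = ∑ i ∈ Finset.range R, f i := by
  obtain ⟨N, hN⟩ := h.bddAbove
  filter_upwards [eventually_gt_atTop N] with R hR
  refine finsum_eq_sum_of_support_subset _ fun i hi => ?_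
  exact Finset.mem_coe.2 (Finset.mem_range.2 ((hN hi).trans_lt hR))

theorem eventually_ncoeff_add_eq_zero (b : VertexOperator ℂ M) (n : ℤ) (v : M) :
    ∀ᶠ R : ℕ in atTop, b.ncoeff (n + R) v = 0 := by
  obtain ⟨N, hN⟩ := exists_ncoeff_eq_zero b v
  filter_upwards [eventually_ge_atTop (N - n).toNat] with R hR
  exact hN _ (by omega)

variable [SuperSpace M]

theorem eventually_swapMul_eq_zero (a : VertexOperator ℂ M) (n : ℤ) (v : M) :
    ∀ᶠ R : ℕ in atTop, ∀ T, swapMul (a.ncoeff (n + R)) T v = 0 := by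
  obtain ⟨N, hN⟩ := exists_swapMul_eq_zero_left a v
  filter_upwards [eventually_ge_atTop (N - n).toNat] with R hR
  exact hN _ (by omega)

/-- The partial sums of the normally ordered product of `a` and `b` in which the modes `a₍ₚ₎` with
`p < s` (in place of `p < 0`) are regarded as creation operators. -/
def partialNormal (a b : VertexOperator ℂ M) (s n : ℤ) (R : ℕ) : Module.End ℂ M :=
  ∑ i ∈ Finset.range R, (a.ncoeff (s - 1 - i) * b.ncoeff (n - s + i) +
    swapMul (a.ncoeff (s + i)) (b.ncoeff (n - 1 - s - i)))

theorem pointwiseLim_partialNormal_zero (a b : VertexOperator ℂ M) (n : ℤ) :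
    PointwiseLim (partialNormal a b 0 n) ((normalProd a b).ncoeff n) := by
  intro v
  filter_upwards [eventually_finsum_eq_sum_range (finite_support_left a b n v),
    eventually_finsum_eq_sum_range (finite_support_right a b n v)] with R h1 h2
  rw [normalProd, ncoeff_ofModes]
  change _ = (∑ᶠ i : ℕ, a.ncoeff (-1 - i) (b.ncoeff (n + i) v)) +
      ∑ᶠ i : ℕ, swapMul (a.ncoeff i) (b.ncoeff (n - 1 - i)) v
  rw [h1, h2, ← Finset.sum_add_distrib, partialNormal, LinearMap.sum_apply]
  simp only [zero_sub, sub_zero, zero_add, LinearMap.add_apply, Module.End.mul_apply]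

/-- Moving the mode `a₍ₛ₎` from the annihilation to the creation operators changes the partial sums
by a supercommutator. -/
theorem pointwiseLim_partialNormal_succ_sub (a b : VertexOperator ℂ M) (s n : ℤ) :
    PointwiseLim (fun R => partialNormal a b (s + 1) n R - partialNormal a b s n R)
      (superComm (a.ncoeff s) (b.ncoeff (n - 1 - s))) := by
  intro v
  filter_upwards [eventually_ncoeff_add_eq_zero b (n - 1 - s) v,
    eventually_swapMul_eq_zero a s v] with R h1 h2
  have key : ∀ R : ℕ, partialNormal a b (s + 1) n R - partialNormal a b s n R =
      superComm (a.ncoeff s) (b.ncoeff (n - 1 - s)) -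
        a.ncoeff (s - R) * b.ncoeff (n - 1 - s + R) +
        swapMul (a.ncoeff (s + R)) (b.ncoeff (n - 1 - s - R)) := by
    intro R
    induction R with
    | zero => simp [partialNormal, superComm]
    | succ R ih =>
      have e : ∀ s, partialNormal a b s n (R + 1) = partialNormal a b s n R +
          (a.ncoeff (s - 1 - R) * b.ncoeff (n - s + R) +
            swapMul (a.ncoeff (s + R)) (b.ncoeff (n - 1 - s - R))) := fun s => by
        rw [partialNormal, partialNormal, Finset.sum_range_succ]
      rw [e, e, add_sub_add_comm, ih]
      have e1 : s + 1 - 1 - (R : ℤ) = s - R := by ring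
      have e2 : n - (s + 1) + (R : ℤ) = n - 1 - s + R := by ring
      have e3 : s + 1 + (R : ℤ) = s + ((R + 1 : ℕ) : ℤ) := by push_cast; ring
      have e4 : n - 1 - (s + 1) - (R : ℤ) = n - 1 - s - ((R + 1 : ℕ) : ℤ) := by push_cast; ring
      have e5 : s - 1 - (R : ℤ) = s - ((R + 1 : ℕ) : ℤ) := by push_cast; ring
      have e6 : n - s + (R : ℤ) = n - 1 - s + ((R + 1 : ℕ) : ℤ) := by push_cast; ring
      rw [e1, e2, e3, e4, e5, e6]
      abel
  rw [key]
  simp [h1, h2]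

/-- A field all of whose modes are homogeneous of parity `α`. -/
def IsHomogField (α : ZMod 2) (a : VertexOperator ℂ M) : Prop :=
  ∀ n, IsHomogEnd α (a.ncoeff n)

theorem isEvenField_iff {a : VertexOperator ℂ M} : IsEvenField a ↔ IsHomogField 0 a := by
  simp [IsEvenField, IsHomogField, IsHomogEnd, sgn_zero]

namespace IsHomogField

variable {α β : ZMod 2} {a b : VertexOperator ℂ M}

theorem zero : IsHomogField α (0 : VertexOperator ℂ M) := fun n => by
  rw [ncoeff_zero]; exact IsHomogEnd.zero α

theorem add (ha : IsHomogField α a) (hb : IsHomogField α b) : IsHomogField α (a + b) := fun n => by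
  rw [ncoeff_add]; exact (ha n).add (hb n)

theorem smul (c : ℂ) (ha : IsHomogField α a) : IsHomogField α (c • a) := fun n => by
  rw [ncoeff_smul]; exact (ha n).smul c

theorem neg (ha : IsHomogField α a) : IsHomogField α (-a) := by
  rw [← neg_one_smul ℂ]; exact ha.smul _

theorem sum {ι : Type*} (s : Finset ι) {a : ι → VertexOperator ℂ M}
    (ha : ∀ i ∈ s, IsHomogField α (a i)) : IsHomogField α (∑ i ∈ s, a i) :=
  Finset.sum_induction a (IsHomogField α) (fun _ _ => add) zero ha

theorem deriv (ha : IsHomogField α a) : IsHomogField α (fieldDeriv a) := fun n => by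
  rw [ncoeff_fieldDeriv]; exact (ha _).smul _

theorem normalProd (ha : IsHomogField α a) (hb : IsHomogField β b) :
    IsHomogField (α + β) (normalProd a b) := fun n =>
  (pointwiseLim_partialNormal_zero a b n).isHomogEnd fun _ =>
    IsHomogEnd.sum _ fun _ _ => ((ha _).mul (hb _)).add ((ha _).swapMul (hb _))

end IsHomogField

/-- The normally ordered product as a bilinear map. -/
def normalProdₗ : VertexOperator ℂ M →ₗ[ℂ] VertexOperator ℂ M →ₗ[ℂ] VertexOperator ℂ M :=
  LinearMap.mk₂ ℂ normalProd
    (fun a a' b => field_ext fun n => (pointwiseLim_partialNormal_zero _ _ n).unique <| by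
      rw [ncoeff_add]
      refine ((pointwiseLim_partialNormal_zero a b n).add
        (pointwiseLim_partialNormal_zero a' b n)).congr (fun R => ?_) rfl
      simp only [partialNormal, ncoeff_add, add_mul, swapMul_add_left, ← Finset.sum_add_distrib]
      exact Finset.sum_congr rfl fun _ _ => by abel)
    (fun c a b => field_ext fun n => (pointwiseLim_partialNormal_zero _ _ n).unique <| by
      rw [ncoeff_smul]
      refine ((pointwiseLim_partialNormal_zero a b n).smul c).congr (fun R => ?_) rfl
      simp only [partialNormal, ncoeff_smul, smul_mul_assoc, swapMul_smul_left, Finset.smul_sum,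
        smul_add])
    (fun a b b' => field_ext fun n => (pointwiseLim_partialNormal_zero _ _ n).unique <| by
      rw [ncoeff_add]
      refine ((pointwiseLim_partialNormal_zero a b n).add
        (pointwiseLim_partialNormal_zero a b' n)).congr (fun R => ?_) rfl
      simp only [partialNormal, ncoeff_add, mul_add, swapMul_add_right, ← Finset.sum_add_distrib]
      exact Finset.sum_congr rfl fun _ _ => by abel)
    (fun c a b => field_ext fun n => (pointwiseLim_partialNormal_zero _ _ n).unique <| by
      rw [ncoeff_smul]
      refine ((pointwiseLim_partialNormal_zero a b n).smul c).congr (fun R => ?_) rfl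
      simp only [partialNormal, ncoeff_smul, mul_smul_comm, swapMul_smul_right, Finset.smul_sum,
        smul_add])

theorem normalProdₗ_apply (a b : VertexOperator ℂ M) : normalProdₗ a b = normalProd a b := rfl

theorem normalProd_smul_left (c : ℂ) (a b : VertexOperator ℂ M) :
    normalProd (c • a) b = c • normalProd a b := by
  simp only [← normalProdₗ_apply, map_smul, LinearMap.smul_apply]

theorem normalProd_smul_right (c : ℂ) (a b : VertexOperator ℂ M) :
    normalProd a (c • b) = c • normalProd a b := by
  simp only [← normalProdₗ_apply, map_smul]

theorem normalProd_add_left (a a' b : VertexOperator ℂ M) :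
    normalProd (a + a') b = normalProd a b + normalProd a' b := by
  simp only [← normalProdₗ_apply, map_add, LinearMap.add_apply]

theorem normalProd_add_right (a b b' : VertexOperator ℂ M) :
    normalProd a (b + b') = normalProd a b + normalProd a b' := by
  simp only [← normalProdₗ_apply, map_add]

theorem normalProd_zero_left (b : VertexOperator ℂ M) : normalProd 0 b = 0 := by
  simp only [← normalProdₗ_apply, map_zero, LinearMap.zero_apply]

theorem normalProd_zero_right (a : VertexOperator ℂ M) : normalProd a 0 = 0 := by
  simp only [← normalProdₗ_apply, map_zero]

theorem isHomogField_idField : IsHomogField 0 (idField : VertexOperator ℂ M) := fun n => by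
  rw [ncoeff_idField, IsHomogEnd]
  split_ifs <;> simp [sgn_zero]

theorem normalProd_idField_left (b : VertexOperator ℂ M) : normalProd idField b = b := by
  refine field_ext fun n => (pointwiseLim_partialNormal_zero _ _ n).unique fun v => ?_
  filter_upwards [eventually_ge_atTop 1] with R hR
  obtain ⟨R, rfl⟩ := Nat.exists_eq_add_of_le' hR
  rw [partialNormal, Finset.sum_range_succ', Finset.sum_eq_zero]
  · simp [ncoeff_idField, swapMul_zero_left]
  · intro i _
    rw [ncoeff_idField, ncoeff_idField, if_neg (by push_cast; omega), if_neg (by push_cast; omega),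
      zero_mul, swapMul_zero_left, add_zero]

theorem normalProd_idField_right (a : VertexOperator ℂ M) : normalProd a idField = a := by
  refine field_ext fun n => (pointwiseLim_partialNormal_zero _ _ n).unique fun v => ?_
  have h : ∀ S : Module.End ℂ M, swapMul S 1 = S := fun S => by
    have := superComm_even_right S (isHomogField_idField (M := M) (-1))
    rw [ncoeff_idField, if_pos rfl, superComm, mul_one, one_mul, sub_self, sub_eq_zero] at this
    exact this.symm
  filter_upwards [eventually_gt_atTop n.natAbs] with R hR
  rw [partialNormal, LinearMap.sum_apply]
  by_cases hn : n < 0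
  · rw [Finset.sum_eq_single (-1 - n).toNat]
    · rw [ncoeff_idField, ncoeff_idField, if_pos (by omega), if_neg (by omega), mul_one,
        swapMul_zero_right, add_zero, show 0 - 1 - ((-1 - n).toNat : ℤ) = n by omega]
    · intro i _ hi
      rw [ncoeff_idField, ncoeff_idField, if_neg (by omega), if_neg (by omega), mul_zero,
        swapMul_zero_right, add_zero]
      rfl
    · intro h
      simp only [Finset.mem_range] at h
      omega
  · rw [Finset.sum_eq_single n.toNat]
    · rw [ncoeff_idField, ncoeff_idField, if_neg (by omega), if_pos (by omega), mul_zero, h,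
        zero_add, show 0 + (n.toNat : ℤ) = n by omega]
    · intro i _ hi
      rw [ncoeff_idField, ncoeff_idField, if_neg (by omega), if_neg (by omega), mul_zero,
        swapMul_zero_right, add_zero]
      rfl
    · intro h
      simp only [Finset.mem_range] at h
      omega

/-- The Leibniz rule for the normally ordered product. The partial sums of the two sides differ by
a telescoping sum. -/
theorem fieldDeriv_normalProd (a b : VertexOperator ℂ M) :
    fieldDeriv (normalProd a b) = normalProd (fieldDeriv a) b + normalProd a (fieldDeriv b) := by
  refine field_ext fun n => ?_
  rw [ncoeff_fieldDeriv, ncoeff_add]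
  refine (((pointwiseLim_partialNormal_zero a b (n - 1)).smul (-n : ℂ)).unique ?_)
  refine fun v => ?_
  filter_upwards [pointwiseLim_partialNormal_zero (fieldDeriv a) b n v,
    pointwiseLim_partialNormal_zero a (fieldDeriv b) n v,
    eventually_ncoeff_add_eq_zero b (n - 1) v, eventually_swapMul_eq_zero a (-1) v]
    with R h1 h2 h3 h4
  have key : ∀ R : ℕ, partialNormal (fieldDeriv a) b 0 n R + partialNormal a (fieldDeriv b) 0 n R =
      (-n : ℂ) • partialNormal a b 0 (n - 1) R +
        (R : ℂ) • (a.ncoeff (-1 - R) * b.ncoeff (n - 1 + R)) +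
        (R : ℂ) • swapMul (a.ncoeff (-1 + R)) (b.ncoeff (n - 1 - R)) := by
    intro R
    induction R with
    | zero => simp [partialNormal]
    | succ R ih =>
      have e : ∀ (a b : VertexOperator ℂ M) (n), partialNormal a b 0 n (R + 1) =
          partialNormal a b 0 n R + (a.ncoeff (-1 - R) * b.ncoeff (n + R) +
            swapMul (a.ncoeff R) (b.ncoeff (n - 1 - R))) := fun a b n => by
        rw [partialNormal, partialNormal, Finset.sum_range_succ]
        simp only [zero_sub, sub_zero, zero_add]
      rw [e, e, e, add_add_add_comm, ih]
      simp only [ncoeff_fieldDeriv, swapMul_smul_left, swapMul_smul_right, smul_mul_assoc,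
        mul_smul_comm]
      have e1 : -1 - (R : ℤ) - 1 = -1 - ((R + 1 : ℕ) : ℤ) := by push_cast; ring
      have e2 : n + (R : ℤ) = n - 1 + ((R + 1 : ℕ) : ℤ) := by push_cast; ring
      have e3 : (R : ℤ) = -1 + ((R + 1 : ℕ) : ℤ) := by push_cast; ring
      have e4 : n - 1 - (R : ℤ) - 1 = n - 1 - ((R + 1 : ℕ) : ℤ) := by ring_nf; push_cast; ring
      have e5 : n + (R : ℤ) - 1 = n - 1 + R := by ring
      have e6 : (R : ℤ) - 1 = -1 + R := by ring
      have e7 : n - 1 - 1 - (R : ℤ) = n - 1 - ((R + 1 : ℕ) : ℤ) := by push_cast; ring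
      rw [e5, e6, e1, e4, e7, e2]
      conv_rhs => rw [← e3]
      push_cast
      module
  have := congrArg (fun T => T v) (key R)
  simp only [LinearMap.add_apply, LinearMap.smul_apply, Module.End.mul_apply, h3, h4, map_zero,
    smul_zero, add_zero] at this
  rw [LinearMap.add_apply, ← h1, ← h2, this, LinearMap.smul_apply]

end Modes

/-! ### The calculus of `λ`-brackets of degree at most three -/

section Bracket

open SuperSpace Filter

variable {M : Type*} [AddCommGroup M] [Module ℂ M] [SuperSpace M]

/-- The commutator formula `[a₍ₘ₎, b₍ₙ₎] = ∑ⱼ (m choose j) (Aⱼ)₍ₘ₊ₙ₋ⱼ₎` with `j ≤ 3`. It says that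
`a` and `b` are local and that `a₍ⱼ₎b = Aⱼ` for `j ≤ 3` and `a₍ⱼ₎b = 0` for `j > 3`, that is,
`[a_λ b] = A₀ + λ A₁ + λ²/2 A₂ + λ³/6 A₃`. -/
def HasBracket (a b A₀ A₁ A₂ A₃ : VertexOperator ℂ M) : Prop :=
  ∀ m n : ℤ, superComm (a.ncoeff m) (b.ncoeff n) =
    A₀.ncoeff (m + n) + (m : ℂ) • A₁.ncoeff (m + n - 1) +
      ((m : ℂ) * (m - 1) / 2) • A₂.ncoeff (m + n - 2) +
      ((m : ℂ) * (m - 1) * (m - 2) / 6) • A₃.ncoeff (m + n - 3)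

namespace HasBracket

variable {a b A₀ A₁ A₂ A₃ a' b' B₀ B₁ B₂ B₃ : VertexOperator ℂ M}

theorem congr (h : HasBracket a b A₀ A₁ A₂ A₃) (h₀ : A₀ = B₀) (h₁ : A₁ = B₁) (h₂ : A₂ = B₂)
    (h₃ : A₃ = B₃) : HasBracket a b B₀ B₁ B₂ B₃ := by
  subst h₀ h₁ h₂ h₃; exact h

theorem zero_left : HasBracket (0 : VertexOperator ℂ M) b 0 0 0 0 := by
  intro m n; simp only [ncoeff_zero, superComm_zero_left, smul_zero, add_zero]

theorem zero_right : HasBracket a (0 : VertexOperator ℂ M) 0 0 0 0 := by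
  intro m n; simp only [ncoeff_zero, superComm_zero_right, smul_zero, add_zero]

theorem add_left (h : HasBracket a b A₀ A₁ A₂ A₃) (h' : HasBracket a' b B₀ B₁ B₂ B₃) :
    HasBracket (a + a') b (A₀ + B₀) (A₁ + B₁) (A₂ + B₂) (A₃ + B₃) := by
  intro m n
  simp only [ncoeff_add, superComm_add_left, h m n, h' m n]
  module

theorem add_right (h : HasBracket a b A₀ A₁ A₂ A₃) (h' : HasBracket a b' B₀ B₁ B₂ B₃) :
    HasBracket a (b + b') (A₀ + B₀) (A₁ + B₁) (A₂ + B₂) (A₃ + B₃) := by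
  intro m n
  simp only [ncoeff_add, superComm_add_right, h m n, h' m n]
  module

theorem smul_left (c : ℂ) (h : HasBracket a b A₀ A₁ A₂ A₃) :
    HasBracket (c • a) b (c • A₀) (c • A₁) (c • A₂) (c • A₃) := by
  intro m n
  simp only [ncoeff_smul, superComm_smul_left, h m n]
  module

theorem smul_right (c : ℂ) (h : HasBracket a b A₀ A₁ A₂ A₃) :
    HasBracket a (c • b) (c • A₀) (c • A₁) (c • A₂) (c • A₃) := by
  intro m n
  simp only [ncoeff_smul, superComm_smul_right, h m n]
  module

theorem sum_right {ι : Type*} (s : Finset ι) {b A₀ A₁ A₂ A₃ : ι → VertexOperator ℂ M}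
    (h : ∀ i ∈ s, HasBracket a (b i) (A₀ i) (A₁ i) (A₂ i) (A₃ i)) :
    HasBracket a (∑ i ∈ s, b i) (∑ i ∈ s, A₀ i) (∑ i ∈ s, A₁ i) (∑ i ∈ s, A₂ i)
      (∑ i ∈ s, A₃ i) := by
  classical
  induction s using Finset.induction_on with
  | empty => simpa using zero_right
  | insert i s hi ih =>
    simp only [Finset.sum_insert hi]
    exact (h i (Finset.mem_insert_self i s)).add_right
      (ih fun j hj => h j (Finset.mem_insert_of_mem hj))

theorem deriv_left (h : HasBracket a b A₀ A₁ A₂ 0) :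
    HasBracket (fieldDeriv a) b 0 (-A₀) ((-2 : ℂ) • A₁) ((-3 : ℂ) • A₂) := by
  intro m n
  have e1 : m - 1 + n = m + n - 1 := by ring
  have e2 : m + n - 1 - 1 = m + n - 2 := by ring
  have e3 : m + n - 1 - 2 = m + n - 3 := by ring
  simp only [ncoeff_fieldDeriv, superComm_smul_left, h _ _, ncoeff_neg, ncoeff_smul, ncoeff_zero,
    e1, e2, e3]
  push_cast
  module

theorem deriv_right (h : HasBracket a b A₀ A₁ A₂ 0) :
    HasBracket a (fieldDeriv b) (fieldDeriv A₀) (fieldDeriv A₁ + A₀)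
      (fieldDeriv A₂ + (2 : ℂ) • A₁) ((3 : ℂ) • A₂) := by
  intro m n
  have e1 : m + (n - 1) = m + n - 1 := by ring
  have e2 : m + n - 1 - 1 = m + n - 2 := by ring
  have e3 : m + n - 1 - 2 = m + n - 3 := by ring
  have e4 : m + n - 2 - 1 = m + n - 3 := by ring
  simp only [ncoeff_fieldDeriv, superComm_smul_right, h _ _, ncoeff_add, ncoeff_smul, ncoeff_zero,
    e1, e2, e3, e4]
  push_cast
  module

/-- Skew-symmetry `[b_λ a] = -[a_{-λ-∂} b]` for an even field `b`. -/
theorem skew (h : HasBracket a b A₀ A₁ 0 0) (hb : IsHomogField 0 b) :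
    HasBracket b a (fieldDeriv A₁ - A₀) A₁ 0 0 := by
  intro m n
  have h1 := h n m
  rw [superComm_even_right _ (hb m)] at h1
  rw [(hb m).superComm_even, ← neg_sub, h1, add_comm n m]
  simp only [ncoeff_fieldDeriv, ncoeff_sub, ncoeff_zero]
  push_cast
  module

/-- Skew-symmetry forces the coefficient of `λ²` in `[a_λ a]` to vanish when `[a_λ a]` has the shape
of a Virasoro `λ`-bracket up to this coefficient. -/
theorem virasoro_quadratic_eq_zero {t : ℂ} (ha : IsHomogField 0 a)
    (h : HasBracket a a (fieldDeriv a) ((2 : ℂ) • a) A₂ (t • idField)) : A₂ = 0 := by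
  refine field_ext fun p => ?_
  -- the modes `m = p + 3`, `n = -1` make the coefficient of `A₂` nonzero for every `p`
  have h1 := h (p + 3) (-1)
  have h2 := h (-1) (p + 3)
  rw [(ha _).superComm_even] at h1 h2
  have h3 := congrArg₂ (· + ·) h1 h2
  have e1 : p + 3 + -1 - 1 = p + 1 := by ring
  have e2 : p + 3 + -1 - 2 = p := by ring
  have e3 : -1 + (p + 3) = p + 3 + -1 := by ring
  simp only [e3, e1, e2, sub_add_sub_cancel, sub_self, ncoeff_fieldDeriv, ncoeff_smul,
    ncoeff_idField] at h3
  have h4 : (((p : ℂ) + 3) * (p + 2) / 2 + 1) • A₂.ncoeff p = 0 := by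
    by_cases hp : p = 0
    · subst hp
      have h6 : (4 : ℂ) • A₂.ncoeff 0 = 0 := by
        norm_num at h3
        exact Eq.trans (by module) h3.symm
      norm_num
      simpa using h6
    · rw [if_neg (by omega)] at h3
      push_cast at h3
      rw [h3]
      module
  rw [ncoeff_zero]
  refine (smul_eq_zero.1 h4).resolve_left fun h0 => ?_
  have h5 : ((p + 3) * (p + 2) + 2 : ℤ) = 0 := by
    have : (((p + 3) * (p + 2) + 2 : ℤ) : ℂ) = 0 := by
      push_cast
      linear_combination 2 * h0
    exact_mod_cast this
  nlinarith [sq_nonneg (2 * p + 5)]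

/-- The partial sums of `:ab:` with the creation operators shifted by `s` converge to `:ab:` up to
the sum of the supercommutators `[a₍ₜ₎, b₍ₙ₋₁₋ₜ₎]` over the (signed) range from `0` to `s`. -/
theorem pointwiseLim_partialNormal (h : HasBracket a b A₀ A₁ A₂ 0) (s n : ℤ) :
    PointwiseLim (partialNormal a b s n) ((normalProd a b).ncoeff n + (s : ℂ) • A₀.ncoeff (n - 1) +
      ((s : ℂ) * (s - 1) / 2) • A₁.ncoeff (n - 2) +
      ((s : ℂ) * (s - 1) * (s - 2) / 6) • A₂.ncoeff (n - 3)) := by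
  have step : ∀ s : ℤ, superComm (a.ncoeff s) (b.ncoeff (n - 1 - s)) =
      A₀.ncoeff (n - 1) + (s : ℂ) • A₁.ncoeff (n - 2) +
        ((s : ℂ) * (s - 1) / 2) • A₂.ncoeff (n - 3) := fun s => by
    have e0 : s + (n - 1 - s) = n - 1 := by ring
    have e1 : n - 1 - 1 = n - 2 := by ring
    have e2 : n - 1 - 2 = n - 3 := by ring
    rw [h s (n - 1 - s), ncoeff_zero, smul_zero, add_zero, e0, e1, e2]
  induction s using Int.induction_on with
  | zero =>
    refine (pointwiseLim_partialNormal_zero a b n).congr (fun _ => rfl) ?_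
    push_cast
    module
  | succ i ih =>
    refine (ih.add (pointwiseLim_partialNormal_succ_sub a b i n)).congr
      (fun R => (add_sub_cancel _ _).symm) ?_
    rw [step]
    push_cast
    module
  | pred i ih =>
    have h1 := pointwiseLim_partialNormal_succ_sub a b (-i - 1) n
    rw [sub_add_cancel] at h1
    refine (ih.sub h1).congr (fun R => (sub_sub_cancel _ _).symm) ?_
    rw [step]
    push_cast
    module

/-- The noncommutative Wick formula
`[c_λ :ab:] = :[c_λ a]b: + (-1)^{p(c)p(a)} :a[c_λ b]: + ∫₀^λ [[c_λ a]_μ b] dμ`.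
Here `Aⱼ = c₍ⱼ₎a`, `Bⱼ = c₍ⱼ₎b` and `Eⱼₗ = (c₍ⱼ₎a)₍ₗ₎b`, and the integral has degree at most
three in `λ`. -/
theorem wick {c A₀ A₁ A₂ A₃ B₀ B₁ B₂ B₃ E₀₀ E₀₁ E₀₂ E₁₀ E₁₁ E₂₀ : VertexOperator ℂ M}
    {γ α : ZMod 2} (hc : IsHomogField γ c) (ha : IsHomogField α a)
    (hA : HasBracket c a A₀ A₁ A₂ A₃) (hB : HasBracket c b B₀ B₁ B₂ B₃)
    (h₀ : HasBracket A₀ b E₀₀ E₀₁ E₀₂ 0) (h₁ : HasBracket A₁ b E₁₀ E₁₁ 0 0)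
    (h₂ : HasBracket A₂ b E₂₀ 0 0 0) (h₃ : HasBracket A₃ b 0 0 0 0) :
    HasBracket c (normalProd a b)
      (normalProd A₀ b + sgn (γ * α) • normalProd a B₀)
      (normalProd A₁ b + sgn (γ * α) • normalProd a B₁ + E₀₀)
      (normalProd A₂ b + sgn (γ * α) • normalProd a B₂ + E₀₁ + (2 : ℂ) • E₁₀)
      (normalProd A₃ b + sgn (γ * α) • normalProd a B₃ + E₀₂ + (3 : ℂ) • E₁₁ +
        (3 : ℂ) • E₂₀) := by
  intro m n
  have hlim := ((pointwiseLim_partialNormal_zero a b n).superComm (hc m))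
  have l₀ := h₀.pointwiseLim_partialNormal m (m + n)
  have l₁ := (h₁.pointwiseLim_partialNormal (m - 1) (m + n - 1)).smul (m : ℂ)
  have l₂ := (h₂.pointwiseLim_partialNormal (m - 2) (m + n - 2)).smul ((m : ℂ) * (m - 1) / 2)
  have l₃ := (h₃.pointwiseLim_partialNormal (m - 3) (m + n - 3)).smul
    ((m : ℂ) * (m - 1) * (m - 2) / 6)
  have r₀ := (pointwiseLim_partialNormal_zero a B₀ (m + n)).smul (sgn (γ * α))
  have r₁ := ((pointwiseLim_partialNormal_zero a B₁ (m + n - 1)).smul (m : ℂ)).smul (sgn (γ * α))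
  have r₂ := ((pointwiseLim_partialNormal_zero a B₂ (m + n - 2)).smul
    ((m : ℂ) * (m - 1) / 2)).smul (sgn (γ * α))
  have r₃ := ((pointwiseLim_partialNormal_zero a B₃ (m + n - 3)).smul
    ((m : ℂ) * (m - 1) * (m - 2) / 6)).smul (sgn (γ * α))
  refine hlim.unique (((((l₀.add l₁).add l₂).add l₃).add
    (((r₀.add r₁).add r₂).add r₃)).congr (fun R => ?_) ?_)
  · rw [partialNormal, superComm_sum_right]
    simp only [partialNormal, Finset.smul_sum, ← Finset.sum_add_distrib]
    refine Finset.sum_congr rfl fun i _ => ?_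
    rw [superComm_add_right, (hc m).superComm_mul (ha _), (hc m).superComm_swapMul (ha _),
      hA, hA, hB, hB]
    have a₀ : m + (0 - 1 - (i : ℤ)) = m - 1 - i := by ring
    have a₁ : m - 1 - (i : ℤ) - 1 = m - 1 - 1 - i := by ring
    have a₂ : m - 1 - (i : ℤ) - 2 = m - 2 - 1 - i := by ring
    have a₃ : m - 1 - (i : ℤ) - 3 = m - 3 - 1 - i := by ring
    have b₀ : m + (n - 0 + (i : ℤ)) = m + n - 0 + i := by ring
    have b₁ : m + n - 0 + (i : ℤ) - 1 = m + n - 1 - 0 + i := by ring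
    have b₂ : m + n - 0 + (i : ℤ) - 2 = m + n - 2 - 0 + i := by ring
    have b₃ : m + n - 0 + (i : ℤ) - 3 = m + n - 3 - 0 + i := by ring
    have c₀ : m + (0 + (i : ℤ)) = m + i := by ring
    have c₁ : m + (i : ℤ) - 1 = m - 1 + i := by ring
    have c₂ : m + (i : ℤ) - 2 = m - 2 + i := by ring
    have c₃ : m + (i : ℤ) - 3 = m - 3 + i := by ring
    have d₀ : m + (n - 1 - 0 - (i : ℤ)) = m + n - 1 - 0 - i := by ring
    have d₁ : m + n - 1 - 0 - (i : ℤ) - 1 = m + n - 1 - 1 - 0 - i := by ring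
    have d₂ : m + n - 1 - 0 - (i : ℤ) - 2 = m + n - 2 - 1 - 0 - i := by ring
    have d₃ : m + n - 1 - 0 - (i : ℤ) - 3 = m + n - 3 - 1 - 0 - i := by ring
    have f₀ : m + n - m + (i : ℤ) = n - 0 + i := by ring
    have f₁ : m + n - 1 - (m - 1) + (i : ℤ) = n - 0 + i := by ring
    have f₂ : m + n - 2 - (m - 2) + (i : ℤ) = n - 0 + i := by ring
    have f₃ : m + n - 3 - (m - 3) + (i : ℤ) = n - 0 + i := by ring
    have g₀ : m + n - 1 - m - (i : ℤ) = n - 1 - 0 - i := by ring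
    have g₁ : m + n - 1 - 1 - (m - 1) - (i : ℤ) = n - 1 - 0 - i := by ring
    have g₂ : m + n - 2 - 1 - (m - 2) - (i : ℤ) = n - 1 - 0 - i := by ring
    have g₃ : m + n - 3 - 1 - (m - 3) - (i : ℤ) = n - 1 - 0 - i := by ring
    simp only [a₀, a₁, a₂, a₃, b₀, b₁, b₂, b₃, c₀, c₁, c₂, c₃, d₀, d₁, d₂, d₃, f₀, f₁, f₂, f₃,
      g₀, g₁, g₂, g₃, add_mul, mul_add, smul_mul_assoc, mul_smul_comm, swapMul_add_left,
      swapMul_add_right, swapMul_smul_left, swapMul_smul_right, smul_add]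
    abel
  · have e₁ : m + n - 1 - 1 = m + n - 2 := by ring
    have e₂ : m + n - 1 - 2 = m + n - 3 := by ring
    have e₃ : m + n - 2 - 1 = m + n - 3 := by ring
    simp only [ncoeff_add, ncoeff_smul, ncoeff_zero, e₁, e₂, e₃, smul_zero, add_zero]
    push_cast
    module

/-- The Wick formula for a field whose brackets with the two factors vanish. -/
theorem wick_zero {c : VertexOperator ℂ M} {γ α : ZMod 2} (hc : IsHomogField γ c)
    (ha : IsHomogField α a) (hA : HasBracket c a 0 0 0 0) (hB : HasBracket c b 0 0 0 0) :
    HasBracket c (normalProd a b) 0 0 0 0 := by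
  have h := wick hc ha hA hB zero_left zero_left zero_left zero_left
  simpa only [normalProd_zero_left, normalProd_zero_right, smul_zero, add_zero] using h

theorem idField_left (b : VertexOperator ℂ M) : HasBracket idField b 0 0 0 0 := by
  intro m n
  have h : superComm (1 : Module.End ℂ M) (b.ncoeff n) = 0 := by
    have := (isHomogField_idField (M := M) (-1)).superComm_even (b.ncoeff n)
    rwa [ncoeff_idField, if_pos rfl, one_mul, mul_one, sub_self] at this
  rw [ncoeff_idField]
  split_ifs
  · simp only [h, ncoeff_zero, smul_zero, add_zero]
  · simp only [superComm_zero_left, ncoeff_zero, smul_zero, add_zero]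

/-- The Wick formula for free fields: all brackets with the factors are multiples of the
identity field. -/
theorem wick_free {c : VertexOperator ℂ M} {γ α : ZMod 2} (hc : IsHomogField γ c)
    (ha : IsHomogField α a) {r₀ r₁ t₀ t₁ : ℂ}
    (hA : HasBracket c a (r₀ • idField) (r₁ • idField) 0 0)
    (hB : HasBracket c b (t₀ • idField) (t₁ • idField) 0 0) :
    HasBracket c (normalProd a b) (r₀ • b + (sgn (γ * α) * t₀) • a)
      (r₁ • b + (sgn (γ * α) * t₁) • a) 0 0 := by
  have hid : ∀ r : ℂ, HasBracket (r • idField) b 0 0 0 0 := fun r => by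
    simpa only [smul_zero] using (idField_left b).smul_left r
  have h := wick hc ha hA hB (hid r₀) (hid r₁) zero_left zero_left
  simpa only [normalProd_smul_left, normalProd_smul_right, normalProd_idField_left,
    normalProd_idField_right, normalProd_zero_left, normalProd_zero_right, smul_zero, add_zero,
    smul_smul] using h

end HasBracket

/-! ### Locality and `n`-th products from the commutator formula -/

/-- An alternating binomial sum is an iterated forward difference. -/
theorem alternating_sum_eq_fwdDiff {V : Type*} [AddCommGroup V] [Module ℂ V] (g : ℤ → V) (n : ℕ)
    (y : ℤ) : ∑ j ∈ Finset.range (n + 1), ((-1) ^ j * (n.choose j : ℂ)) • g (y + n - j) =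
      (fwdDiff 1)^[n] g y := by
  rw [fwdDiff_iter_eq_sum_shift, ← Finset.sum_flip]
  refine Finset.sum_congr rfl fun j hj => ?_
  have hj : j ≤ n := Nat.lt_succ_iff.1 (Finset.mem_range.1 hj)
  rw [Nat.choose_symm hj, ← Int.cast_smul_eq_zsmul ℂ]
  push_cast [Nat.cast_sub hj]
  congr 2
  simp; ring

/-- The fourth and higher forward differences of a cubic function vanish. -/
theorem fwdDiff_cubic_eq_zero {V : Type*} [AddCommGroup V] [Module ℂ V] (v₀ v₁ v₂ v₃ : V) (n : ℕ) :
    (fwdDiff 1)^[n + 4] (fun t : ℤ => v₀ + (t : ℂ) • v₁ + ((t : ℂ) * (t - 1) / 2) • v₂ +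
      ((t : ℂ) * (t - 1) * (t - 2) / 6) • v₃) = 0 := by
  rw [Function.iterate_add_apply]
  have : (fwdDiff 1)^[4] (fun t : ℤ => v₀ + (t : ℂ) • v₁ + ((t : ℂ) * (t - 1) / 2) • v₂ +
      ((t : ℂ) * (t - 1) * (t - 2) / 6) • v₃) = 0 := by
    funext t
    simp only [Function.iterate_succ, Function.iterate_zero, Function.comp_apply, id_eq, fwdDiff,
      Pi.zero_apply]
    push_cast
    module
  rw [this]
  exact Function.iterate_fixed (by funext t; simp [fwdDiff]) n

namespace HasBracket

variable {a b A₀ A₁ A₂ A₃ : VertexOperator ℂ M}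

theorem isLocal (h : HasBracket a b A₀ A₁ A₂ A₃) : IsLocal a b := by
  refine ⟨4, fun m n => ?_⟩
  have key := congrFun (fwdDiff_cubic_eq_zero (A₀.ncoeff (m + n + 4)) (A₁.ncoeff (m + n + 4 - 1))
    (A₂.ncoeff (m + n + 4 - 2)) (A₃.ncoeff (m + n + 4 - 3)) 0) m
  rw [← alternating_sum_eq_fwdDiff] at key
  rw [← key.trans (Pi.zero_apply m)]
  refine Finset.sum_congr rfl fun j _ => ?_
  have e : m + ((4 : ℕ) : ℤ) - j + (n + j) = m + n + 4 := by push_cast; ring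
  rw [h, e]

theorem ncoeff_nonnegProd (h : HasBracket a b A₀ A₁ A₂ A₃) (n : ℕ) (p : ℤ) :
    (nonnegProd a b n).ncoeff p = (fwdDiff 1)^[n] (fun t : ℤ => A₀.ncoeff (n + p) +
      (t : ℂ) • A₁.ncoeff (n + p - 1) + ((t : ℂ) * (t - 1) / 2) • A₂.ncoeff (n + p - 2) +
      ((t : ℂ) * (t - 1) * (t - 2) / 6) • A₃.ncoeff (n + p - 3)) 0 := by
  rw [nonnegProd, ncoeff_ofModes, ← alternating_sum_eq_fwdDiff]
  refine Finset.sum_congr rfl fun j _ => ?_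
  have e : (n : ℤ) - j + (p + j) = n + p := by ring
  rw [h, e, zero_add]

theorem lambdaBracket_eq (h : HasBracket a b A₀ A₁ A₂ A₃) :
    lambdaBracket a b = atPower 0 A₀ + atPower 1 A₁ + atPower 2 ((1 / 2 : ℂ) • A₂) +
      atPower 3 ((1 / 6 : ℂ) • A₃) := by
  funext n
  refine field_ext fun p => ?_
  have e : lambdaBracket a b n = ((n ! : ℂ)⁻¹) • nonnegProd a b n := rfl
  rw [e, ncoeff_smul, h.ncoeff_nonnegProd]
  match n with
  | 0 => simp [atPower]
  | 1 =>
    have e0 : 1 + p - 1 = p := by ring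
    simp [atPower, fwdDiff, e0]
  | 2 =>
    have e0 : 2 + p - 2 = p := by ring
    simp only [Function.iterate_succ, Function.iterate_zero, Function.comp_apply, id_eq, fwdDiff,
      atPower, Pi.add_apply, Nat.cast_ofNat, e0]
    simp [Nat.factorial, ncoeff_smul]
    module
  | 3 =>
    have e0 : 3 + p - 3 = p := by ring
    simp only [Function.iterate_succ, Function.iterate_zero, Function.comp_apply, id_eq, fwdDiff,
      atPower, Pi.add_apply, Nat.cast_ofNat, e0]
    simp [Nat.factorial, ncoeff_smul]
    module
  | n + 4 =>
    rw [fwdDiff_cubic_eq_zero, Pi.zero_apply, smul_zero]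
    simp [atPower, map_zero]

end HasBracket

end Bracket

/-! ### The generating fields of the vacuum module -/

namespace AffineData

open SuperSpace

variable {W : Type*} [AddCommGroup W] [Module ℂ W] [SuperSpace W] (D : AffineData W)

theorem act_mk (u v : D.Env) :
    D.act u (Submodule.Quotient.mk v) = Submodule.Quotient.mk (u * v) := rfl

theorem act_mul (u v : D.Env) : D.act (u * v) = D.act u * D.act v := by
  refine LinearMap.ext fun w => ?_
  obtain ⟨w, rfl⟩ := Submodule.Quotient.mk_surjective _ w
  simp only [Module.End.mul_apply, act_mk, mul_assoc]

theorem act_add (u v : D.Env) : D.act (u + v) = D.act u + D.act v := by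
  refine LinearMap.ext fun w => ?_
  obtain ⟨w, rfl⟩ := Submodule.Quotient.mk_surjective _ w
  simp only [LinearMap.add_apply, act_mk, add_mul, Submodule.Quotient.mk_add]

theorem act_smul (c : ℂ) (u : D.Env) : D.act (c • u) = c • D.act u := by
  refine LinearMap.ext fun w => ?_
  obtain ⟨w, rfl⟩ := Submodule.Quotient.mk_surjective _ w
  simp only [LinearMap.smul_apply, act_mk, smul_mul_assoc, Submodule.Quotient.mk_smul]

theorem act_algebraMap (c : ℂ) : D.act (algebraMap ℂ D.Env c) = c • 1 := by
  refine LinearMap.ext fun w => ?_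
  obtain ⟨w, rfl⟩ := Submodule.Quotient.mk_surjective _ w
  rw [act_mk, ← Algebra.smul_def]
  rfl

theorem parity_mul_act (u : D.Env) :
    parity * D.act u = D.act (D.parityEnv u) * (parity : Module.End ℂ D.Vacuum) := by
  refine LinearMap.ext fun w => ?_
  obtain ⟨w, rfl⟩ := Submodule.Quotient.mk_surjective _ w
  change Submodule.Quotient.mk (D.parityEnv (u * w)) =
    Submodule.Quotient.mk (D.parityEnv u * D.parityEnv w)
  rw [map_mul]

theorem isHomogEnd_act_gen {α : ZMod 2} {a : W} (ha : a ∈ homog W α) (n : ℤ) :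
    IsHomogEnd α (D.act (D.gen a n)) := by
  rw [IsHomogEnd, parity_mul_act, parityEnv_gen, mem_homog.1 ha, gen_smul, act_smul,
    smul_mul_assoc]

theorem superComm_act_gen (a b : W) (m n : ℤ) : superComm (D.act (D.gen a m)) (D.act (D.gen b n)) =
    D.act (D.gen (D.br a b) (m + n)) + D.central a b m n • 1 := by
  have key : ∀ {α β : ZMod 2} {a b : W}, a ∈ homog W α → b ∈ homog W β →
      superComm (D.act (D.gen a m)) (D.act (D.gen b n)) =
        D.act (D.gen (D.br a b) (m + n)) + D.central a b m n • 1 := by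
    intro α β a b ha hb
    rw [superComm, (D.isHomogEnd_act_gen ha m).swapMul_eq (D.isHomogEnd_act_gen hb n), ← act_mul,
      D.gen_mul_gen ha hb, act_add, act_add, act_smul, act_mul, act_algebraMap]
    abel
  have hc : ∀ a a' b b' : W, D.central (a + a') (b + b') m n =
      D.central a b m n + D.central a b' m n + D.central a' b m n + D.central a' b' m n := by
    intro a a' b b'
    simp only [central, map_add, LinearMap.add_apply]
    split_ifs <;> ring
  rw [← comp_add_comp a, ← comp_add_comp b, hc]
  simp only [gen_add, act_add, superComm_add_left, superComm_add_right, map_add,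
    LinearMap.add_apply, key (comp_mem 0 a) (comp_mem 0 b), key (comp_mem 0 a) (comp_mem 1 b),
    key (comp_mem 1 a) (comp_mem 0 b), key (comp_mem 1 a) (comp_mem 1 b)]
  module

/-- The field `a(z)` as a linear function of `a`. -/
def fieldₗ : W →ₗ[ℂ] VertexOperator ℂ D.Vacuum where
  toFun := D.field
  map_add' a b := field_ext fun n => by
    simp only [field, ncoeff_add, ncoeff_ofModes, gen_add, act_add]
  map_smul' c a := field_ext fun n => by
    simp only [field, ncoeff_smul, ncoeff_ofModes, gen_smul, act_smul, RingHom.id_apply]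

theorem fieldₗ_apply (a : W) : D.fieldₗ a = D.field a := rfl

theorem isHomogField_field {α : ZMod 2} {a : W} (ha : a ∈ homog W α) :
    IsHomogField α (D.field a) := fun n => by
  rw [field, ncoeff_ofModes]
  exact D.isHomogEnd_act_gen ha n

theorem hasBracket_field (a b : W) : HasBracket (D.field a) (D.field b)
    (D.field (D.br a b) + D.form₀ a b • idField) (D.form₁ a b • idField) 0 0 := by
  intro m n
  simp only [field, ncoeff_add, ncoeff_smul, ncoeff_zero, ncoeff_idField, ncoeff_ofModes,
    superComm_act_gen, smul_zero, add_zero, central]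
  have e : m + n - 1 = -1 ↔ m + n = 0 := by omega
  simp only [e]
  split_ifs <;> module

theorem hasBracket_field_central {a b : W} {r : ℂ} (hb : D.br a b = 0) (hr : D.form₀ a b = r)
    (hf : D.form₁ a b = 0) : HasBracket (D.field a) (D.field b) (r • idField) 0 0 0 := by
  have key := D.hasBracket_field a b
  rwa [hb, hf, hr, ← fieldₗ_apply _ 0, map_zero, zero_add, zero_smul] at key

end AffineData

/-! ### Currents and ghosts -/

namespace Datum

open SuperSpace LieSuperalgebra

variable {𝔤 : Type*} [AddCommGroup 𝔤] [Module ℂ 𝔤] [LieSuperalgebra 𝔤] (Q : Datum 𝔤)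

/-- The current `u(z)` as a linear function of `u`. -/
def currentₗ : 𝔤 →ₗ[ℂ] VertexOperator ℂ Q.State :=
  Q.affineData.fieldₗ ∘ₗ LinearMap.inl ℂ 𝔤 _

theorem currentₗ_apply (u : 𝔤) : Q.currentₗ u = Q.current u := rfl

/-- The neutral ghost `Φ_c(z)` as a linear function of `c`. -/
def neutralₗ : Q.gHalf →ₗ[ℂ] VertexOperator ℂ Q.State :=
  Q.affineData.fieldₗ ∘ₗ LinearMap.inr ℂ 𝔤 _ ∘ₗ LinearMap.inr ℂ _ _

theorem isHomogField_current {α : ZMod 2} {u : 𝔤} (hu : u ∈ homog 𝔤 α) :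
    IsHomogField α (Q.current u) := by
  refine Q.affineData.isHomogField_field ?_
  rw [mem_homog] at hu ⊢
  simp [parity, hu]

theorem isHomogField_ghost {α : ZMod 2} {b : Q.gPlus} (hb : (b : 𝔤) ∈ homog 𝔤 α) :
    IsHomogField (α + 1) (Q.ghost b) := by
  refine Q.affineData.isHomogField_field ?_
  have h : Q.parityPlus b = sgn α • b := Subtype.ext (mem_homog.1 hb)
  rw [mem_homog]
  simp [parity, h, sgn_add, sgn_one]

theorem isHomogField_ghostDual {α : ZMod 2} {ξ : Module.Dual ℂ Q.gPlus}
    (hξ : Q.parityPlus.dualMap ξ = sgn α • ξ) : IsHomogField (α + 1) (Q.ghostDual ξ) := by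
  refine Q.affineData.isHomogField_field ?_
  rw [mem_homog]
  simp [parity, hξ, sgn_add, sgn_one]

theorem isHomogField_neutral {α : ZMod 2} {c : Q.gHalf} (hc : (c : 𝔤) ∈ homog 𝔤 α) :
    IsHomogField α (Q.neutral c) := by
  refine Q.affineData.isHomogField_field ?_
  have h : Q.parityHalf c = sgn α • c := Subtype.ext (mem_homog.1 hc)
  rw [mem_homog]
  simp [parity, h]

theorem affineData_br (v w : Q.GenSpace) :
    Q.affineData.br v w = LinearMap.inl ℂ 𝔤 _ (br (Q.toG v) (Q.toG w)) := rfl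

theorem affineData_form₀ (v w : Q.GenSpace) : Q.affineData.form₀ v w =
    Q.toDual w (Q.toPlus v) + Q.toDual v (Q.parityPlus (Q.toPlus w)) +
      Q.form Q.f (br (Q.toHalf v) (Q.toHalf w)) := rfl

theorem affineData_form₁ (v w : Q.GenSpace) :
    Q.affineData.form₁ v w = Q.k * Q.form (Q.toG v) (Q.toG w) := rfl

theorem hasBracket_current (u v : 𝔤) : HasBracket (Q.current u) (Q.current v)
    (Q.current (br u v)) ((Q.k * Q.form u v) • idField) 0 0 := by
  refine (Q.affineData.hasBracket_field _ _).congr ?_ rfl rfl rfl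
  have h : Q.affineData.form₀ (u, (0, 0), 0) (v, (0, 0), 0) = 0 := by
    rw [affineData_form₀]; simp [toPlus, toDual, toHalf]
  rw [h, zero_smul, add_zero]
  rfl

/-- If one of two generators has no component in `𝔤`, then their bracket is central. -/
theorem hasBracket_ghosts {v w : Q.GenSpace} {r : ℂ} (h : Q.toG v = 0 ∨ Q.toG w = 0)
    (hr : Q.affineData.form₀ v w = r) :
    HasBracket (Q.affineData.field v) (Q.affineData.field w) (r • idField) 0 0 0 := by
  have hb : br (Q.toG v) (Q.toG w) = 0 := by
    rcases h with h | h
    · rw [h, map_zero, LinearMap.zero_apply]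
    · rw [h, map_zero]
  have hf : Q.form (Q.toG v) (Q.toG w) = 0 := by
    rcases h with h | h
    · rw [h, map_zero, LinearMap.zero_apply]
    · rw [h, map_zero]
  refine Q.affineData.hasBracket_field_central ?_ hr ?_
  · rw [affineData_br, hb, map_zero]
  · rw [affineData_form₁, hf, mul_zero]

theorem hasBracket_ghost_ghostDual (b : Q.gPlus) (ξ : Module.Dual ℂ Q.gPlus) :
    HasBracket (Q.ghost b) (Q.ghostDual ξ) (ξ b • idField) 0 0 0 := by
  refine Q.hasBracket_ghosts (Or.inl rfl) ?_
  rw [affineData_form₀]; simp [toPlus, toDual, toHalf]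

theorem hasBracket_ghostDual_ghost (b : Q.gPlus) (ξ : Module.Dual ℂ Q.gPlus) :
    HasBracket (Q.ghostDual ξ) (Q.ghost b) (ξ (Q.parityPlus b) • idField) 0 0 0 := by
  refine Q.hasBracket_ghosts (Or.inl rfl) ?_
  rw [affineData_form₀]; simp [toPlus, toDual, toHalf]

theorem hasBracket_ghost_ghost (b c : Q.gPlus) :
    HasBracket (Q.ghost b) (Q.ghost c) 0 0 0 0 := by
  refine (Q.hasBracket_ghosts (Or.inl rfl) ?_).congr (zero_smul ℂ _) rfl rfl rfl
  rw [affineData_form₀]; simp [toPlus, toDual, toHalf]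

theorem hasBracket_ghostDual_ghostDual (ξ η : Module.Dual ℂ Q.gPlus) :
    HasBracket (Q.ghostDual ξ) (Q.ghostDual η) 0 0 0 0 := by
  refine (Q.hasBracket_ghosts (Or.inl rfl) ?_).congr (zero_smul ℂ _) rfl rfl rfl
  rw [affineData_form₀]; simp [toPlus, toDual, toHalf]

theorem hasBracket_neutral (c d : Q.gHalf) : HasBracket (Q.neutral c) (Q.neutral d)
    (Q.form Q.f (br (c : 𝔤) (d : 𝔤)) • idField) 0 0 0 := by
  refine Q.hasBracket_ghosts (Or.inl rfl) ?_
  rw [affineData_form₀]; simp [toPlus, toDual, toHalf]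

theorem hasBracket_ghost_current (b : Q.gPlus) (u : 𝔤) :
    HasBracket (Q.ghost b) (Q.current u) 0 0 0 0 := by
  refine (Q.hasBracket_ghosts (Or.inl rfl) ?_).congr (zero_smul ℂ _) rfl rfl rfl
  rw [affineData_form₀]; simp [toPlus, toDual, toHalf]

theorem hasBracket_ghostDual_current (ξ : Module.Dual ℂ Q.gPlus) (u : 𝔤) :
    HasBracket (Q.ghostDual ξ) (Q.current u) 0 0 0 0 := by
  refine (Q.hasBracket_ghosts (Or.inl rfl) ?_).congr (zero_smul ℂ _) rfl rfl rfl
  rw [affineData_form₀]; simp [toPlus, toDual, toHalf]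

theorem hasBracket_neutral_current (c : Q.gHalf) (u : 𝔤) :
    HasBracket (Q.neutral c) (Q.current u) 0 0 0 0 := by
  refine (Q.hasBracket_ghosts (Or.inl rfl) ?_).congr (zero_smul ℂ _) rfl rfl rfl
  rw [affineData_form₀]; simp [toPlus, toDual, toHalf]

theorem hasBracket_current_ghost (u : 𝔤) (b : Q.gPlus) :
    HasBracket (Q.current u) (Q.ghost b) 0 0 0 0 := by
  refine (Q.hasBracket_ghosts (Or.inr rfl) ?_).congr (zero_smul ℂ _) rfl rfl rfl
  rw [affineData_form₀]; simp [toPlus, toDual, toHalf]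

theorem hasBracket_current_ghostDual (u : 𝔤) (ξ : Module.Dual ℂ Q.gPlus) :
    HasBracket (Q.current u) (Q.ghostDual ξ) 0 0 0 0 := by
  refine (Q.hasBracket_ghosts (Or.inr rfl) ?_).congr (zero_smul ℂ _) rfl rfl rfl
  rw [affineData_form₀]; simp [toPlus, toDual, toHalf]

theorem hasBracket_current_neutral (u : 𝔤) (c : Q.gHalf) :
    HasBracket (Q.current u) (Q.neutral c) 0 0 0 0 := by
  refine (Q.hasBracket_ghosts (Or.inr rfl) ?_).congr (zero_smul ℂ _) rfl rfl rfl
  rw [affineData_form₀]; simp [toPlus, toDual, toHalf]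

theorem hasBracket_neutral_ghost (c : Q.gHalf) (b : Q.gPlus) :
    HasBracket (Q.neutral c) (Q.ghost b) 0 0 0 0 := by
  refine (Q.hasBracket_ghosts (Or.inl rfl) ?_).congr (zero_smul ℂ _) rfl rfl rfl
  rw [affineData_form₀]; simp [toPlus, toDual, toHalf]

theorem hasBracket_neutral_ghostDual (c : Q.gHalf) (ξ : Module.Dual ℂ Q.gPlus) :
    HasBracket (Q.neutral c) (Q.ghostDual ξ) 0 0 0 0 := by
  refine (Q.hasBracket_ghosts (Or.inl rfl) ?_).congr (zero_smul ℂ _) rfl rfl rfl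
  rw [affineData_form₀]; simp [toPlus, toDual, toHalf]

theorem hasBracket_ghost_neutral (b : Q.gPlus) (c : Q.gHalf) :
    HasBracket (Q.ghost b) (Q.neutral c) 0 0 0 0 := by
  refine (Q.hasBracket_ghosts (Or.inl rfl) ?_).congr (zero_smul ℂ _) rfl rfl rfl
  rw [affineData_form₀]; simp [toPlus, toDual, toHalf]

theorem hasBracket_ghostDual_neutral (ξ : Module.Dual ℂ Q.gPlus) (c : Q.gHalf) :
    HasBracket (Q.ghostDual ξ) (Q.neutral c) 0 0 0 0 := by
  refine (Q.hasBracket_ghosts (Or.inl rfl) ?_).congr (zero_smul ℂ _) rfl rfl rfl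
  rw [affineData_form₀]; simp [toPlus, toDual, toHalf]

end Datum

/-! ### Brackets of an energy-momentum field with quadratic fields -/

section Quadratic

open SuperSpace

variable {M : Type*} [AddCommGroup M] [Module ℂ M] [SuperSpace M]

namespace HasBracket

variable {L a b E : VertexOperator ℂ M} {α : ZMod 2} {Δ Δ' r : ℂ}

theorem neg_right {A₀ A₁ A₂ A₃ : VertexOperator ℂ M} (h : HasBracket a b A₀ A₁ A₂ A₃) :
    HasBracket a (-b) (-A₀) (-A₁) (-A₂) (-A₃) := by
  intro m n
  have := h.smul_right (-1) m n
  simp only [ncoeff_neg, ncoeff_smul, neg_one_smul] at this ⊢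
  exact this

theorem deriv_right_zero (h : HasBracket a b 0 0 0 0) : HasBracket a (fieldDeriv b) 0 0 0 0 := by
  simpa only [fieldDeriv_zero, smul_zero, add_zero] using h.deriv_right

theorem deriv_right_const (h : HasBracket a b (r • idField) 0 0 0) :
    HasBracket a (fieldDeriv b) 0 (r • idField) 0 0 := by
  simpa only [fieldDeriv_zero, fieldDeriv_smul, fieldDeriv_idField, smul_zero, add_zero,
    zero_add] using h.deriv_right

theorem deriv_left_const (h : HasBracket a b (r • idField) 0 0 0) :
    HasBracket (fieldDeriv a) b 0 ((-r) • idField) 0 0 := by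
  refine h.deriv_left.congr rfl ?_ (smul_zero _) (smul_zero _)
  module

theorem skew_zero (h : HasBracket a b 0 0 0 0) (hb : IsHomogField 0 b) :
    HasBracket b a 0 0 0 0 := by
  simpa only [fieldDeriv_zero, sub_zero] using h.skew hb

theorem sum_right_zero {ι : Type*} (s : Finset ι) {b : ι → VertexOperator ℂ M}
    (h : ∀ i ∈ s, HasBracket a (b i) 0 0 0 0) : HasBracket a (∑ i ∈ s, b i) 0 0 0 0 := by
  simpa only [Finset.sum_const_zero] using sum_right s h

theorem smul_right_zero (c : ℂ) (h : HasBracket a b 0 0 0 0) :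
    HasBracket a (c • b) 0 0 0 0 := by
  simpa only [smul_zero] using h.smul_right c

theorem add_right_zero {b' : VertexOperator ℂ M} (h : HasBracket a b 0 0 0 0)
    (h' : HasBracket a b' 0 0 0 0) : HasBracket a (b + b') 0 0 0 0 := by
  simpa only [add_zero] using h.add_right h'

/-- The Wick formula for fields with brackets of degree one in `λ`, with central coefficients of
`λ`. -/
theorem wick_affine {c A₀ B₀ : VertexOperator ℂ M} {γ : ZMod 2} (hc : IsHomogField γ c)
    (ha : IsHomogField α a) {r s t : ℂ} (hA : HasBracket c a A₀ (r • idField) 0 0)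
    (hB : HasBracket c b B₀ (s • idField) 0 0) (h₀ : HasBracket A₀ b E (t • idField) 0 0) :
    HasBracket c (normalProd a b) (normalProd A₀ b + sgn (γ * α) • normalProd a B₀)
      (r • b + (sgn (γ * α) * s) • a + E) (t • idField) 0 := by
  have hid : HasBracket (r • idField) b 0 0 0 0 := by
    simpa only [smul_zero] using (idField_left b).smul_left r
  have h := wick hc ha hA hB h₀ hid zero_left zero_left
  simpa only [normalProd_smul_left, normalProd_smul_right, normalProd_idField_left,
    normalProd_idField_right, normalProd_zero_left, normalProd_zero_right, smul_zero, add_zero,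
    zero_add, smul_smul] using h

/-- The bracket of an even field `L` with `:ab:` when `a` and `b` are primary of conformal weights
`Δ` and `Δ'` and `[a_λ b] = E + λ r`. -/
theorem normalProd_primary (hL : IsHomogField 0 L) (ha : IsHomogField α a)
    (h₁ : HasBracket L a (fieldDeriv a) (Δ • a) 0 0)
    (h₂ : HasBracket L b (fieldDeriv b) (Δ' • b) 0 0)
    (h : HasBracket a b E (r • idField) 0 0) :
    HasBracket L (normalProd a b) (fieldDeriv (normalProd a b)) ((Δ + Δ') • normalProd a b)
      ((2 * Δ - 1) • E) (((3 * Δ - 2) * r) • idField) := by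
  have h' : HasBracket (Δ • a) b (Δ • E) (Δ • r • idField) 0 0 := by
    simpa only [smul_zero] using h.smul_left Δ
  have hd : HasBracket (fieldDeriv a) b 0 (-E) ((-2 : ℂ) • r • idField) 0 := by
    simpa only [smul_zero] using h.deriv_left
  refine (wick hL ha h₁ h₂ hd h' zero_left zero_left).congr ?_ ?_ ?_ ?_
  all_goals
    simp only [fieldDeriv_normalProd, normalProd_smul_left, normalProd_smul_right,
      normalProd_zero_left, normalProd_zero_right, zero_mul, sgn_zero]
    module

/-- The bracket of an even field `L` with `:(∂a)b:` when `a` and `b` are primary of conformal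
weights `Δ` and `Δ'` and `[a_λ b] = r`. -/
theorem normalProd_deriv_left_primary (hL : IsHomogField 0 L) (ha : IsHomogField α a)
    (h₁ : HasBracket L a (fieldDeriv a) (Δ • a) 0 0)
    (h₂ : HasBracket L b (fieldDeriv b) (Δ' • b) 0 0)
    (h : HasBracket a b (r • idField) 0 0 0) :
    HasBracket L (normalProd (fieldDeriv a) b) (fieldDeriv (normalProd (fieldDeriv a) b))
      ((1 + Δ + Δ') • normalProd (fieldDeriv a) b) ((2 * Δ) • normalProd a b)
      (((3 * Δ - 1) * r) • idField) := by
  have h1 := h₁.deriv_right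
  have hd := h.deriv_left_const
  have hdd : HasBracket (fieldDeriv (fieldDeriv a)) b 0 0 ((-2 : ℂ) • (-r) • idField) 0 := by
    simpa only [neg_zero, smul_zero] using hd.deriv_left
  have e₁ : HasBracket (fieldDeriv (Δ • a) + fieldDeriv a) b 0 (((Δ + 1) * -r) • idField) 0 0 := by
    rw [fieldDeriv_smul]
    refine ((hd.smul_left Δ).add_left hd).congr ?_ ?_ ?_ ?_ <;> module
  have e₂ : HasBracket (fieldDeriv (0 : VertexOperator ℂ M) + (2 : ℂ) • Δ • a) b
      ((2 * Δ * r) • idField) 0 0 0 := by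
    rw [fieldDeriv_zero, zero_add]
    refine ((h.smul_left Δ).smul_left 2).congr ?_ ?_ ?_ ?_ <;> module
  have e₃ : HasBracket ((3 : ℂ) • (0 : VertexOperator ℂ M)) b 0 0 0 0 := by
    rw [smul_zero]; exact zero_left
  refine (wick hL ha.deriv h1 h₂ hdd e₁ e₂ e₃).congr ?_ ?_ ?_ ?_
  all_goals
    simp only [fieldDeriv_normalProd, fieldDeriv_smul, fieldDeriv_zero, normalProd_add_left,
      normalProd_smul_left, normalProd_smul_right, normalProd_zero_left, normalProd_zero_right,
      zero_mul, sgn_zero]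
    module

/-- The bracket of an even field `L` with `:a∂b:` when `a` and `b` are primary of conformal weights
`Δ` and `Δ'` and `[a_λ b] = r`. -/
theorem normalProd_deriv_right_primary (hL : IsHomogField 0 L) (ha : IsHomogField α a)
    (h₁ : HasBracket L a (fieldDeriv a) (Δ • a) 0 0)
    (h₂ : HasBracket L b (fieldDeriv b) (Δ' • b) 0 0)
    (h : HasBracket a b (r • idField) 0 0 0) :
    HasBracket L (normalProd a (fieldDeriv b)) (fieldDeriv (normalProd a (fieldDeriv b)))
      ((1 + Δ + Δ') • normalProd a (fieldDeriv b)) ((2 * Δ') • normalProd a b)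
      (((3 * Δ - 2) * r) • idField) := by
  have h2 := h₂.deriv_right
  have hd := h.deriv_right_const
  have hdd : HasBracket (fieldDeriv a) (fieldDeriv b) 0 0 ((-2 : ℂ) • r • idField) 0 := by
    simpa only [neg_zero, smul_zero] using hd.deriv_left
  have e₁ : HasBracket (Δ • a) (fieldDeriv b) 0 (Δ • r • idField) 0 0 := by
    simpa only [smul_zero] using hd.smul_left Δ
  refine (wick hL ha h₁ h2 hdd e₁ zero_left zero_left).congr ?_ ?_ ?_ ?_
  all_goals
    simp only [fieldDeriv_normalProd, fieldDeriv_smul, fieldDeriv_zero, normalProd_add_right,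
      normalProd_smul_left, normalProd_smul_right, normalProd_zero_left, normalProd_zero_right,
      zero_mul, sgn_zero]
    module

end HasBracket

end Quadratic

/-! ### The canonical tensor and the Casimir operator -/

namespace Datum

open SuperSpace LieSuperalgebra

variable {𝔤 : Type*} [AddCommGroup 𝔤] [Module ℂ 𝔤] [LieSuperalgebra 𝔤] (Q : Datum 𝔤)

/-- Supersymmetry of the form for elements that need not be homogeneous. -/
theorem form_swap (a b : 𝔤) : Q.form a b = Q.form b (parity a) := by
  have key : ∀ {α β : ZMod 2} {a b : 𝔤}, a ∈ homog 𝔤 α → b ∈ homog 𝔤 β →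
      Q.form a b = Q.form b (parity a) := by
    intro α β a b ha hb
    rw [QuantumReduction.mem_homog.1 ha, map_smul]
    by_cases h : α = β
    · subst h
      rw [Q.form_symm ha hb, zmod_two_mul_self]
    · rw [Q.form_even ha hb h, Q.form_even hb ha (Ne.symm h), smul_zero]
  rw [← comp_add_comp a, ← comp_add_comp b]
  simp only [map_add, LinearMap.add_apply]
  rw [key (comp_mem 0 a) (comp_mem 0 b), key (comp_mem 0 a) (comp_mem 1 b),
    key (comp_mem 1 a) (comp_mem 0 b), key (comp_mem 1 a) (comp_mem 1 b)]
  ring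

theorem form_parity_right (a b : 𝔤) : Q.form a (parity b) = Q.form (parity a) b := by
  rw [← Q.form_parity, parity_parity]

theorem eq_zero_of_form_right {a : 𝔤} (h : ∀ b, Q.form b a = 0) : a = 0 :=
  Q.form_nondegenerate a fun b => by rw [form_swap, form_parity_right, h]

namespace DualPair

variable {Q} {J : Type*} [Fintype J] [DecidableEq J] (P : Q.DualPair J)

theorem sum_form_smul_a (v : 𝔤) : ∑ i, Q.form v (P.a' i) • P.a i = v := by
  have h : ∀ i, Q.form v (P.a' i) = P.a.repr v i := fun i => by
    have := congrArg (fun w => Q.form w (P.a' i)) (P.a.sum_repr v)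
    simp only [map_sum, LinearMap.sum_apply, map_smul, LinearMap.smul_apply, P.form_eq,
      smul_eq_mul, mul_ite, mul_one, mul_zero, Finset.sum_ite_eq', Finset.mem_univ, if_true] at this
    exact this.symm
  simp only [h, P.a.sum_repr]

theorem sum_form_smul_a' (v : 𝔤) : ∑ i, Q.form (P.a i) v • P.a' i = v := by
  rw [← sub_eq_zero]
  refine Q.eq_zero_of_form_right fun b => ?_
  have h : ∀ j, Q.form (P.a j) (∑ i, Q.form (P.a i) v • P.a' i - v) = 0 := fun j => by
    simp [P.form_eq]
  rw [← P.a.sum_repr b, map_sum, LinearMap.sum_apply]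
  exact Finset.sum_eq_zero fun j _ => by rw [map_smul, LinearMap.smul_apply, h, smul_zero]

theorem a'_mem_homog (i : J) : P.a' i ∈ homog 𝔤 (P.p i) := by
  rw [QuantumReduction.mem_homog]
  conv_lhs => rw [← P.sum_form_smul_a' (parity (P.a' i))]
  simp [form_parity_right, QuantumReduction.mem_homog.1 (P.mem_homog _), P.form_eq]

/-- The two expressions `∑ (-1)^{p(aᵢ)} aᵢ ⊗ aⁱ` and `∑ aⁱ ⊗ aᵢ` of the canonical tensor agree. -/
theorem sum_flip {V : Type*} [AddCommGroup V] [Module ℂ V] (B : 𝔤 →ₗ[ℂ] 𝔤 →ₗ[ℂ] V) :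
    ∑ i, sgn (P.p i) • B (P.a i) (P.a' i) = ∑ i, B (P.a' i) (P.a i) := by
  have h1 : ∀ i, sgn (P.p i) • B (P.a i) (P.a' i) =
      ∑ j, (sgn (P.p i) * Q.form (P.a' i) (P.a' j)) • B (P.a i) (P.a j) := fun i => by
    conv_lhs => rw [← P.sum_form_smul_a (P.a' i)]
    simp only [map_sum, map_smul, Finset.smul_sum, smul_smul]
  have h2 : ∀ i, B (P.a' i) (P.a i) =
      ∑ j, Q.form (P.a' i) (P.a' j) • B (P.a j) (P.a i) := fun i => by
    conv_lhs => rw [← P.sum_form_smul_a (P.a' i)]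
    simp only [map_sum, map_smul, LinearMap.sum_apply, LinearMap.smul_apply]
  simp only [h1, h2]
  conv_rhs => rw [Finset.sum_comm]
  refine Finset.sum_congr rfl fun i _ => Finset.sum_congr rfl fun j _ => ?_
  rw [Q.form_swap (P.a' j), form_parity_right,
    QuantumReduction.mem_homog.1 (P.a'_mem_homog i), map_smul, LinearMap.smul_apply, smul_eq_mul]

/-- The canonical tensor `∑ aⁱ ⊗ aᵢ` is invariant under `𝔤`. -/
theorem sum_invariant {V : Type*} [AddCommGroup V] [Module ℂ V] (B : 𝔤 →ₗ[ℂ] 𝔤 →ₗ[ℂ] V)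
    {γ : ZMod 2} {w : 𝔤} (hw : w ∈ homog 𝔤 γ) :
    ∑ i, (B (br w (P.a' i)) (P.a i) + sgn (γ * P.p i) • B (P.a' i) (br w (P.a i))) = 0 := by
  have h1 : ∀ i, B (br w (P.a' i)) (P.a i) =
      ∑ j, Q.form (P.a j) (br w (P.a' i)) • B (P.a' j) (P.a i) := fun i => by
    conv_lhs => rw [← P.sum_form_smul_a' (br w (P.a' i))]
    simp only [map_sum, map_smul, LinearMap.sum_apply, LinearMap.smul_apply]
  have h2 : ∀ i, sgn (γ * P.p i) • B (P.a' i) (br w (P.a i)) =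
      ∑ j, -(Q.form (P.a i) (br w (P.a' j)) • B (P.a' i) (P.a j)) := fun i => by
    conv_lhs => rw [← P.sum_form_smul_a (br w (P.a i))]
    simp only [map_sum, map_smul, Finset.smul_sum, smul_smul]
    refine Finset.sum_congr rfl fun j _ => ?_
    rw [br_skew hw (P.mem_homog i), map_neg, map_smul, LinearMap.neg_apply, LinearMap.smul_apply,
      Q.form_invariant, smul_eq_mul, mul_neg, ← mul_assoc, sgn_mul_self, one_mul, neg_smul]
  rw [Finset.sum_add_distrib]
  simp only [h1, h2, Finset.sum_neg_distrib]
  rw [Finset.sum_comm, add_neg_cancel]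

theorem sum_br_eq_zero : ∑ i, br (P.a' i) (P.a i) = 0 := by
  have h := P.sum_flip (br : 𝔤 →ₗ[ℂ] 𝔤 →ₗ[ℂ] 𝔤)
  have h1 : ∀ i, sgn (P.p i) • br (P.a i) (P.a' i) = -br (P.a' i) (P.a i) := fun i => by
    rw [br_skew (P.mem_homog i) (P.a'_mem_homog i), zmod_two_mul_self, smul_neg, smul_smul,
      sgn_mul_self, one_smul]
  simp only [h1, Finset.sum_neg_distrib] at h
  have h2 : (2 : ℂ) • ∑ i, br (P.a' i) (P.a i) = 0 := by
    rw [two_smul]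
    nth_rewrite 1 [← h]
    exact neg_add_cancel _
  exact (smul_eq_zero.1 h2).resolve_left two_ne_zero

theorem casimirAd_apply (v : 𝔤) :
    casimirAd P.a P.a' P.p v = ∑ i, br (P.a' i) (br (P.a i) v) := by
  have h := P.sum_flip
    (LinearMap.mk₂ ℂ (fun a b : 𝔤 => br a (br b v)) (by intros; simp) (by intros; simp)
      (by intros; simp) (by intros; simp))
  simp only [LinearMap.mk₂_apply] at h
  rw [← h]
  simp [casimirAd]

theorem br_casimirAd (w v : 𝔤) :
    br w (casimirAd P.a P.a' P.p v) = casimirAd P.a P.a' P.p (br w v) := by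
  have key : ∀ {γ : ZMod 2} {w : 𝔤}, w ∈ homog 𝔤 γ →
      br w (casimirAd P.a P.a' P.p v) = casimirAd P.a P.a' P.p (br w v) := by
    intro γ w hw
    have h := P.sum_invariant
      (LinearMap.mk₂ ℂ (fun a b : 𝔤 => br a (br b v)) (by intros; simp) (by intros; simp)
        (by intros; simp) (by intros; simp)) hw
    simp only [LinearMap.mk₂_apply] at h
    rw [casimirAd_apply, casimirAd_apply, map_sum, ← sub_eq_zero, ← Finset.sum_sub_distrib, ← h]
    refine Finset.sum_congr rfl fun i _ => ?_
    rw [br_jacobi hw (P.a'_mem_homog i), br_jacobi hw (P.mem_homog i), map_add, map_smul, smul_add,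
      smul_smul, sgn_mul_self, one_smul]
    abel
  rw [← comp_add_comp w]
  simp only [map_add, LinearMap.add_apply]
  rw [key (comp_mem 0 w), key (comp_mem 1 w)]

theorem parity_casimirAd (v : 𝔤) :
    parity (casimirAd P.a P.a' P.p v) = casimirAd P.a P.a' P.p (parity v) := by
  rw [casimirAd_apply, casimirAd_apply, map_sum]
  refine Finset.sum_congr rfl fun i _ => ?_
  rw [parity_br, parity_br, QuantumReduction.mem_homog.1 (P.mem_homog i),
    QuantumReduction.mem_homog.1 (P.a'_mem_homog i)]
  simp only [map_smul, LinearMap.smul_apply, smul_smul, sgn_mul_self, one_smul]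

/-- If `𝔤` is simple, the Casimir operator is a scalar, because its eigenspaces are graded
ideals. -/
theorem casimirAd_eq (h𝔤 : IsSimple 𝔤) {h : ℂ} (hh : Q.IsDualCoxeterNumber P h) (v : 𝔤) :
    casimirAd P.a P.a' P.p v = (2 * h) • v := by
  have hI := h𝔤.2 (Module.End.eigenspace (casimirAd P.a P.a' P.p) (2 * h))
    (fun a ha => by
      rw [Module.End.mem_eigenspace_iff] at ha ⊢
      rw [← parity_casimirAd, ha, map_smul])
    (fun a b hb => by
      rw [Module.End.mem_eigenspace_iff] at hb ⊢
      rw [← br_casimirAd, hb, map_smul])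
  have htop := hI.resolve_left hh
  exact Module.End.mem_eigenspace_iff.1 (htop ▸ Submodule.mem_top)

end DualPair

/-! ### The Sugawara construction -/

section Sugawara

variable {Q} {J : Type*} [Fintype J] [DecidableEq J] (P : Q.DualPair J)
  {M : Type*} [AddCommGroup M] [Module ℂ M] [SuperSpace M]

/-- A representation of the currents of level `k` by fields on a superspace. -/
structure IsCurrentMap (Q : Datum 𝔤) (F : 𝔤 →ₗ[ℂ] VertexOperator ℂ M) : Prop where
  isHomogField : ∀ {α : ZMod 2} {u : 𝔤}, u ∈ homog 𝔤 α → IsHomogField α (F u)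
  bracket : ∀ u v, HasBracket (F u) (F v) (F (br u v)) ((Q.k * Q.form u v) • idField) 0 0

namespace IsCurrentMap

variable {F : 𝔤 →ₗ[ℂ] VertexOperator ℂ M} (hF : Q.IsCurrentMap F)

/-- The field `∑ᵢ :F(aⁱ)F(aᵢ):`, a multiple of the Sugawara field. -/
def quadratic (F : 𝔤 →ₗ[ℂ] VertexOperator ℂ M) : VertexOperator ℂ M :=
  ∑ i, normalProd (F (P.a' i)) (F (P.a i))

include hF in
theorem isHomogField_quadratic : IsHomogField 0 (quadratic P F) := by
  refine IsHomogField.sum _ fun i _ => ?_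
  rw [← zmod_two_add_self (P.p i)]
  exact (hF.isHomogField (P.a'_mem_homog i)).normalProd (hF.isHomogField (P.mem_homog i))

include hF in
theorem hasBracket_quadratic_of_commute {c : VertexOperator ℂ M} {γ : ZMod 2}
    (hc : IsHomogField γ c) (hz : ∀ u, HasBracket c (F u) 0 0 0 0) :
    HasBracket c (quadratic P F) 0 0 0 0 :=
  HasBracket.sum_right_zero _ fun i _ => HasBracket.wick_zero hc
    (hF.isHomogField (P.a'_mem_homog i)) (hz _) (hz _)

include hF in
theorem hasBracket_quadratic_summand {γ : ZMod 2} {w : 𝔤} (hw : w ∈ homog 𝔤 γ) (i : J) :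
    HasBracket (F w) (normalProd (F (P.a' i)) (F (P.a i)))
      (normalProd (F (br w (P.a' i))) (F (P.a i)) +
        sgn (γ * P.p i) • normalProd (F (P.a' i)) (F (br w (P.a i))))
      (F (Q.k • Q.form w (P.a' i) • P.a i + Q.k • Q.form (P.a i) w • P.a' i +
        sgn (P.p i) • br (P.a i) (br (P.a' i) w)))
      ((Q.k * Q.form w (br (P.a' i) (P.a i))) • idField) 0 := by
  have h := HasBracket.wick_affine (hF.isHomogField hw) (hF.isHomogField (P.a'_mem_homog i))
    (hF.bracket w (P.a' i)) (hF.bracket w (P.a i)) (hF.bracket (br w (P.a' i)) (P.a i))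
  have e : br (br w (P.a' i)) (P.a i) = sgn (P.p i) • br (P.a i) (br (P.a' i) w) := by
    rw [br_skew (br_mem hw (P.a'_mem_homog i)) (P.mem_homog i), br_skew hw (P.a'_mem_homog i),
      add_mul, sgn_add, zmod_two_mul_self, map_neg, map_smul, smul_neg, neg_neg, smul_smul,
      mul_right_comm, sgn_mul_self, one_mul]
  have e' : sgn (γ * P.p i) * (Q.k * Q.form w (P.a i)) = Q.k * Q.form (P.a i) w := by
    rw [Q.form_symm hw (P.mem_homog i), smul_eq_mul]
    linear_combination Q.k * Q.form (P.a i) w * sgn_mul_self (γ * P.p i)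
  refine h.congr rfl ?_ ?_ rfl
  · rw [e, e']
    simp only [map_add, map_smul, smul_smul]
  · rw [Q.form_invariant]

include hF in
/-- `[u_λ ∑ᵢ :aⁱaᵢ:] = 2(k + h^∨) λ u`: the invariance of the canonical tensor makes the constant
term vanish, and the coefficient of `λ` collects `2k` from the form and `2h^∨` from the Casimir
operator. -/
theorem hasBracket_quadratic {h : ℂ} (h𝔤 : IsSimple 𝔤) (hh : Q.IsDualCoxeterNumber P h) (u : 𝔤) :
    HasBracket (F u) (quadratic P F) 0 ((2 * (Q.k + h)) • F u) 0 0 := by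
  have key : ∀ {γ : ZMod 2} {w : 𝔤}, w ∈ homog 𝔤 γ →
      HasBracket (F w) (quadratic P F) 0 ((2 * (Q.k + h)) • F w) 0 0 := by
    intro γ w hw
    refine (HasBracket.sum_right Finset.univ fun i _ =>
      hF.hasBracket_quadratic_summand P hw i).congr ?_ ?_ ?_ ?_
    · exact P.sum_invariant (normalProdₗ.compl₁₂ F F) hw
    · have e : ∑ i, sgn (P.p i) • br (P.a i) (br (P.a' i) w) = (2 * h) • w := by
        rw [← P.casimirAd_eq h𝔤 hh w]
        simp [casimirAd]
      rw [← map_sum, Finset.sum_add_distrib, Finset.sum_add_distrib, ← Finset.smul_sum,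
        ← Finset.smul_sum, P.sum_form_smul_a, P.sum_form_smul_a', e, ← add_smul, ← add_smul,
        map_smul]
      congr 1
      ring
    · rw [← Finset.sum_smul, ← Finset.mul_sum, ← map_sum, P.sum_br_eq_zero, map_zero, mul_zero,
        zero_smul]
    · exact Finset.sum_const_zero
  have hadd := (key (comp_mem 0 u)).add_left (key (comp_mem 1 u))
  simpa only [← smul_add, ← map_add, comp_add_comp, add_zero] using hadd

include hF in
/-- If the currents are primary of conformal weight one for an even field `L`, then the quadratic
field has the bracket of an energy-momentum field with `L`, up to the coefficient of `λ³`. -/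
theorem hasBracket_primary_quadratic {L : VertexOperator ℂ M} (hL : IsHomogField 0 L)
    (hu : ∀ u, HasBracket L (F u) (fieldDeriv (F u)) (F u) 0 0) :
    HasBracket L (quadratic P F) (fieldDeriv (quadratic P F)) ((2 : ℂ) • quadratic P F) 0
      ((Q.k * ∑ i, sgn (P.p i)) • idField) := by
  have hu' : ∀ u, HasBracket L (F u) (fieldDeriv (F u)) ((1 : ℂ) • F u) 0 0 := fun u => by
    rw [one_smul]; exact hu u
  refine (HasBracket.sum_right Finset.univ fun i _ =>
    HasBracket.normalProd_primary hL (hF.isHomogField (P.a'_mem_homog i)) (hu' _) (hu' _)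
      (hF.bracket (P.a' i) (P.a i))).congr ?_ ?_ ?_ ?_
  · rw [← fieldDeriv_sum, quadratic]
  · rw [← Finset.smul_sum, quadratic]
    norm_num
  · rw [← Finset.smul_sum, ← map_sum, P.sum_br_eq_zero, map_zero, smul_zero]
  · have e : ∀ i, Q.form (P.a' i) (P.a i) = sgn (P.p i) := fun i => by
      rw [form_swap, form_parity_right, QuantumReduction.mem_homog.1 (P.mem_homog i), map_smul,
        LinearMap.smul_apply, P.form_eq, if_pos rfl, smul_eq_mul, mul_one]
    simp only [e]
    rw [← Finset.sum_smul, ← Finset.mul_sum, ← Finset.mul_sum]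
    congr 1
    ring

include hF in
/-- The Sugawara construction. -/
theorem hasBracket_smul_quadratic {h : ℂ} (h𝔤 : IsSimple 𝔤) (hh : Q.IsDualCoxeterNumber P h)
    (hk : Q.k + h ≠ 0) {L : VertexOperator ℂ M} (hL : IsHomogField 0 L)
    (e : L = (1 / (2 * (Q.k + h))) • quadratic P F) :
    (∀ u, HasBracket L (F u) (fieldDeriv (F u)) (F u) 0 0) ∧
      HasBracket L L (fieldDeriv L) ((2 : ℂ) • L) 0
        ((Q.k * (∑ i, sgn (P.p i)) / (2 * (Q.k + h))) • idField) := by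
  have h0 : ∀ u, HasBracket (F u) L 0 (F u) 0 0 := fun u => by
    rw [e]
    refine ((hF.hasBracket_quadratic P h𝔤 hh u).smul_right
      (1 / (2 * (Q.k + h)))).congr (smul_zero _) ?_ (smul_zero _) (smul_zero _)
    rw [smul_smul, one_div_mul_cancel (mul_ne_zero two_ne_zero hk), one_smul]
  have h1 : ∀ u, HasBracket L (F u) (fieldDeriv (F u)) (F u) 0 0 := fun u =>
    ((h0 u).skew hL).congr (sub_zero _) rfl rfl rfl
  refine ⟨h1, ?_⟩
  have hs := (hF.hasBracket_primary_quadratic P hL h1).smul_right (1 / (2 * (Q.k + h)))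
  rw [← e, ← fieldDeriv_smul, smul_comm, ← e, smul_zero, smul_smul] at hs
  refine hs.congr rfl rfl rfl ?_
  congr 1
  ring

end IsCurrentMap

theorem isCurrentMap_currentₗ (Q : Datum 𝔤) : Q.IsCurrentMap Q.currentₗ :=
  ⟨Q.isHomogField_current, Q.hasBracket_current⟩

variable (h : ℂ)

theorem sugawara_eq :
    Q.sugawara P h = (1 / (2 * (Q.k + h))) • IsCurrentMap.quadratic P Q.currentₗ := by
  rw [sugawara]
  congr 1
  exact P.sum_flip (normalProdₗ.compl₁₂ Q.currentₗ Q.currentₗ)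

theorem isHomogField_sugawara : IsHomogField 0 (Q.sugawara P h) := by
  rw [sugawara_eq]
  exact (Q.isCurrentMap_currentₗ.isHomogField_quadratic P).smul _

theorem hasBracket_sugawara_of_commute {c : VertexOperator ℂ Q.State} {γ : ZMod 2}
    (hc : IsHomogField γ c) (hz : ∀ u, HasBracket c (Q.current u) 0 0 0 0) :
    HasBracket c (Q.sugawara P h) 0 0 0 0 := by
  rw [sugawara_eq]
  exact (Q.isCurrentMap_currentₗ.hasBracket_quadratic_of_commute P hc hz).smul_right_zero _

theorem hasBracket_sugawara_current {h : ℂ} (h𝔤 : IsSimple 𝔤) (hh : Q.IsDualCoxeterNumber P h)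
    (hk : Q.k + h ≠ 0) (u : 𝔤) : HasBracket (Q.sugawara P h) (Q.current u)
      (fieldDeriv (Q.current u)) (Q.current u) 0 0 :=
  (Q.isCurrentMap_currentₗ.hasBracket_smul_quadratic P h𝔤 hh hk (isHomogField_sugawara P h)
    (sugawara_eq P h)).1 u

theorem hasBracket_sugawara_sugawara {h : ℂ} (h𝔤 : IsSimple 𝔤) (hh : Q.IsDualCoxeterNumber P h)
    (hk : Q.k + h ≠ 0) : HasBracket (Q.sugawara P h) (Q.sugawara P h)
      (fieldDeriv (Q.sugawara P h)) ((2 : ℂ) • Q.sugawara P h) 0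
      ((Q.k * (∑ i, sgn (P.p i)) / (2 * (Q.k + h))) • idField) :=
  (Q.isCurrentMap_currentₗ.hasBracket_smul_quadratic P h𝔤 hh hk (isHomogField_sugawara P h)
    (sugawara_eq P h)).2

end Sugawara

end Datum

/-! ### Charged free superfermions -/

section Charged

open SuperSpace

variable {M : Type*} [AddCommGroup M] [Module ℂ M] [SuperSpace M]
  {S : Type*} [Fintype S] [DecidableEq S]

/-- Fields `uᵢ`, `vᵢ` of parity `p i + 1` whose only nonzero `λ`-brackets are
`[uᵢ_λ vᵢ] = 1` and `[vᵢ_λ uᵢ] = (-1)^{p i}`. -/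
structure IsChargedSystem (u v : S → VertexOperator ℂ M) (p : S → ZMod 2) : Prop where
  homog_u : ∀ i, IsHomogField (p i + 1) (u i)
  homog_v : ∀ i, IsHomogField (p i + 1) (v i)
  brUV : ∀ i j, HasBracket (u i) (v j) ((if i = j then (1 : ℂ) else 0) • idField) 0 0 0
  brVU : ∀ i j, HasBracket (v i) (u j) ((if i = j then sgn (p i) else 0) • idField) 0 0 0
  brUU : ∀ i j, HasBracket (u i) (u j) 0 0 0 0
  brVV : ∀ i j, HasBracket (v i) (v j) 0 0 0 0

/-- The energy-momentum field `-∑ mᵢ :vᵢ∂uᵢ: + ∑ (1 - mᵢ) :(∂vᵢ)uᵢ:` of a charged system. -/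
def chargedEnergy (u v : S → VertexOperator ℂ M) (m : S → ℂ) : VertexOperator ℂ M :=
  -(∑ i, m i • normalProd (v i) (fieldDeriv (u i))) +
    ∑ i, (1 - m i) • normalProd (fieldDeriv (v i)) (u i)

namespace IsChargedSystem

variable {u v : S → VertexOperator ℂ M} {p : S → ZMod 2} (h : IsChargedSystem u v p) (m : S → ℂ)
include h

theorem isHomogField_energy : IsHomogField 0 (chargedEnergy u v m) := by
  refine IsHomogField.add (IsHomogField.sum _ fun i _ => ?_).neg
    (IsHomogField.sum _ fun i _ => ?_)
  · rw [← zmod_two_add_self (p i + 1)]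
    exact ((h.homog_v i).normalProd (h.homog_u i).deriv).smul _
  · rw [← zmod_two_add_self (p i + 1)]
    exact ((h.homog_v i).deriv.normalProd (h.homog_u i)).smul _

theorem hasBracket_energy_of_commute {c : VertexOperator ℂ M} {γ : ZMod 2}
    (hc : IsHomogField γ c) (hu : ∀ i, HasBracket c (u i) 0 0 0 0)
    (hv : ∀ i, HasBracket c (v i) 0 0 0 0) : HasBracket c (chargedEnergy u v m) 0 0 0 0 := by
  have h1 : HasBracket c (∑ i, m i • normalProd (v i) (fieldDeriv (u i))) 0 0 0 0 :=
    HasBracket.sum_right_zero _ fun i _ => (HasBracket.wick_zero hc (h.homog_v i) (hv i)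
      (hu i).deriv_right_zero).smul_right_zero _
  have h2 : HasBracket c (∑ i, (1 - m i) • normalProd (fieldDeriv (v i)) (u i)) 0 0 0 0 :=
    HasBracket.sum_right_zero _ fun i _ => (HasBracket.wick_zero hc (h.homog_v i).deriv
      (hv i).deriv_right_zero (hu i)).smul_right_zero _
  have h3 := h1.neg_right
  simp only [neg_zero] at h3
  exact h3.add_right_zero h2

theorem hasBracket_u_energy (j : S) : HasBracket (u j) (chargedEnergy u v m)
    (-(m j • fieldDeriv (u j))) ((1 - m j) • u j) 0 0 := by
  have h1 : ∀ i ∈ Finset.univ, HasBracket (u j) (m i • normalProd (v i) (fieldDeriv (u i)))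
      (if j = i then m i • fieldDeriv (u i) else 0) 0 0 0 := fun i _ => by
    have hA : HasBracket (u j) (v i) ((if j = i then (1 : ℂ) else 0) • idField)
        ((0 : ℂ) • idField) 0 0 := by rw [zero_smul]; exact h.brUV j i
    have hB : HasBracket (u j) (fieldDeriv (u i)) ((0 : ℂ) • idField) ((0 : ℂ) • idField) 0 0 := by
      rw [zero_smul]; exact (h.brUU j i).deriv_right_zero
    refine ((HasBracket.wick_free (h.homog_u j) (h.homog_v i) hA hB).smul_right (m i)).congr
      ?_ ?_ (smul_zero _) (smul_zero _)
    · split_ifs <;> module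
    · module
  have h2 : ∀ i ∈ Finset.univ, HasBracket (u j) ((1 - m i) • normalProd (fieldDeriv (v i)) (u i))
      0 (if j = i then (1 - m i) • u i else 0) 0 0 := fun i _ => by
    have hA : HasBracket (u j) (fieldDeriv (v i)) ((0 : ℂ) • idField)
        ((if j = i then (1 : ℂ) else 0) • idField) 0 0 := by
      rw [zero_smul]; exact (h.brUV j i).deriv_right_const
    have hB : HasBracket (u j) (u i) ((0 : ℂ) • idField) ((0 : ℂ) • idField) 0 0 := by
      rw [zero_smul]; exact h.brUU j i
    refine ((HasBracket.wick_free (h.homog_u j) (h.homog_v i).deriv hA hB).smul_right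
      (1 - m i)).congr ?_ ?_ (smul_zero _) (smul_zero _)
    · module
    · split_ifs <;> module
  refine ((HasBracket.sum_right _ h1).neg_right.add_right (HasBracket.sum_right _ h2)).congr
    ?_ ?_ ?_ ?_ <;> simp

theorem hasBracket_v_energy (j : S) : HasBracket (v j) (chargedEnergy u v m)
    (-((1 - m j) • fieldDeriv (v j))) (m j • v j) 0 0 := by
  -- the exchange of `vⱼ` with itself gives the sign `-(-1)^{p j}`
  have hs : sgn ((p j + 1) * (p j + 1)) * sgn (p j) = -1 := by
    rw [zmod_two_mul_self, sgn_add, sgn_one, mul_right_comm, sgn_mul_self, one_mul]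
  have h1 : ∀ i ∈ Finset.univ, HasBracket (v j) (m i • normalProd (v i) (fieldDeriv (u i)))
      0 (if j = i then -(m i • v i) else 0) 0 0 := fun i _ => by
    have hA : HasBracket (v j) (v i) ((0 : ℂ) • idField) ((0 : ℂ) • idField) 0 0 := by
      rw [zero_smul]; exact h.brVV j i
    have hB : HasBracket (v j) (fieldDeriv (u i)) ((0 : ℂ) • idField)
        ((if j = i then sgn (p j) else 0) • idField) 0 0 := by
      rw [zero_smul]; exact (h.brVU j i).deriv_right_const
    refine ((HasBracket.wick_free (h.homog_v j) (h.homog_v i) hA hB).smul_right (m i)).congr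
      ?_ ?_ (smul_zero _) (smul_zero _)
    · module
    · split_ifs with hij
      · subst hij; rw [hs]; module
      · module
  have h2 : ∀ i ∈ Finset.univ, HasBracket (v j) ((1 - m i) • normalProd (fieldDeriv (v i)) (u i))
      (if j = i then -((1 - m i) • fieldDeriv (v i)) else 0) 0 0 0 := fun i _ => by
    have hA : HasBracket (v j) (fieldDeriv (v i)) ((0 : ℂ) • idField) ((0 : ℂ) • idField) 0 0 := by
      rw [zero_smul]; exact (h.brVV j i).deriv_right_zero
    have hB : HasBracket (v j) (u i) ((if j = i then sgn (p j) else 0) • idField)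
        ((0 : ℂ) • idField) 0 0 := by
      rw [zero_smul]; exact h.brVU j i
    refine ((HasBracket.wick_free (h.homog_v j) (h.homog_v i).deriv hA hB).smul_right
      (1 - m i)).congr ?_ ?_ (smul_zero _) (smul_zero _)
    · split_ifs with hij
      · subst hij; rw [hs]; module
      · module
    · module
  refine ((HasBracket.sum_right _ h1).neg_right.add_right (HasBracket.sum_right _ h2)).congr
    ?_ ?_ ?_ ?_ <;> simp

theorem hasBracket_energy_u (j : S) : HasBracket (chargedEnergy u v m) (u j)
    (fieldDeriv (u j)) ((1 - m j) • u j) 0 0 := by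
  refine ((h.hasBracket_u_energy m j).skew (h.isHomogField_energy m)).congr ?_ rfl rfl rfl
  rw [fieldDeriv_smul]
  module

theorem hasBracket_energy_v (j : S) : HasBracket (chargedEnergy u v m) (v j)
    (fieldDeriv (v j)) (m j • v j) 0 0 := by
  refine ((h.hasBracket_v_energy m j).skew (h.isHomogField_energy m)).congr ?_ rfl rfl rfl
  rw [fieldDeriv_smul]
  module

theorem hasBracket_energy_energy : HasBracket (chargedEnergy u v m) (chargedEnergy u v m)
    (fieldDeriv (chargedEnergy u v m)) ((2 : ℂ) • chargedEnergy u v m) 0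
    ((∑ i, sgn (p i) * (-6 * m i ^ 2 + 6 * m i - 1)) • idField) := by
  have hL := h.isHomogField_energy m
  have hr : ∀ i, HasBracket (v i) (u i) (sgn (p i) • idField) 0 0 0 := fun i => by
    simpa only [if_true] using h.brVU i i
  have h1 := HasBracket.sum_right Finset.univ fun i _ =>
    (HasBracket.normalProd_deriv_right_primary hL (h.homog_v i) (h.hasBracket_energy_v m i)
      (h.hasBracket_energy_u m i) (hr i)).smul_right (m i)
  have h2 := HasBracket.sum_right Finset.univ fun i _ =>
    (HasBracket.normalProd_deriv_left_primary hL (h.homog_v i) (h.hasBracket_energy_v m i)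
      (h.hasBracket_energy_u m i) (hr i)).smul_right (1 - m i)
  refine (h1.neg_right.add_right h2).congr ?_ ?_ ?_ ?_
  · simp only [chargedEnergy, fieldDeriv_add, fieldDeriv_neg, fieldDeriv_sum, fieldDeriv_smul]
  · rw [chargedEnergy, smul_add, smul_neg, Finset.smul_sum, Finset.smul_sum]
    congr 1
    · congr 1
      exact Finset.sum_congr rfl fun i _ => by module
    · exact Finset.sum_congr rfl fun i _ => by module
  · rw [neg_add_eq_zero]
    exact Finset.sum_congr rfl fun i _ => by module
  · rw [Finset.sum_smul, ← Finset.sum_neg_distrib, ← Finset.sum_add_distrib]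
    exact Finset.sum_congr rfl fun i _ => by module

end IsChargedSystem

end Charged

/-! ### Neutral free superfermions -/

namespace Datum

open SuperSpace LieSuperalgebra

variable {𝔤 : Type*} [AddCommGroup 𝔤] [Module ℂ 𝔤] [LieSuperalgebra 𝔤] {Q : Datum 𝔤}

/-- The form `⟨a, b⟩ = (f|[a, b])`, on all of `𝔤`. -/
def omega (Q : Datum 𝔤) : 𝔤 →ₗ[ℂ] 𝔤 →ₗ[ℂ] ℂ := (br : 𝔤 →ₗ[ℂ] 𝔤 →ₗ[ℂ] 𝔤).compr₂ (Q.form Q.f)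

theorem omega_apply (a b : 𝔤) : Q.omega a b = Q.form Q.f (br a b) := rfl

theorem omega_skew {α β : ZMod 2} {a b : 𝔤} (ha : a ∈ homog 𝔤 α) (hb : b ∈ homog 𝔤 β) :
    Q.omega a b = -(sgn (α * β) * Q.omega b a) := by
  rw [omega_apply, br_skew ha hb, map_neg, map_smul, smul_eq_mul, omega_apply]

theorem omega_parity (a b : 𝔤) : Q.omega (parity a) (parity b) = Q.omega a b := by
  rw [omega_apply, omega_apply, ← parity_br, form_parity_right, parity_even Q.f_even]

theorem omega_parity_right (a b : 𝔤) : Q.omega a (parity b) = Q.omega (parity a) b := by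
  rw [← omega_parity, parity_parity]

theorem omega_eq_zero_of_ne {α β : ZMod 2} {a b : 𝔤} (ha : a ∈ homog 𝔤 α) (hb : b ∈ homog 𝔤 β)
    (hne : α ≠ β) : Q.omega a b = 0 := by
  rw [omega_apply]
  refine Q.form_even Q.f_even (br_mem ha hb) fun h => hne ?_
  have : α + β + β = α := by rw [add_assoc, zmod_two_add_self, add_zero]
  rw [← this, ← h, zero_add]

/-- Skew-supersymmetry of the form `⟨a, b⟩` for elements that need not be homogeneous. -/
theorem omega_swap (a b : 𝔤) : Q.omega a b = -Q.omega b (parity a) := by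
  have key : ∀ {α β : ZMod 2} {a b : 𝔤}, a ∈ homog 𝔤 α → b ∈ homog 𝔤 β →
      Q.omega a b = -Q.omega b (parity a) := by
    intro α β a b ha hb
    rw [mem_homog.1 ha, map_smul]
    by_cases h : α = β
    · subst h
      rw [omega_skew ha hb, zmod_two_mul_self, smul_eq_mul]
    · rw [omega_eq_zero_of_ne ha hb h, omega_eq_zero_of_ne hb ha (Ne.symm h), smul_zero, neg_zero]
  rw [← comp_add_comp a, ← comp_add_comp b]
  simp only [map_add, LinearMap.add_apply]
  rw [key (comp_mem 0 a) (comp_mem 0 b), key (comp_mem 0 a) (comp_mem 1 b),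
    key (comp_mem 1 a) (comp_mem 0 b), key (comp_mem 1 a) (comp_mem 1 b)]
  ring

namespace AdaptedBasis

variable {I : Type*} [Fintype I] [DecidableEq I] (U : Q.AdaptedBasis I)

/-- The coordinates of an eigenvector of `ad x` are supported on the basis vectors with the same
eigenvalue. -/
theorem repr_eq_zero {n : ℤ} {c : 𝔤} (hc : c ∈ eigen Q.x n) {i : I} (hi : U.n i ≠ n) :
    U.u.repr c i = 0 := by
  have h1 : br Q.x c = ((n : ℂ) / 2) • c := Module.End.mem_eigenspace_iff.1 hc
  have h2 : ∀ j, br Q.x (U.u j) = ((U.n j : ℂ) / 2) • U.u j := fun j =>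
    Module.End.mem_eigenspace_iff.1 (U.mem_eigen j)
  have h3 : U.u.coord i ∘ₗ br Q.x = ((U.n i : ℂ) / 2) • U.u.coord i := by
    refine U.u.ext fun j => ?_
    rw [LinearMap.comp_apply, h2, map_smul, LinearMap.smul_apply, U.u.coord_apply, U.u.repr_self,
      Finsupp.single_apply]
    split_ifs with hj
    · rw [hj]
    · simp
  have h4 := LinearMap.congr_fun h3 c
  rw [LinearMap.comp_apply, h1, map_smul, LinearMap.smul_apply, U.u.coord_apply, smul_eq_mul,
    smul_eq_mul, ← sub_eq_zero, ← sub_mul] at h4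
  refine (mul_eq_zero.1 h4).resolve_left fun h5 => hi ?_
  have : (U.n i : ℂ) = n := by linear_combination -2 * h5
  exact_mod_cast this

/-- The basis vector `uᵢ` (`i ∈ S'`) as an element of `𝔤_{1/2}`. -/
def half (i : U.S') : Q.gHalf := ⟨U.u i, by
  have h := U.mem_eigen i
  rw [i.2] at h
  exact h⟩

theorem sum_repr_half (c : Q.gHalf) : ∑ i : U.S', U.u.repr c i • U.half i = c := by
  refine Subtype.ext ?_
  rw [AddSubmonoidClass.coe_finsetSum]
  conv_rhs => rw [← U.u.sum_repr (c : 𝔤)]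
  rw [← Finset.sum_filter_of_ne (p := fun i => U.n i = 1)]
  · exact (Finset.sum_subtype (Finset.univ.filter fun i => U.n i = 1) (by simp)
      fun i => U.u.repr (c : 𝔤) i • U.u i).symm
  · intro i _ hi
    by_contra hn
    exact hi (by rw [U.repr_eq_zero c.2 hn, zero_smul])

theorem sum_omega_smul_half (c : Q.gHalf) : ∑ i : U.S', Q.omega c (U.u' i) • U.half i = c := by
  have h : ∀ i, Q.omega c (U.u' i) = U.u.repr (c : 𝔤) i := fun i => by
    have := congrArg (fun d : Q.gHalf => Q.omega d (U.u' i)) (U.sum_repr_half c)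
    simp only [AddSubmonoidClass.coe_finsetSum, map_sum, LinearMap.sum_apply,
      Submodule.coe_smul, map_smul, LinearMap.smul_apply, half, omega_apply, U.form_eq,
      smul_eq_mul, mul_ite, mul_one, mul_zero, Finset.sum_ite_eq', Finset.mem_univ, if_true] at this
    exact this.symm
  simp only [h, U.sum_repr_half]

theorem sum_omega_smul_u' (c : Q.gHalf) : ∑ i : U.S', Q.omega (U.u i) c • U.u' i = c := by
  set d : Q.gHalf := ∑ i : U.S', Q.omega (U.u i) c • U.u' i - c with hd
  have h1 : ∀ j : U.S', Q.omega (U.u j) d = 0 := fun j => by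
    simp only [hd, AddSubgroupClass.coe_sub, AddSubmonoidClass.coe_finsetSum, map_sub, map_sum,
      Submodule.coe_smul, map_smul, omega_apply, U.form_eq, smul_eq_mul, mul_ite, mul_one,
      mul_zero, Finset.sum_ite_eq, Finset.mem_univ, if_true, sub_self]
  have h2 : ∀ b : Q.gHalf, Q.omega b d = 0 := fun b => by
    rw [← U.sum_repr_half b, AddSubmonoidClass.coe_finsetSum, map_sum, LinearMap.sum_apply]
    refine Finset.sum_eq_zero fun j _ => ?_
    rw [Submodule.coe_smul, map_smul, LinearMap.smul_apply, half, h1, smul_zero]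
  -- the form is nondegenerate on the other side as well, because it is skew-supersymmetric
  have h3 : d = 0 := by
    rw [← U.sum_omega_smul_half d]
    refine Finset.sum_eq_zero fun j _ => ?_
    have : Q.omega (U.u' j : 𝔤) (parity (d : 𝔤)) = 0 := by
      rw [omega_parity_right]
      exact h2 (Q.parityHalf (U.u' j))
    rw [omega_swap, this, neg_zero, zero_smul]
  exact sub_eq_zero.1 h3

theorem u'_mem_homog (i : U.S') : (U.u' i : 𝔤) ∈ homog 𝔤 (U.p i) := by
  have h : Q.parityHalf (U.u' i) = sgn (U.p i) • U.u' i := by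
    rw [← U.sum_omega_smul_u' (Q.parityHalf (U.u' i)), Finset.sum_eq_single i]
    · change Q.omega (U.u i) (parity (U.u' i : 𝔤)) • _ = _
      rw [omega_parity_right, QuantumReduction.mem_homog.1 (U.mem_homog i), map_smul,
        LinearMap.smul_apply, omega_apply, U.form_eq, if_pos rfl, smul_eq_mul, mul_one]
    · intro j _ hj
      change Q.omega (U.u j) (parity (U.u' i : 𝔤)) • _ = _
      rw [omega_parity_right, QuantumReduction.mem_homog.1 (U.mem_homog j), map_smul,
        LinearMap.smul_apply, omega_apply, U.form_eq, if_neg hj, smul_zero, zero_smul]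
    · simp
  exact congrArg Subtype.val h

end AdaptedBasis

/-- A representation of the neutral superfermions of `A_ne = 𝔤_{1/2}` by fields on a superspace. -/
structure IsNeutralMap {M : Type*} [AddCommGroup M] [Module ℂ M] [SuperSpace M] (Q : Datum 𝔤)
    (F : Q.gHalf →ₗ[ℂ] VertexOperator ℂ M) : Prop where
  isHomogField : ∀ {α : ZMod 2} {c : Q.gHalf}, (c : 𝔤) ∈ homog 𝔤 α → IsHomogField α (F c)
  bracket : ∀ c d : Q.gHalf, HasBracket (F c) (F d) (Q.omega c d • idField) 0 0 0

namespace IsNeutralMap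

variable {I : Type*} [Fintype I] [DecidableEq I] (U : Q.AdaptedBasis I)
  {M : Type*} [AddCommGroup M] [Module ℂ M] [SuperSpace M]
  {F : Q.gHalf →ₗ[ℂ] VertexOperator ℂ M} (hF : Q.IsNeutralMap F)

/-- The energy-momentum field `½ ∑ᵢ :∂F(uⁱ)F(uᵢ):` of the neutral superfermions. -/
def energy (F : Q.gHalf →ₗ[ℂ] VertexOperator ℂ M) : VertexOperator ℂ M :=
  (1 / 2 : ℂ) • ∑ i, normalProd (fieldDeriv (F (U.u' i))) (F (U.half i))

include hF

theorem isHomogField_energy : IsHomogField 0 (energy U F) := by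
  refine (IsHomogField.sum _ fun i _ => ?_).smul _
  rw [← zmod_two_add_self (U.p i)]
  exact (hF.isHomogField (U.u'_mem_homog i)).deriv.normalProd
    (hF.isHomogField (c := U.half i) (U.mem_homog i))

theorem hasBracket_energy_of_commute {c : VertexOperator ℂ M} {γ : ZMod 2}
    (hc : IsHomogField γ c) (hz : ∀ d, HasBracket c (F d) 0 0 0 0) :
    HasBracket c (energy U F) 0 0 0 0 :=
  (HasBracket.sum_right_zero _ fun i _ => HasBracket.wick_zero hc
    (hF.isHomogField (U.u'_mem_homog i)).deriv (hz _).deriv_right_zero (hz _)).smul_right_zero _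

theorem hasBracket_field_energy {γ : ZMod 2} {c : Q.gHalf} (hc : (c : 𝔤) ∈ homog 𝔤 γ) :
    HasBracket (F c) (energy U F) (-((1 / 2 : ℂ) • fieldDeriv (F c))) ((1 / 2 : ℂ) • F c) 0 0 := by
  have h1 : ∀ i ∈ Finset.univ, HasBracket (F c)
      (normalProd (fieldDeriv (F (U.u' i))) (F (U.half i)))
      (-(fieldDeriv (F (Q.omega (U.u i) c • U.u' i)))) (F (Q.omega c (U.u' i) • U.half i)) 0 0 :=
    fun i _ => by
    have hA : HasBracket (F c) (fieldDeriv (F (U.u' i))) ((0 : ℂ) • idField)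
        (Q.omega c (U.u' i) • idField) 0 0 := by
      rw [zero_smul]; exact (hF.bracket c (U.u' i)).deriv_right_const
    have hB : HasBracket (F c) (F (U.half i)) (Q.omega c (U.u i) • idField) ((0 : ℂ) • idField)
        0 0 := by
      rw [zero_smul]; exact hF.bracket c (U.half i)
    have e : sgn (γ * U.p i) * Q.omega c (U.u i) = -Q.omega (U.u i) c := by
      rw [omega_skew hc (U.mem_homog i)]
      linear_combination -Q.omega (U.u i) c * sgn_mul_self (γ * U.p i)
    refine (HasBracket.wick_free (hF.isHomogField hc)
      (hF.isHomogField (U.u'_mem_homog i)).deriv hA hB).congr ?_ ?_ rfl rfl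
    · rw [e, map_smul, fieldDeriv_smul]
      module
    · rw [map_smul]
      module
  refine ((HasBracket.sum_right _ h1).smul_right (1 / 2 : ℂ)).congr ?_ ?_ ?_ ?_
  · rw [Finset.sum_neg_distrib, ← fieldDeriv_sum, ← map_sum, U.sum_omega_smul_u', smul_neg]
  · rw [← map_sum, U.sum_omega_smul_half]
  · rw [Finset.sum_const_zero, smul_zero]
  · rw [Finset.sum_const_zero, smul_zero]

theorem hasBracket_energy_field {γ : ZMod 2} {c : Q.gHalf} (hc : (c : 𝔤) ∈ homog 𝔤 γ) :
    HasBracket (energy U F) (F c) (fieldDeriv (F c)) ((1 / 2 : ℂ) • F c) 0 0 := by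
  refine ((hF.hasBracket_field_energy U hc).skew (hF.isHomogField_energy U)).congr ?_ rfl rfl rfl
  rw [fieldDeriv_smul]
  module

theorem hasBracket_energy_energy : HasBracket (energy U F) (energy U F)
    (fieldDeriv (energy U F)) ((2 : ℂ) • energy U F) 0
    ((-(1 / 4) * ∑ i : U.S', sgn (U.p i)) • idField) := by
  have hL := hF.isHomogField_energy U
  have h1 := (HasBracket.sum_right Finset.univ fun i _ =>
    HasBracket.normalProd_deriv_left_primary hL (hF.isHomogField (U.u'_mem_homog i))
      (hF.hasBracket_energy_field U (U.u'_mem_homog i))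
      (hF.hasBracket_energy_field U (c := U.half i) (U.mem_homog i))
      (hF.bracket (U.u' i) (U.half i))).smul_right (1 / 2 : ℂ)
  have e : ∀ i : U.S', Q.omega (U.u' i) (U.half i) = -sgn (U.p i) := fun i => by
    have h0 := U.form_eq i i
    rw [if_pos rfl] at h0
    rw [omega_skew (U.u'_mem_homog i) (b := (U.half i : 𝔤)) (U.mem_homog i), zmod_two_mul_self]
    change -(sgn (U.p i) * Q.form Q.f (br (U.u i) (U.u' i : 𝔤))) = _
    rw [h0, mul_one]
  have h2 : HasBracket (energy U F) (energy U F) (fieldDeriv (energy U F))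
      ((2 : ℂ) • energy U F) ((1 / 2 : ℂ) • ∑ i : U.S', (2 * (1 / 2) : ℂ) •
        normalProd (F (U.u' i)) (F (U.half i)))
      ((-(1 / 4) * ∑ i : U.S', sgn (U.p i)) • idField) := by
    refine h1.congr ?_ ?_ rfl ?_
    · rw [← fieldDeriv_sum, ← fieldDeriv_smul, energy]
    · rw [← Finset.smul_sum, smul_comm, energy]
      norm_num
    · simp only [e]
      rw [← Finset.sum_smul, smul_smul, ← Finset.mul_sum, Finset.sum_neg_distrib]
      congr 1
      ring
  -- skew-symmetry makes the coefficient `½ ∑ᵢ :F(uⁱ)F(uᵢ):` of `λ²` vanish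
  exact h2.congr rfl rfl (HasBracket.virasoro_quadratic_eq_zero hL h2) rfl

end IsNeutralMap

end Datum

/-! ### Superdimensions -/

section Superdimension

open SuperSpace

variable {V : Type*} [AddCommGroup V] [Module ℂ V] [SuperSpace V] {I : Type*}
  (b : Module.Basis I ℂ V) {p : I → ZMod 2}

theorem repr_parity (hb : ∀ i, b i ∈ homog V (p i)) (v : V) (i : I) :
    b.repr (parity v) i = sgn (p i) * b.repr v i := by
  classical
  have h : b.coord i ∘ₗ parity = sgn (p i) • b.coord i := by
    refine b.ext fun j => ?_
    rw [LinearMap.comp_apply, mem_homog.1 (hb j), map_smul, LinearMap.smul_apply, b.coord_apply,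
      b.repr_self, Finsupp.single_apply]
    split_ifs with hj
    · rw [hj]
    · simp
  exact LinearMap.congr_fun h v

theorem sgn_injective : Function.Injective sgn := by
  intro α β h
  rcases zmod_two_cases α with rfl | rfl <;> rcases zmod_two_cases β with rfl | rfl
  · rfl
  · rw [sgn_zero, sgn_one] at h; norm_num at h
  · rw [sgn_zero, sgn_one] at h; norm_num at h
  · rfl

variable [Fintype I]

/-- The dimension of the part of parity `α` of a subspace spanned by a part of a homogeneous
basis. -/
theorem finrank_inf_homog (hb : ∀ i, b i ∈ homog V (p i)) (q : I → Prop) [DecidablePred q]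
    (W : Submodule ℂ V) (hW : ∀ i, q i → b i ∈ W)
    (hW' : ∀ v ∈ W, ∀ i, ¬q i → b.repr v i = 0) (α : ZMod 2) :
    Module.finrank ℂ ↥(W ⊓ homog V α) = (Finset.univ.filter fun i => q i ∧ p i = α).card := by
  have hspan : W ⊓ homog V α =
      Submodule.span ℂ (Set.range fun i : {i // q i ∧ p i = α} => b i) := by
    refine le_antisymm (fun v hv => ?_) (Submodule.span_le.2 ?_)
    · rw [← b.sum_repr v]
      refine Submodule.sum_mem _ fun i _ => ?_
      by_cases hi : q i ∧ p i = α
      · exact Submodule.smul_mem _ _ (Submodule.subset_span ⟨⟨i, hi⟩, rfl⟩)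
      · have h0 : b.repr v i = 0 := by
          by_cases hq : q i
          · have h1 := repr_parity b hb v i
            rw [mem_homog.1 hv.2, map_smul, Finsupp.smul_apply, smul_eq_mul, ← sub_eq_zero,
              ← sub_mul] at h1
            refine (mul_eq_zero.1 h1).resolve_left fun h2 => hi ⟨hq, ?_⟩
            exact (sgn_injective (sub_eq_zero.1 h2)).symm
          · exact hW' v hv.1 i hq
        rw [h0, zero_smul]
        exact Submodule.zero_mem _
    · rintro _ ⟨⟨i, hq, rfl⟩, rfl⟩
      exact ⟨hW i hq, hb i⟩
  rw [hspan, finrank_span_eq_card (b := fun i : {i // q i ∧ p i = α} => b i)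
    (b.linearIndependent.comp _ Subtype.val_injective), Fintype.card_subtype]

/-- The superdimension of a subspace spanned by a part of a homogeneous basis is the signed number
of these basis vectors. -/
theorem sdim_eq_sum (hb : ∀ i, b i ∈ homog V (p i)) (q : I → Prop) [DecidablePred q]
    (W : Submodule ℂ V) (hW : ∀ i, q i → b i ∈ W)
    (hW' : ∀ v ∈ W, ∀ i, ¬q i → b.repr v i = 0) :
    sdim W = ∑ i : {i // q i}, sgn (p i) := by
  rw [sdim, finrank_inf_homog b hb q W hW hW', finrank_inf_homog b hb q W hW hW',
    ← Finset.sum_subtype (Finset.univ.filter q) (by simp) fun i => sgn (p i),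
    Finset.card_filter, Finset.card_filter, Finset.sum_filter]
  push_cast
  rw [← Finset.sum_sub_distrib]
  refine Finset.sum_congr rfl fun i _ => ?_
  by_cases hq : q i <;> rcases zmod_two_cases (p i) with h | h <;> simp [hq, h, sgn_zero, sgn_one]

end Superdimension

/-! ### Sums of commuting energy-momentum fields -/

section Bracket

open SuperSpace

variable {M : Type*} [AddCommGroup M] [Module ℂ M]

theorem atPower_zero (j : ℕ) : atPower j (0 : VertexOperator ℂ M) = 0 := by
  funext n
  simp [atPower]

variable [SuperSpace M]

namespace HasBracket

variable {L a A₂ A₃ : VertexOperator ℂ M}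

theorem isEnergyMomentumField {t c : ℂ} (hL : IsHomogField 0 L)
    (h : HasBracket L L (fieldDeriv L) ((2 : ℂ) • L) 0 (t • idField)) (ht : t = c / 2) :
    IsEnergyMomentumField L c where
  even := isEvenField_iff.2 hL
  isLocal := h.isLocal
  bracket := by
    rw [h.lambdaBracket_eq, smul_zero, atPower_zero, add_zero, smul_smul, ht]
    congr 3
    ring

theorem hasConformalWeight {Δ : ℂ} (h : HasBracket L a (fieldDeriv a) (Δ • a) A₂ A₃) :
    HasConformalWeight L a Δ where
  isLocal := h.isLocal
  bracket_zero := by simp [h.lambdaBracket_eq, atPower]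
  bracket_one := by simp [h.lambdaBracket_eq, atPower]

theorem isPrimary {Δ : ℂ} (h : HasBracket L a (fieldDeriv a) (Δ • a) 0 0) :
    IsPrimary L a Δ where
  isLocal := h.isLocal
  bracket := by rw [h.lambdaBracket_eq, smul_zero, smul_zero, atPower_zero, atPower_zero, add_zero,
    add_zero]

/-- The bracket of `A + X + C + N` with itself when `A`, `C` and `N` are commuting energy-momentum
fields, `X` commutes with `C` and `N`, and the quadratic terms of `[A_λ X]` and `[X_λ A]` cancel. -/
theorem add_four {A X C N Y : VertexOperator ℂ M} {tA tX tC tN : ℂ}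
    (hAA : HasBracket A A (fieldDeriv A) ((2 : ℂ) • A) 0 (tA • idField))
    (hXX : HasBracket X X 0 0 0 (tX • idField))
    (hCC : HasBracket C C (fieldDeriv C) ((2 : ℂ) • C) 0 (tC • idField))
    (hNN : HasBracket N N (fieldDeriv N) ((2 : ℂ) • N) 0 (tN • idField))
    (hAX : HasBracket A X (fieldDeriv X) ((2 : ℂ) • X) Y 0) (hXA : HasBracket X A 0 0 (-Y) 0)
    (hAC : HasBracket A C 0 0 0 0) (hCA : HasBracket C A 0 0 0 0)
    (hAN : HasBracket A N 0 0 0 0) (hNA : HasBracket N A 0 0 0 0)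
    (hXC : HasBracket X C 0 0 0 0) (hCX : HasBracket C X 0 0 0 0)
    (hXN : HasBracket X N 0 0 0 0) (hNX : HasBracket N X 0 0 0 0)
    (hCN : HasBracket C N 0 0 0 0) (hNC : HasBracket N C 0 0 0 0) :
    HasBracket (A + X + C + N) (A + X + C + N) (fieldDeriv (A + X + C + N))
      ((2 : ℂ) • (A + X + C + N)) 0 ((tA + tX + tC + tN) • idField) := by
  have h1 := ((hAA.add_right hAX).add_right hAC).add_right hAN
  have h2 := ((hXA.add_right hXX).add_right hXC).add_right hXN
  have h3 := ((hCA.add_right hCX).add_right hCC).add_right hCN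
  have h4 := ((hNA.add_right hNX).add_right hNC).add_right hNN
  refine (((h1.add_left h2).add_left h3).add_left h4).congr ?_ ?_ ?_ ?_
  · simp only [fieldDeriv_add]; abel
  · module
  · abel
  · module

theorem isPrimary_of_eq_zero {Δ r : ℂ}
    (h : HasBracket L a (fieldDeriv a) (Δ • a) ((-2 : ℂ) • r • idField) 0) (hr : r = 0) :
    IsPrimary L a Δ := by
  subst hr
  exact (h.congr rfl rfl (by rw [zero_smul, smul_zero]) rfl : HasBracket L a _ _ 0 0).isPrimary

/-- The bracket of `A + X + C + N` with a field of weight `1` for `A`, which is shifted by `X` and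
commutes with `C` and `N`. -/
theorem add_shift {A X C N Y : VertexOperator ℂ M} {j : ℂ}
    (hA : HasBracket A a (fieldDeriv a) a 0 0) (hX : HasBracket X a 0 (-(j • a)) Y 0)
    (hC : HasBracket C a 0 0 0 0) (hN : HasBracket N a 0 0 0 0) :
    HasBracket (A + X + C + N) a (fieldDeriv a) ((1 - j) • a) Y 0 := by
  refine (((hA.add_left hX).add_left hC).add_left hN).congr ?_ ?_ ?_ ?_
  · simp only [add_zero]
  · module
  · simp only [add_zero, zero_add]
  · simp only [add_zero]

/-- The derivative of a Heisenberg field. -/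
theorem deriv_deriv_of_heisenberg {r : ℂ} (h : HasBracket a a 0 (r • idField) 0 0) :
    HasBracket (fieldDeriv a) (fieldDeriv a) 0 0 0 ((-6 * r) • idField) := by
  have h1 : HasBracket a (fieldDeriv a) 0 0 ((2 : ℂ) • r • idField) 0 := by
    refine h.deriv_right.congr fieldDeriv_zero ?_ ?_ (smul_zero _)
    · rw [fieldDeriv_smul, fieldDeriv_idField, smul_zero, add_zero]
    · rw [fieldDeriv_zero, zero_add]
  refine h1.deriv_left.congr rfl neg_zero (smul_zero _) ?_
  rw [smul_smul, smul_smul]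
  congr 1
  ring

theorem deriv_right_of_weight_one (h : HasBracket L a (fieldDeriv a) a 0 0) :
    HasBracket L (fieldDeriv a) (fieldDeriv (fieldDeriv a)) ((2 : ℂ) • fieldDeriv a)
      ((2 : ℂ) • a) 0 := by
  refine h.deriv_right.congr rfl ?_ ?_ (smul_zero _)
  · rw [two_smul]
  · rw [fieldDeriv_zero, zero_add]

theorem deriv_left_of_weight_one (h : HasBracket L a (fieldDeriv a) a 0 0)
    (ha : IsHomogField 0 a) : HasBracket (fieldDeriv a) L 0 0 (-((2 : ℂ) • a)) 0 := by
  have h0 := h.skew ha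
  rw [sub_self] at h0
  refine h0.deriv_left.congr rfl neg_zero ?_ (smul_zero _)
  module

end HasBracket

theorem generator_mem_vertexAlgebraOf {𝒱 : Set (VertexOperator ℂ M)} {a : VertexOperator ℂ M}
    (ha : a ∈ 𝒱) : a ∈ vertexAlgebraOf 𝒱 :=
  Submodule.mem_sInf.2 fun _ hS => hS.2.1 ha

theorem fieldDeriv_mem_vertexAlgebraOf {𝒱 : Set (VertexOperator ℂ M)} {a : VertexOperator ℂ M}
    (ha : a ∈ vertexAlgebraOf 𝒱) : fieldDeriv a ∈ vertexAlgebraOf 𝒱 :=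
  Submodule.mem_sInf.2 fun S hS => hS.2.2.1 a (Submodule.mem_sInf.1 ha S hS)

theorem normalProd_mem_vertexAlgebraOf {𝒱 : Set (VertexOperator ℂ M)} {a b : VertexOperator ℂ M}
    (ha : a ∈ vertexAlgebraOf 𝒱) (hb : b ∈ vertexAlgebraOf 𝒱) :
    normalProd a b ∈ vertexAlgebraOf 𝒱 := by
  refine Submodule.mem_sInf.2 fun S hS => ?_
  have h := hS.2.2.2 a (Submodule.mem_sInf.1 ha S hS) b (Submodule.mem_sInf.1 hb S hS) (-1)
  have e : nthProd a b (-1) = ((0 ! : ℂ)⁻¹) • normalProd a b := rfl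
  rwa [e, Nat.factorial_zero, Nat.cast_one, inv_one, one_smul] at h

end Bracket

/-! ### The energy-momentum field of the quantum reduction -/

namespace Datum

open SuperSpace LieSuperalgebra

variable {𝔤 : Type*} [AddCommGroup 𝔤] [Module ℂ 𝔤] [LieSuperalgebra 𝔤] {Q : Datum 𝔤}
  {J : Type*} [Fintype J] [DecidableEq J] (P : Q.DualPair J)
  {I : Type*} [Fintype I] [DecidableEq I] (U : Q.AdaptedBasis I)

theorem DualPair.sum_sgn : ∑ i, sgn (P.p i) = sdim (⊤ : Submodule ℂ 𝔤) := by
  rw [sdim_eq_sum P.a P.mem_homog (fun _ => True) ⊤ (fun _ _ => Submodule.mem_top)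
    (fun _ _ _ h => absurd trivial h)]
  exact (Finset.sum_subtype Finset.univ (by simp) fun i => sgn (P.p i))

namespace AdaptedBasis

theorem sum_sgn : ∑ i : U.S', sgn (U.p i) = sdim Q.gHalf :=
  (sdim_eq_sum U.u U.mem_homog (fun i => U.n i = 1) Q.gHalf (fun i hi => (U.half ⟨i, hi⟩).2)
    (fun _ hv _ hi => U.repr_eq_zero hv hi)).symm

theorem isChargedSystem : IsChargedSystem U.phi U.phiDual fun i => U.p i where
  homog_u i := Q.isHomogField_ghost (U.mem_homog i)
  homog_v i := Q.isHomogField_ghostDual (LinearMap.ext fun b => repr_parity U.u U.mem_homog b i)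
  brUV i j := by
    refine (Q.hasBracket_ghost_ghostDual _ _).congr ?_ rfl rfl rfl
    congr 1
    change U.u.repr (U.u i) j = _
    simp [Finsupp.single_apply, Subtype.ext_iff]
  brVU i j := by
    refine (Q.hasBracket_ghostDual_ghost _ _).congr ?_ rfl rfl rfl
    congr 1
    change U.u.repr (parity (U.u j)) i = _
    rw [repr_parity U.u U.mem_homog]
    simp [Finsupp.single_apply, Subtype.ext_iff, eq_comm]
  brUU i j := Q.hasBracket_ghost_ghost _ _
  brVV i j := Q.hasBracket_ghostDual_ghostDual _ _

theorem isNeutralMap : Q.IsNeutralMap Q.neutralₗ :=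
  ⟨Q.isHomogField_neutral, Q.hasBracket_neutral⟩

theorem energyMomentum_mem (h : ℂ) : U.energyMomentum P h ∈ Q.vertexAlgebra := by
  have hc : ∀ u, Q.current u ∈ Q.vertexAlgebra := fun u =>
    generator_mem_vertexAlgebraOf (Or.inl (Or.inl (Or.inl ⟨u, rfl⟩)))
  have hb : ∀ b, Q.ghost b ∈ Q.vertexAlgebra := fun b =>
    generator_mem_vertexAlgebraOf (Or.inl (Or.inl (Or.inr ⟨b, rfl⟩)))
  have hd : ∀ ξ, Q.ghostDual ξ ∈ Q.vertexAlgebra := fun ξ =>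
    generator_mem_vertexAlgebraOf (Or.inl (Or.inr ⟨ξ, rfl⟩))
  have hn : ∀ c, Q.neutral c ∈ Q.vertexAlgebra := fun c =>
    generator_mem_vertexAlgebraOf (Or.inr ⟨c, rfl⟩)
  refine Submodule.add_mem _ (Submodule.add_mem _ (Submodule.add_mem _ ?_ ?_)
    (Submodule.add_mem _ (Submodule.neg_mem _ ?_) ?_)) ?_
  · exact Submodule.smul_mem _ _ (Submodule.sum_mem _ fun i _ => Submodule.smul_mem _ _
      (normalProd_mem_vertexAlgebraOf (hc _) (hc _)))
  · exact fieldDeriv_mem_vertexAlgebraOf (hc _)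
  · exact Submodule.sum_mem _ fun i _ => Submodule.smul_mem _ _
      (normalProd_mem_vertexAlgebraOf (hd _) (fieldDeriv_mem_vertexAlgebraOf (hb _)))
  · exact Submodule.sum_mem _ fun i _ => Submodule.smul_mem _ _
      (normalProd_mem_vertexAlgebraOf (fieldDeriv_mem_vertexAlgebraOf (hd _)) (hb _))
  · exact Submodule.smul_mem _ _ (Submodule.sum_mem _ fun i _ =>
      normalProd_mem_vertexAlgebraOf (fieldDeriv_mem_vertexAlgebraOf (hn _)) (hn _))

theorem isHomogField_Lch : IsHomogField 0 U.Lch := U.isChargedSystem.isHomogField_energy _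

theorem isHomogField_Lne : IsHomogField 0 U.Lne := isNeutralMap.isHomogField_energy U

theorem isHomogField_deriv_x : IsHomogField 0 (fieldDeriv (Q.current Q.x)) :=
  (Q.isHomogField_current Q.x_even).deriv

theorem isHomogField_energyMomentum (h : ℂ) : IsHomogField 0 (U.energyMomentum P h) :=
  (((isHomogField_sugawara P h).add isHomogField_deriv_x).add U.isHomogField_Lch).add
    U.isHomogField_Lne

theorem hasBracket_Lch_of_commute {c : VertexOperator ℂ Q.State} {γ : ZMod 2}
    (hc : IsHomogField γ c) (hb : ∀ b, HasBracket c (Q.ghost b) 0 0 0 0)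
    (hd : ∀ ξ, HasBracket c (Q.ghostDual ξ) 0 0 0 0) : HasBracket c U.Lch 0 0 0 0 :=
  U.isChargedSystem.hasBracket_energy_of_commute _ hc (fun _ => hb _) fun _ => hd _

theorem hasBracket_Lne_of_commute {c : VertexOperator ℂ Q.State} {γ : ZMod 2}
    (hc : IsHomogField γ c) (hn : ∀ d, HasBracket c (Q.neutral d) 0 0 0 0) :
    HasBracket c U.Lne 0 0 0 0 :=
  isNeutralMap.hasBracket_energy_of_commute U hc hn

/-- A field that commutes with the homogeneous currents commutes with all currents. -/
theorem hasBracket_current_of_homog {c : VertexOperator ℂ Q.State}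
    (hc : ∀ (α : ZMod 2) (u : 𝔤), u ∈ homog 𝔤 α → HasBracket c (Q.current u) 0 0 0 0) (u : 𝔤) :
    HasBracket c (Q.current u) 0 0 0 0 := by
  have h := (hc 0 _ (comp_mem 0 u)).add_right_zero (hc 1 _ (comp_mem 1 u))
  rwa [← Q.currentₗ_apply, ← Q.currentₗ_apply, ← map_add, comp_add_comp] at h

theorem hasBracket_Lch_current (u : 𝔤) : HasBracket U.Lch (Q.current u) 0 0 0 0 :=
  hasBracket_current_of_homog (fun _ _ hu => (U.hasBracket_Lch_of_commute
    (Q.isHomogField_current hu) (Q.hasBracket_current_ghost _)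
    (Q.hasBracket_current_ghostDual _)).skew_zero U.isHomogField_Lch) u

theorem hasBracket_Lne_current (u : 𝔤) : HasBracket U.Lne (Q.current u) 0 0 0 0 :=
  hasBracket_current_of_homog (fun _ _ hu => (U.hasBracket_Lne_of_commute
    (Q.isHomogField_current hu) (Q.hasBracket_current_neutral _)).skew_zero U.isHomogField_Lne) u

theorem hasBracket_deriv_x_current {n : ℤ} {u : 𝔤} (hu : u ∈ eigen Q.x n) :
    HasBracket (fieldDeriv (Q.current Q.x)) (Q.current u) 0 (-(((n : ℂ) / 2) • Q.current u))
      ((-2 : ℂ) • (Q.k * Q.form Q.x u) • idField) 0 := by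
  have e : Q.current (br Q.x u) = ((n : ℂ) / 2) • Q.current u := by
    rw [← Q.currentₗ_apply, Module.End.mem_eigenspace_iff.1 hu, map_smul, Q.currentₗ_apply]
  exact ((Q.hasBracket_current Q.x u).deriv_left).congr rfl (by rw [e]) rfl (smul_zero _)

variable {h : ℂ} (h𝔤 : IsSimple 𝔤) (hh : Q.IsDualCoxeterNumber P h) (hk : Q.k + h ≠ 0)

include h𝔤 hh hk in
/-- `[L_λ u] = (∂ + (1 - j) λ) u - λ² k (x|u)` for `u ∈ 𝔤_j`, `j = n / 2`. -/
theorem hasBracket_energyMomentum_current {n : ℤ} {u : 𝔤} (hu : u ∈ eigen Q.x n) :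
    HasBracket (U.energyMomentum P h) (Q.current u) (fieldDeriv (Q.current u))
      ((1 - (n : ℂ) / 2) • Q.current u) ((-2 : ℂ) • (Q.k * Q.form Q.x u) • idField) 0 := by
  exact (hasBracket_sugawara_current P h𝔤 hh hk u).add_shift (hasBracket_deriv_x_current hu)
    (U.hasBracket_Lch_current u) (U.hasBracket_Lne_current u)

/-- A ghost field commutes with the Sugawara field and with `∂x`. -/
theorem hasBracket_sugawara_of_ghost (h : ℂ) {c : VertexOperator ℂ Q.State} {γ : ZMod 2}
    (hc : IsHomogField γ c) (hz : ∀ u, HasBracket c (Q.current u) 0 0 0 0) :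
    HasBracket (Q.sugawara P h + fieldDeriv (Q.current Q.x)) c 0 0 0 0 :=
  ((hasBracket_sugawara_of_commute P h hc hz).add_right_zero (hz _).deriv_right_zero).skew_zero
    ((isHomogField_sugawara P h).add isHomogField_deriv_x)

theorem hasBracket_energyMomentum_phi (h : ℂ) (i : U.S) :
    HasBracket (U.energyMomentum P h) (U.phi i) (fieldDeriv (U.phi i))
      ((1 - U.m i) • U.phi i) 0 0 := by
  have hc := U.isChargedSystem.homog_u i
  have h1 := hasBracket_sugawara_of_ghost P h hc (Q.hasBracket_ghost_current _)
  have h2 := U.isChargedSystem.hasBracket_energy_u (fun i => U.m i) i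
  have h3 := (U.hasBracket_Lne_of_commute hc (Q.hasBracket_ghost_neutral _)).skew_zero
    U.isHomogField_Lne
  refine ((h1.add_left h2).add_left h3).congr ?_ ?_ ?_ ?_ <;> simp only [add_zero, zero_add]

theorem hasBracket_energyMomentum_phiDual (h : ℂ) (i : U.S) :
    HasBracket (U.energyMomentum P h) (U.phiDual i) (fieldDeriv (U.phiDual i))
      (U.m i • U.phiDual i) 0 0 := by
  have hc := U.isChargedSystem.homog_v i
  have h1 := hasBracket_sugawara_of_ghost P h hc (Q.hasBracket_ghostDual_current _)
  have h2 := U.isChargedSystem.hasBracket_energy_v (fun i => U.m i) i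
  have h3 := (U.hasBracket_Lne_of_commute hc (Q.hasBracket_ghostDual_neutral _)).skew_zero
    U.isHomogField_Lne
  refine ((h1.add_left h2).add_left h3).congr ?_ ?_ ?_ ?_ <;> simp only [add_zero, zero_add]

theorem hasBracket_energyMomentum_Phi (h : ℂ) (i : U.S') :
    HasBracket (U.energyMomentum P h) (U.Phi i) (fieldDeriv (U.Phi i))
      ((1 / 2 : ℂ) • U.Phi i) 0 0 := by
  have hc : IsHomogField (U.p i) (U.Phi i) :=
    Q.isHomogField_neutral (c := U.half i) (U.mem_homog i)
  have h1 := hasBracket_sugawara_of_ghost P h hc (Q.hasBracket_neutral_current _)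
  have h2 := (U.hasBracket_Lch_of_commute hc (Q.hasBracket_neutral_ghost _)
    (Q.hasBracket_neutral_ghostDual _)).skew_zero U.isHomogField_Lch
  have h3 : HasBracket U.Lne (U.Phi i) _ _ _ _ :=
    isNeutralMap.hasBracket_energy_field U (c := U.half i) (U.mem_homog i)
  refine ((h1.add_left h2).add_left h3).congr ?_ ?_ ?_ ?_ <;> simp only [add_zero, zero_add] <;> rfl

theorem br_x_x : br Q.x Q.x = 0 := by
  have h1 := br_skew Q.x_even Q.x_even
  rw [zero_mul, sgn_zero, one_smul, eq_neg_iff_add_eq_zero, ← two_smul ℂ] at h1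
  exact (smul_eq_zero.1 h1).resolve_left two_ne_zero

theorem hasBracket_deriv_x_deriv_x :
    HasBracket (fieldDeriv (Q.current Q.x)) (fieldDeriv (Q.current Q.x)) 0 0 0
      ((-6 * (Q.k * Q.form Q.x Q.x)) • idField) := by
  have e : Q.current (br Q.x Q.x) = 0 := by rw [br_x_x, ← Q.currentₗ_apply, map_zero]
  exact ((Q.hasBracket_current Q.x Q.x).congr e rfl rfl rfl).deriv_deriv_of_heisenberg

include h𝔤 hh hk in
theorem hasBracket_energyMomentum : HasBracket (U.energyMomentum P h) (U.energyMomentum P h)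
    (fieldDeriv (U.energyMomentum P h)) ((2 : ℂ) • U.energyMomentum P h) 0
    ((Q.k * (∑ i, sgn (P.p i)) / (2 * (Q.k + h)) + -6 * (Q.k * Q.form Q.x Q.x) +
      (∑ i : U.S, sgn (U.p i) * (-6 * U.m i ^ 2 + 6 * U.m i - 1)) +
      -(1 / 4) * ∑ i : U.S', sgn (U.p i)) • idField) := by
  have hA := isHomogField_sugawara P h
  have hAx := hasBracket_sugawara_current P h𝔤 hh hk Q.x
  have hX := isHomogField_deriv_x (Q := Q)
  have hC := U.isHomogField_Lch
  have hN := U.isHomogField_Lne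
  have hCA := hasBracket_sugawara_of_commute P h hC U.hasBracket_Lch_current
  have hNA := hasBracket_sugawara_of_commute P h hN U.hasBracket_Lne_current
  have hCX := (U.hasBracket_Lch_current Q.x).deriv_right_zero
  have hNX := (U.hasBracket_Lne_current Q.x).deriv_right_zero
  have hNC : HasBracket U.Lne U.Lch 0 0 0 0 := U.isChargedSystem.hasBracket_energy_of_commute _ hN
    (fun i => (U.hasBracket_Lne_of_commute (U.isChargedSystem.homog_u i)
      (Q.hasBracket_ghost_neutral _)).skew_zero hN)
    (fun i => (U.hasBracket_Lne_of_commute (U.isChargedSystem.homog_v i)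
      (Q.hasBracket_ghostDual_neutral _)).skew_zero hN)
  exact HasBracket.add_four (hasBracket_sugawara_sugawara P h𝔤 hh hk) hasBracket_deriv_x_deriv_x
    (U.isChargedSystem.hasBracket_energy_energy _) (isNeutralMap.hasBracket_energy_energy U)
    hAx.deriv_right_of_weight_one (hAx.deriv_left_of_weight_one (Q.isHomogField_current Q.x_even))
    (hCA.skew_zero hA) hCA (hNA.skew_zero hA) hNA (hCX.skew_zero hX) hCX (hNX.skew_zero hX) hNX
    (hNC.skew_zero hC) hNC

include h𝔤 hh hk in
theorem isEnergyMomentumField_energyMomentum :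
    IsEnergyMomentumField (U.energyMomentum P h) (U.centralCharge h) := by
  refine (U.hasBracket_energyMomentum P h𝔤 hh hk).isEnergyMomentumField
    (U.isHomogField_energyMomentum P h) ?_
  have e : ∑ i : U.S, sgn (U.p i) * (-6 * U.m i ^ 2 + 6 * U.m i - 1) =
      -(1 / 2) * ∑ i : U.S, sgn (U.p i) * (12 * U.m i ^ 2 - 12 * U.m i + 2) := by
    rw [Finset.mul_sum]
    exact Finset.sum_congr rfl fun i _ => by ring
  rw [P.sum_sgn, U.sum_sgn, e, centralCharge]
  field_simp
  ring

/-- The form is zero between `x` and `𝔤_j` for `j ≠ 0`, by invariance. -/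
theorem form_x_eq_zero {n : ℤ} {u : 𝔤} (hu : u ∈ eigen Q.x n) (hn : n ≠ 0) :
    Q.form Q.x u = 0 := by
  have h1 := Q.form_invariant Q.x Q.x u
  rw [br_x_x, map_zero, LinearMap.zero_apply, Module.End.mem_eigenspace_iff.1 hu, map_smul,
    smul_eq_mul] at h1
  refine (mul_eq_zero.1 h1.symm).resolve_left ?_
  simpa using hn

include h𝔤 hh hk in
theorem hasConformalWeight_current {n : ℤ} {u : 𝔤} (hu : u ∈ eigen Q.x n) :
    HasConformalWeight (U.energyMomentum P h) (Q.current u) (1 - (n : ℂ) / 2) :=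
  (U.hasBracket_energyMomentum_current P h𝔤 hh hk hu).hasConformalWeight

include h𝔤 hh hk in
theorem isPrimary_current {n : ℤ} {u : 𝔤} (hu : u ∈ eigen Q.x n)
    (hn : ¬(n = 0 ∧ Q.form Q.x u ≠ 0)) :
    IsPrimary (U.energyMomentum P h) (Q.current u) (1 - (n : ℂ) / 2) := by
  have hx : Q.form Q.x u = 0 := by
    by_contra hx
    exact hx (form_x_eq_zero hu fun h0 => hn ⟨h0, hx⟩)
  exact (U.hasBracket_energyMomentum_current P h𝔤 hh hk hu).isPrimary_of_eq_zero
    (by rw [hx, mul_zero])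

end AdaptedBasis

end Datum

end QuantumReduction

end

open QuantumReduction in
theorem theorem2p2 {𝔤 : Type*} [AddCommGroup 𝔤] [Module ℂ 𝔤] [FiniteDimensional ℂ 𝔤]
    [LieSuperalgebra 𝔤] (h𝔤 : IsSimple 𝔤) (Q : Datum 𝔤)
    {J : Type*} [Fintype J] [DecidableEq J] (P : Q.DualPair J)
    {I : Type*} [Fintype I] [DecidableEq I] (U : Q.AdaptedBasis I)
    (h : ℂ) (hh : Q.IsDualCoxeterNumber P h) (hk : Q.k + h ≠ 0) :
    U.energyMomentum P h ∈ Q.vertexAlgebra ∧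
    IsEnergyMomentumField (U.energyMomentum P h) (U.centralCharge h) ∧
    (∀ i : U.S, IsPrimary (U.energyMomentum P h) (U.phi i) (1 - U.m i) ∧
      IsPrimary (U.energyMomentum P h) (U.phiDual i) (U.m i)) ∧
    (∀ i : U.S', IsPrimary (U.energyMomentum P h) (U.Phi i) (1 / 2)) ∧
    (∀ (n : ℤ) (u : 𝔤), u ∈ eigen Q.x n →
      HasConformalWeight (U.energyMomentum P h) (Q.current u) (1 - (n : ℂ) / 2) ∧
      (¬(n = 0 ∧ Q.form Q.x u ≠ 0) →
        IsPrimary (U.energyMomentum P h) (Q.current u) (1 - (n : ℂ) / 2))) := by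
  exact ⟨U.energyMomentum_mem P h, U.isEnergyMomentumField_energyMomentum P h𝔤 hh hk,
    fun i => ⟨(U.hasBracket_energyMomentum_phi P h i).isPrimary,
      (U.hasBracket_energyMomentum_phiDual P h i).isPrimary⟩,
    fun i => (U.hasBracket_energyMomentum_Phi P h i).isPrimary,
    fun _ _ hu => ⟨U.hasConformalWeight_current P h𝔤 hh hk hu,
      U.isPrimary_current P h𝔤 hh hk hu⟩⟩
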